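/- Let $m,n\ge 2$ be even integers with $mn\ge 6$. **The surface $X_{m,n}$.** Let $\mathcal G_{m,n}$ be the graph with vertices $v_{i,j}$ ($0<i<m$, $0<j<n$), two vertices being joined by an edge when $(i,j)$ and $(k,l)$ are at Euclidean distance $1$. Each edge $e$ has one end $\alpha(e)$ with even coordinate sum and one end $\beta(e)$ with odd coordinate sum. Order the edges around $v_{i,j}$ cyclically, clockwise in $\mathbb R^2$ if $i$ is even and counter-clockwise if $i$ is odd; let $\mathfrak e(e)$ be the next edge around $\alpha(e)$ and $\mathfrak n(e)$ the next edge around $\beta(e)$. Put $w(v_{i,j})=\sin\frac{i\pi}{m}\sin\frac{j\pi}{n}$. The translation surface $(X_{m,n},\omega_{m,n})$ is glued from the rectangles $R_e=[0,w(\beta(e))]\times[0,w(\alpha(e))]$ by identifying, by translations, the right side of $R_e$ with the left side of $R_{\mathfrak e(e)}$ and the top side of $R_e$ with the bottom side of $R_{\mathfrak n(e)}$. As $m$ and $n$ are even, the graph automorphism $v_{i,j}\mapsto v_{m-i,n-j}$ induces an involution $\iota_*$ of $X_{m,n}$ permuting the rectangles by translations; let $(X^e_{m,n},\omega^e_{m,n})=(X_{m,n},\omega_{m,n})/\iota_*$.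 **The surface $Y_{m,n}$.** Let $P_n(a,b)$ be the convex $2n$-gon whose counter-clockwise edge vectors are $\mathbf v_i=a(\cos\frac{i\pi}{n},\sin\frac{i\pi}{n})$ for $i$ even and $\mathbf v_i=b(\cos\frac{i\pi}{n},\sin\frac{i\pi}{n})$ for $i$ odd, $0\le i<2n$ (edges of length $0$ are allowed). For $0\le k<m$ let $P(k)=P_n(\sin\frac{k\pi}{m},\sin\frac{(k+1)\pi}{m})$ if $k$ is even and $P(k)=P_n(\sin\frac{(k+1)\pi}{m},\sin\frac{k\pi}{m})$ if $k$ is odd. The translation surface $(Y_{m,n},\eta_{m,n})$ is glued from $P(0),\dots,P(m-1)$: for $k$ odd, the even sides of $P(k)$ are identified by translations with the opposite sides of $P(k+1)$ (if $k+1<m$), and the odd sides of $P(k)$ with the opposite sides of $P(k-1)$. Let $\iota'_*$ be the involution of $Y_{m,n}$ that interchanges $P(k)$ and $P(m-1-k)$ by translation for all $k$, and let $(Y^e_{m,n},\eta^e_{m,n})=(Y_{m,n},\eta_{m,n})/\iota'_*$. The surfaces $Y_{n,m}$ and $Y^e_{n,m}$ are defined in the same way with $m$ and $n$ exchanged. A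 homeomorphism $f$ between translation surfaces is *affine with derivative* $D(f)\in GL(2,\mathbb R)$ if in the local charts given by the $1$-forms, away from their zeros, it has the form $v\mapsto D(f)v+c$ with $c$ locally constant. **Statement.** There are affine homeomorphisms $\mu:(X_{m,n},\omega_{m,n})\to(Y_{m,n},\eta_{m,n})$ and $\mu^e:(X^e_{m,n},\omega^e_{m,n})\to(Y^e_{m,n},\eta^e_{m,n})$ with $$D(\mu^e)=D(\mu)=\begin{pmatrix}\csc\frac{\pi}{n}&-\cot\frac{\pi}{n}\\0&1\end{pmatrix},$$ and there are affine homeomorphisms $\nu:(X_{m,n},\omega_{m,n})\to(Y_{n,m},\eta_{n,m})$ and $\nu^e:(X^e_{m,n},\omega^e_{m,n})\to(Y^e_{n,m},\eta^e_{n,m})$ with $$D(\nu^e)=D(\nu)=\begin{pmatrix}-\csc\frac{\pi}{m}&-\cot\frac{\pi}{m}\\0&1\end{pmatrix}.$$ -/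

import Mathlib

open Topology

/-- The Euclidean plane, with its two coordinates. -/
abbrev Plane : Type := Fin 2 → ℝ

/-! ### Surfaces glued from plane regions, and affine homeomorphisms -/

/-- A surface obtained by gluing finitely many compact convex plane regions: `param` restricts on
each region to the map onto the corresponding piece of the surface, and the surface carries the
quotient topology. -/
structure TiledSurface where
  Point : Type
  [top : TopologicalSpace Point]
  Tile : Type
  [finite_tile : Finite Tile]
  region : Tile → Set Plane
  isCompact_region : ∀ i, IsCompact (region i)
  convex_region : ∀ i, Convex ℝ (region i)
  param : (Σ i, region i) → Point
  isQuotientMap_param : IsQuotientMap param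

namespace TiledSurface

instance (S : TiledSurface) : TopologicalSpace S.Point := S.top

/-- The local charts of the translation structure: homeomorphisms `φ` from an open subset of the
surface onto an open subset of the plane which, read in the coordinates of any of the glued
regions, are locally translations. At a cone point whose angle is not `2π` there is no such
chart. -/
def IsTranslationChart (S : TiledSurface) (φ : OpenPartialHomeomorph S.Point Plane) : Prop :=
  ∀ (i : S.Tile) (x : S.region i), S.param ⟨i, x⟩ ∈ φ.source →
    ∀ᶠ y in 𝓝 x, φ (S.param ⟨i, y⟩) - φ (S.param ⟨i, x⟩) = (y : Plane) - (x : Plane)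

/-- A nonsingular point of the surface: one that lies in the domain of a chart. -/
def IsRegularPoint (S : TiledSurface) (p : S.Point) : Prop :=
  ∃ φ : OpenPartialHomeomorph S.Point Plane, S.IsTranslationChart φ ∧ p ∈ φ.source

/-- The homeomorphism `f` is affine with derivative `D`: in all local charts of the two translation
structures it has locally the form `v ↦ D v + c`. The second clause records that, outside a finite
set of points `p` (the zeros of the `1`-forms), both `p` and `f p` do have charts around them. -/
structure IsAffineHomeo (S T : TiledSurface) (f : S.Point ≃ₜ T.Point)
    (D : Matrix (Fin 2) (Fin 2) ℝ) : Prop where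
  affine_in_charts : ∀ (φ : OpenPartialHomeomorph S.Point Plane)
    (ψ : OpenPartialHomeomorph T.Point Plane),
    S.IsTranslationChart φ → T.IsTranslationChart ψ →
    ∀ p ∈ φ.source, f p ∈ ψ.source →
      ∃ c : Plane, ∀ᶠ q in 𝓝 p, ψ (f q) = D.mulVec (φ q) + c
  finite_singular : {p : S.Point | ¬ (S.IsRegularPoint p ∧ T.IsRegularPoint (f p))}.Finite

/-- The quotient of a surface by the group generated by a self-homeomorphism `f`, tiled by the
images of the regions of the surface. -/
def quotient (S : TiledSurface) (f : S.Point ≃ₜ S.Point) : TiledSurface where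
  Point := Quot fun x y : S.Point => f x = y
  Tile := S.Tile
  finite_tile := S.finite_tile
  region := S.region
  isCompact_region := S.isCompact_region
  convex_region := S.convex_region
  param := fun x => Quot.mk _ (S.param x)
  isQuotientMap_param := isQuotientMap_quot_mk.comp S.isQuotientMap_param

end TiledSurface

/-! ### The grid graph as a bipartite ribbon graph -/

/-- `v = (i, j)` is a vertex of the `(m, n)` grid graph: `0 < i < m` and `0 < j < n`. -/
def IsGridNode (m n : ℕ) (v : ℤ × ℤ) : Prop :=
  0 < v.1 ∧ v.1 < m ∧ 0 < v.2 ∧ v.2 < n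

instance (m n : ℕ) (v : ℤ × ℤ) : Decidable (IsGridNode m n v) := by
  unfold IsGridNode; infer_instance

/-- An edge of the `(m, n)` grid graph, given by its end `a` with even coordinate sum and its end
`b` with odd coordinate sum. -/
@[ext]
structure GridEdge (m n : ℕ) where
  a : ℤ × ℤ
  b : ℤ × ℤ
  a_node : IsGridNode m n a
  b_node : IsGridNode m n b
  a_even : Even (a.1 + a.2)
  b_odd : Odd (b.1 + b.2)
  dist_one : (a.1 - b.1) ^ 2 + (a.2 - b.2) ^ 2 = 1

instance (m n : ℕ) : Finite (GridEdge m n) := by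
  let I := Set.Icc ((0, 0) : ℤ × ℤ) ((m : ℤ), (n : ℤ))
  have hI : ∀ v, IsGridNode m n v → v ∈ I := fun v hv =>
    ⟨⟨hv.1.le, hv.2.2.1.le⟩, ⟨hv.2.1.le, hv.2.2.2.le⟩⟩
  have : Finite I := (Set.finite_Icc _ _).to_subtype
  refine Finite.of_injective
    (fun e : GridEdge m n => ((⟨e.a, hI _ e.a_node⟩ : I), (⟨e.b, hI _ e.b_node⟩ : I))) ?_
  intro e e' h
  simp only [Prod.mk.injEq, Subtype.mk.injEq] at h
  exact GridEdge.ext h.1 h.2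

/-- Quarter turn of a direction: clockwise if `i` is even, counter-clockwise if `i` is odd. -/
def turn (i : ℤ) (d : ℤ × ℤ) : ℤ × ℤ := if Even i then (d.2, -d.1) else (-d.2, d.1)

/-- Starting from the direction `d` at a vertex whose first coordinate has the parity of `i`, turn
by quarter turns in the sense of `turn i` until the next direction that satisfies `P` is reached;
the fourth quarter turn leads back to `d`. -/
def nextDir (P : ℤ × ℤ → Prop) [DecidablePred P] (i : ℤ) (d : ℤ × ℤ) : ℤ × ℤ :=
  if P (turn i d) then turn i d
  else if P (turn i (turn i d)) then turn i (turn i d)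
  else if P (turn i (turn i (turn i d))) then turn i (turn i (turn i d))
  else d

theorem turn_succ_turn (i : ℤ) (d : ℤ × ℤ) : turn (i + 1) (turn i d) = d := by
  have h' : Even (i + 1) ↔ ¬ Even i := Int.even_add_one
  by_cases h : Even i <;> simp only [turn, h', h] <;> simp

theorem turn_turn_succ (i : ℤ) (d : ℤ × ℤ) : turn i (turn (i + 1) d) = d := by
  have h' : Even (i + 1) ↔ ¬ Even i := Int.even_add_one
  by_cases h : Even i <;> simp only [turn, h', h] <;> simp

theorem turn_turn (i j : ℤ) (d : ℤ × ℤ) : turn i (turn i d) = turn j (turn j d) := by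
  by_cases h : Even i <;> by_cases h' : Even j <;> simp [turn, h, h']

theorem turn_four (i : ℤ) (d : ℤ × ℤ) : turn i (turn i (turn i (turn i d))) = d := by
  by_cases h : Even i <;> simp [turn, h]

theorem turn_neg (i : ℤ) (d : ℤ × ℤ) : turn i (-d) = -turn i d := by
  by_cases h : Even i <;> ext <;> simp [turn, h]

theorem nextDir_prop {P : ℤ × ℤ → Prop} [DecidablePred P] (i : ℤ) {d : ℤ × ℤ} (hd : P d) :
    P (nextDir P i d) := by
  unfold nextDir; split_ifs <;> assumption

theorem nextDir_norm (P : ℤ × ℤ → Prop) [DecidablePred P] (i : ℤ) (d : ℤ × ℤ) :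
    (nextDir P i d).1 ^ 2 + (nextDir P i d).2 ^ 2 = d.1 ^ 2 + d.2 ^ 2 := by
  have h : ∀ d : ℤ × ℤ, (turn i d).1 ^ 2 + (turn i d).2 ^ 2 = d.1 ^ 2 + d.2 ^ 2 := by
    intro d; by_cases h : Even i <;> simp [turn, h] <;> ring
  unfold nextDir; split_ifs <;> simp only [h]

theorem nextDir_succ_nextDir (P : ℤ × ℤ → Prop) [DecidablePred P] (i : ℤ) {d : ℤ × ℤ} (hd : P d) :
    nextDir P (i + 1) (nextDir P i d) = d := by
  have h4 : turn (i + 1) d = turn i (turn i (turn i d)) := by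
    rw [← turn_four i d, turn_succ_turn, turn_four]
  unfold nextDir
  split_ifs <;> simp_all [turn_succ_turn]

theorem nextDir_nextDir_succ (P : ℤ × ℤ → Prop) [DecidablePred P] (i : ℤ) {d : ℤ × ℤ} (hd : P d) :
    nextDir P i (nextDir P (i + 1) d) = d := by
  have h4 : turn i d = turn (i + 1) (turn (i + 1) (turn (i + 1) d)) := by
    rw [← turn_four (i + 1) d, turn_turn_succ, turn_four]
  unfold nextDir
  split_ifs <;> simp_all [turn_turn_succ]

theorem nextDir_neg {P Q : ℤ × ℤ → Prop} [DecidablePred P] [DecidablePred Q]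
    (hPQ : ∀ d, Q (-d) ↔ P d) {i j : ℤ} (hij : Even i ↔ Even j) (d : ℤ × ℤ) :
    nextDir Q j (-d) = -nextDir P i d := by
  have h : turn j = turn i := by funext d; simp [turn, hij]
  simp only [nextDir, h, turn_neg, hPQ]
  split_ifs <;> rfl

theorem odd_add_of_sq_add_sq {x y : ℤ} (h : x ^ 2 + y ^ 2 = 1) : Odd (x + y) := by
  have h1 : Odd (x ^ 2 + y ^ 2) := by rw [h]; exact odd_one
  rw [Int.odd_add] at h1 ⊢
  simpa [Int.odd_pow, Int.even_pow] using h1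

namespace GridEdge

variable {m n : ℕ}

/-- The next edge around the even end of `e`; the sense of rotation is given by the parity of the
first coordinate of that end, reversed if `s = 1`. -/
def rotA (s : ℤ) (e : GridEdge m n) : GridEdge m n :=
  let d := nextDir (fun d => IsGridNode m n (e.a + d)) (e.a.1 + s) (e.b - e.a)
  have hd : d.1 ^ 2 + d.2 ^ 2 = 1 := by
    rw [nextDir_norm, ← e.dist_one]; simp only [Prod.fst_sub, Prod.snd_sub]; ring
  { a := e.a
    b := e.a + d
    a_node := e.a_node
    b_node := nextDir_prop (P := fun d => IsGridNode m n (e.a + d)) _ (by simpa using e.b_node)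
    a_even := e.a_even
    b_odd := by
      have h := e.a_even.add_odd (odd_add_of_sq_add_sq hd)
      rwa [Prod.fst_add, Prod.snd_add, add_add_add_comm]
    dist_one := by simp only [Prod.fst_add, Prod.snd_add]; linarith }

/-- The next edge around the odd end of `e`; the sense of rotation is given by the parity of the
first coordinate of that end, reversed if `s = 1`. -/
def rotB (s : ℤ) (e : GridEdge m n) : GridEdge m n :=
  let d := nextDir (fun d => IsGridNode m n (e.b + d)) (e.b.1 + s) (e.a - e.b)
  have hd : d.1 ^ 2 + d.2 ^ 2 = 1 := by
    rw [nextDir_norm, ← e.dist_one]; simp only [Prod.fst_sub, Prod.snd_sub]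
  { a := e.b + d
    b := e.b
    a_node := nextDir_prop (P := fun d => IsGridNode m n (e.b + d)) _ (by simpa using e.a_node)
    b_node := e.b_node
    a_even := by
      have h := e.b_odd.add_odd (odd_add_of_sq_add_sq hd)
      rwa [Prod.fst_add, Prod.snd_add, add_add_add_comm]
    b_odd := e.b_odd
    dist_one := by simp only [Prod.fst_add, Prod.snd_add]; linarith }

/-- The permutation `east`: its cycles run through the edges at the vertices with even coordinate
sum. -/
def east : Equiv.Perm (GridEdge m n) where
  toFun := rotA 0
  invFun := rotA 1
  left_inv e := by
    apply GridEdge.ext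
    · rfl
    · simp only [rotA, add_zero, add_sub_cancel_left]
      rw [nextDir_succ_nextDir _ _ (by simpa using e.b_node)]
      simp
  right_inv e := by
    apply GridEdge.ext
    · rfl
    · simp only [rotA, add_zero, add_sub_cancel_left]
      rw [nextDir_nextDir_succ _ _ (by simpa using e.b_node)]
      simp

/-- The permutation `north`: its cycles run through the edges at the vertices with odd coordinate
sum. -/
def north : Equiv.Perm (GridEdge m n) where
  toFun := rotB 0
  invFun := rotB 1
  left_inv e := by
    apply GridEdge.ext
    · simp only [rotB, add_zero, add_sub_cancel_left]
      rw [nextDir_succ_nextDir _ _ (by simpa using e.a_node)]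
      simp
    · rfl
  right_inv e := by
    apply GridEdge.ext
    · simp only [rotB, add_zero, add_sub_cancel_left]
      rw [nextDir_nextDir_succ _ _ (by simpa using e.a_node)]
      simp
    · rfl

end GridEdge

/-! ### The surface glued from rectangles -/

noncomputable section

/-- The positive eigenfunction `w(v_{i,j}) = sin(iπ/m) sin(jπ/n)` of the grid graph. -/
def gridWeight (m n : ℕ) (v : ℤ × ℤ) : ℝ :=
  Real.sin (v.1 * Real.pi / m) * Real.sin (v.2 * Real.pi / n)

/-- The rectangle `[0, w(b)] × [0, w(a)]` of the edge with even end `a` and odd end `b`. -/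
def gridRect {m n : ℕ} (e : GridEdge m n) : Set Plane :=
  Set.Icc ![0, 0] ![gridWeight m n e.b, gridWeight m n e.a]

/-- The right side of the rectangle of `e` is glued to the left side of that of `east e`, and the
top side to the bottom side of that of `north e`. -/
inductive RectGlue (m n : ℕ) :
    (Σ e : GridEdge m n, gridRect e) → (Σ e : GridEdge m n, gridRect e) → Prop
  | right_left (e : GridEdge m n) (p : gridRect e) (q : gridRect e.east)
      (hp : p.1 0 = gridWeight m n e.b) (hq : q.1 0 = 0) (h : q.1 1 = p.1 1) :
      RectGlue m n ⟨e, p⟩ ⟨e.east, q⟩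
  | top_bottom (e : GridEdge m n) (p : gridRect e) (q : gridRect e.north)
      (hp : p.1 1 = gridWeight m n e.a) (hq : q.1 1 = 0) (h : q.1 0 = p.1 0) :
      RectGlue m n ⟨e, p⟩ ⟨e.north, q⟩

/-- The surface `(X_{m,n}, ω_{m,n})`. -/
def surfaceX (m n : ℕ) : TiledSurface where
  Point := Quot (RectGlue m n)
  Tile := GridEdge m n
  region := gridRect
  isCompact_region _ := isCompact_Icc
  convex_region _ := convex_Icc _ _
  param := Quot.mk _
  isQuotientMap_param := isQuotientMap_quot_mk

/-- The map `v_{i,j} ↦ v_{m-i,n-j}` on vertices. -/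
def iotaNode (m n : ℕ) (v : ℤ × ℤ) : ℤ × ℤ := (m - v.1, n - v.2)

theorem isGridNode_iotaNode {m n : ℕ} {v : ℤ × ℤ} :
    IsGridNode m n (iotaNode m n v) ↔ IsGridNode m n v := by
  unfold IsGridNode iotaNode; constructor <;> rintro ⟨h1, h2, h3, h4⟩ <;> simp at * <;> omega

theorem iotaNode_add (m n : ℕ) (v d : ℤ × ℤ) : iotaNode m n (v + d) = iotaNode m n v + -d := by
  ext <;> simp [iotaNode] <;> ring

theorem iotaNode_iotaNode (m n : ℕ) (v : ℤ × ℤ) : iotaNode m n (iotaNode m n v) = v := by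
  ext <;> simp [iotaNode]

theorem gridWeight_iotaNode {m n : ℕ} {v : ℤ × ℤ} (hv : IsGridNode m n v) :
    gridWeight m n (iotaNode m n v) = gridWeight m n v := by
  obtain ⟨h1, h2, h3, h4⟩ := hv
  have hm : (m : ℝ) ≠ 0 := by have : 0 < m := by omega
                              positivity
  have hn : (n : ℝ) ≠ 0 := by have : 0 < n := by omega
                              positivity
  have key : ∀ (N : ℕ) (i : ℤ), (N : ℝ) ≠ 0 →
      Real.sin (((N - i : ℤ) : ℝ) * Real.pi / N) = Real.sin (i * Real.pi / N) := by
    intro N i hN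
    rw [← Real.sin_pi_sub]
    congr 1; push_cast; field_simp; ring
  simp only [gridWeight, iotaNode, key m _ hm, key n _ hn]

theorem even_nat_sub {k : ℕ} (hk : Even k) (i : ℤ) : Even ((k : ℤ) - i) ↔ Even i := by
  have : Even (k : ℤ) := by exact_mod_cast hk
  simp [Int.even_sub, this]

namespace GridEdge

variable {m n : ℕ}

/-- The graph automorphism `ι` on edges; for `m` and `n` even it preserves the two vertex
classes. -/
def iota (hm : Even m) (hn : Even n) (e : GridEdge m n) : GridEdge m n where
  a := iotaNode m n e.a
  b := iotaNode m n e.b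
  a_node := isGridNode_iotaNode.2 e.a_node
  b_node := isGridNode_iotaNode.2 e.b_node
  a_even := by
    have h := e.a_even
    simp only [iotaNode]
    rw [Int.even_add] at h ⊢
    rwa [even_nat_sub hm, even_nat_sub hn]
  b_odd := by
    have h := e.b_odd
    simp only [iotaNode]
    rw [← Int.not_even_iff_odd, Int.even_add] at h ⊢
    rwa [even_nat_sub hm, even_nat_sub hn]
  dist_one := by rw [← e.dist_one]; simp only [iotaNode]; ring

theorem iota_iota (hm : Even m) (hn : Even n) (e : GridEdge m n) :
    (e.iota hm hn).iota hm hn = e :=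
  GridEdge.ext (iotaNode_iotaNode _ _ _) (iotaNode_iotaNode _ _ _)

theorem iotaNode_sub (v u : ℤ × ℤ) : iotaNode m n u - iotaNode m n v = -(u - v) := by
  ext <;> simp [iotaNode]

theorem iota_east (hm : Even m) (hn : Even n) (e : GridEdge m n) :
    (e.iota hm hn).east = e.east.iota hm hn := by
  apply GridEdge.ext
  · rfl
  · simp only [east, Equiv.coe_fn_mk, rotA, iota, iotaNode_add]
    rw [iotaNode_sub, nextDir_neg (P := fun d => IsGridNode m n (e.a + d)) (i := e.a.1 + 0)]
    · intro d; rw [← iotaNode_add, isGridNode_iotaNode]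
    · simp only [add_zero, iotaNode]; exact (even_nat_sub hm _).symm

theorem iota_north (hm : Even m) (hn : Even n) (e : GridEdge m n) :
    (e.iota hm hn).north = e.north.iota hm hn := by
  apply GridEdge.ext
  · simp only [north, Equiv.coe_fn_mk, rotB, iota, iotaNode_add]
    rw [iotaNode_sub, nextDir_neg (P := fun d => IsGridNode m n (e.b + d)) (i := e.b.1 + 0)]
    · intro d; rw [← iotaNode_add, isGridNode_iotaNode]
    · simp only [add_zero, iotaNode]; exact (even_nat_sub hm _).symm
  · rfl

theorem gridRect_iota (hm : Even m) (hn : Even n) (e : GridEdge m n) :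
    gridRect (e.iota hm hn) = gridRect e := by
  simp only [gridRect, iota, gridWeight_iotaNode e.a_node, gridWeight_iotaNode e.b_node]

end GridEdge

/-- The permutation of the rectangles by `ι`, on their disjoint union. -/
def iotaRect {m n : ℕ} (hm : Even m) (hn : Even n) (x : Σ e : GridEdge m n, gridRect e) :
    Σ e : GridEdge m n, gridRect e :=
  ⟨x.1.iota hm hn, ⟨x.2.1, (GridEdge.gridRect_iota hm hn x.1).symm ▸ x.2.2⟩⟩

theorem rectGlue_iotaRect {m n : ℕ} (hm : Even m) (hn : Even n)
    {x y : Σ e : GridEdge m n, gridRect e} (h : RectGlue m n x y) :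
    RectGlue m n (iotaRect hm hn x) (iotaRect hm hn y) := by
  have cast : ∀ (e e' : GridEdge m n) (_ : e = e') (v : Plane) (hv : v ∈ gridRect e)
      (hv' : v ∈ gridRect e'),
      (⟨e, ⟨v, hv⟩⟩ : Σ e : GridEdge m n, gridRect e) = ⟨e', ⟨v, hv'⟩⟩ := by
    rintro e _ rfl v hv hv'; rfl
  cases h with
  | right_left e p q hp hq h =>
    have hq' : q.1 ∈ gridRect (e.iota hm hn).east := by
      rw [GridEdge.iota_east, GridEdge.gridRect_iota]; exact q.2
    have := RectGlue.right_left (e.iota hm hn) (iotaRect hm hn ⟨e, p⟩).2 ⟨q.1, hq'⟩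
      (by rw [← gridWeight_iotaNode e.b_node] at hp; exact hp) hq h
    rwa [cast _ _ (GridEdge.iota_east hm hn e) q.1 hq' (iotaRect hm hn ⟨e.east, q⟩).2.2] at this
  | top_bottom e p q hp hq h =>
    have hq' : q.1 ∈ gridRect (e.iota hm hn).north := by
      rw [GridEdge.iota_north, GridEdge.gridRect_iota]; exact q.2
    have := RectGlue.top_bottom (e.iota hm hn) (iotaRect hm hn ⟨e, p⟩).2 ⟨q.1, hq'⟩
      (by rw [← gridWeight_iotaNode e.a_node] at hp; exact hp) hq h
    rwa [cast _ _ (GridEdge.iota_north hm hn e) q.1 hq' (iotaRect hm hn ⟨e.north, q⟩).2.2] at this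

theorem iotaRect_iotaRect {m n : ℕ} (hm : Even m) (hn : Even n)
    (x : Σ e : GridEdge m n, gridRect e) : iotaRect hm hn (iotaRect hm hn x) = x := by
  obtain ⟨e, v, hv⟩ := x
  have cast : ∀ (e e' : GridEdge m n) (_ : e = e') (v : Plane) (hv : v ∈ gridRect e)
      (hv' : v ∈ gridRect e'),
      (⟨e, ⟨v, hv⟩⟩ : Σ e : GridEdge m n, gridRect e) = ⟨e', ⟨v, hv'⟩⟩ := by
    rintro e _ rfl v hv hv'; rfl
  exact cast _ _ (GridEdge.iota_iota hm hn e) _ _ _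

theorem continuous_iotaRect {m n : ℕ} (hm : Even m) (hn : Even n) :
    Continuous (iotaRect (m := m) (n := n) hm hn) := by
  refine continuous_sigma fun e => ?_
  have h : ∀ v : gridRect e, (v : Plane) ∈ gridRect (e.iota hm hn) := fun v =>
    (GridEdge.gridRect_iota hm hn e).symm ▸ v.2
  exact (continuous_sigmaMk (σ := fun e : GridEdge m n => gridRect e)).comp
    (continuous_subtype_val.subtype_mk h)

/-- The automorphism `ι_*` of `X_{m,n}` for `m` and `n` even, which permutes the rectangles
according to `ι`. -/
def iotaStar {m n : ℕ} (hm : Even m) (hn : Even n) :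
    (surfaceX m n).Point ≃ₜ (surfaceX m n).Point where
  toFun := Quot.map (iotaRect hm hn) fun _ _ => rectGlue_iotaRect hm hn
  invFun := Quot.map (iotaRect hm hn) fun _ _ => rectGlue_iotaRect hm hn
  left_inv x := by
    induction x using Quot.ind
    simp only [Quot.map, iotaRect_iotaRect]; rfl
  right_inv x := by
    induction x using Quot.ind
    simp only [Quot.map, iotaRect_iotaRect]; rfl
  continuous_toFun :=
    continuous_quot_lift _ (continuous_quot_mk.comp (continuous_iotaRect hm hn))
  continuous_invFun :=
    continuous_quot_lift _ (continuous_quot_mk.comp (continuous_iotaRect hm hn))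

/-- The quotient `(X^e_{m,n}, ω^e_{m,n})` of `X_{m,n}` by `ι_*`, for `m` and `n` even. -/
def surfaceXe {m n : ℕ} (hm : Even m) (hn : Even n) : TiledSurface :=
  (surfaceX m n).quotient (iotaStar hm hn)

/-! ### The surface glued from semiregular polygons -/

/-- The edge vectors of the `(a, b)`-semiregular `2n`-gon. -/
def semiEdge (n : ℕ) (a b : ℝ) (i : ℕ) : Plane :=
  (if Even i then a else b) • ![Real.cos (i * Real.pi / n), Real.sin (i * Real.pi / n)]

/-- The `i`-th vertex of the `(a, b)`-semiregular `2n`-gon, placed with its vertex `0` at the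
origin; side `i` runs from vertex `i` to vertex `i + 1`. -/
def semiVertex (n : ℕ) (a b : ℝ) (i : ℕ) : Plane :=
  ∑ j ∈ Finset.range i, semiEdge n a b j

/-- The `(a, b)`-semiregular `2n`-gon. -/
def semiPolygon (n : ℕ) (a b : ℝ) : Set Plane :=
  convexHull ℝ (Set.range fun i : Fin (2 * n) => semiVertex n a b i)

/-- The length of the even edges of the polygon `P(k)`. -/
def evenLen (m n k : ℕ) : ℝ :=
  if Odd n ∨ Odd k then Real.sin ((k + 1) * Real.pi / m) else Real.sin (k * Real.pi / m)

/-- The length of the odd edges of the polygon `P(k)`. -/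
def oddLen (m n k : ℕ) : ℝ :=
  if Odd n ∨ Odd k then Real.sin (k * Real.pi / m) else Real.sin ((k + 1) * Real.pi / m)

/-- The polygon `P(k)`. -/
def polyP (m n k : ℕ) : Set Plane :=
  semiPolygon n (evenLen m n k) (oddLen m n k)

/-- The point at parameter `t ∈ [0, 1]` of side `i` of `P(k)`, in counter-clockwise direction. -/
def sidePoint (m n k i : ℕ) (t : ℝ) : Plane :=
  semiVertex n (evenLen m n k) (oddLen m n k) i + t • semiEdge n (evenLen m n k) (oddLen m n k) i

/-- For `k` odd, the even sides of `P(k)` are glued to the opposite sides of `P(k+1)`, and the odd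
sides of `P(k)` to the opposite sides of `P(k-1)`. -/
inductive PolyGlue (m n : ℕ) :
    (Σ k : Fin m, polyP m n k) → (Σ k : Fin m, polyP m n k) → Prop
  | even_side (k k' : Fin m) (p : polyP m n k) (q : polyP m n k') (hk : Odd (k : ℕ))
      (hk' : (k' : ℕ) = k + 1) (i : ℕ) (hi : i < 2 * n) (hi' : Even i)
      (t : ℝ) (ht : t ∈ Set.Icc (0 : ℝ) 1)
      (hp : p.1 = sidePoint m n k i t)
      (hq : q.1 = sidePoint m n k' ((i + n) % (2 * n)) (1 - t)) :
      PolyGlue m n ⟨k, p⟩ ⟨k', q⟩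
  | odd_side (k k' : Fin m) (p : polyP m n k) (q : polyP m n k') (hk : Odd (k : ℕ))
      (hk' : (k' : ℕ) + 1 = k) (i : ℕ) (hi : i < 2 * n) (hi' : Odd i)
      (t : ℝ) (ht : t ∈ Set.Icc (0 : ℝ) 1)
      (hp : p.1 = sidePoint m n k i t)
      (hq : q.1 = sidePoint m n k' ((i + n) % (2 * n)) (1 - t)) :
      PolyGlue m n ⟨k, p⟩ ⟨k', q⟩

/-- The surface `(Y_{m,n}, η_{m,n})`. -/
def surfaceY (m n : ℕ) : TiledSurface where
  Point := Quot (PolyGlue m n)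
  Tile := Fin m
  region k := polyP m n k
  isCompact_region _ := (Set.finite_range _).isCompact_convexHull _
  convex_region _ := convex_convexHull ℝ _
  param := Quot.mk _
  isQuotientMap_param := isQuotientMap_quot_mk

theorem sin_rev {m : ℕ} (k : Fin m) :
    Real.sin (((Fin.rev k : ℕ) : ℝ) * Real.pi / m) = Real.sin (((k : ℕ) + 1) * Real.pi / m) ∧
    Real.sin ((((Fin.rev k : ℕ) : ℝ) + 1) * Real.pi / m) = Real.sin ((k : ℕ) * Real.pi / m) := by
  have hm : (m : ℝ) ≠ 0 := by
    have := k.pos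
    positivity
  have h : ((Fin.rev k : ℕ) : ℝ) = m - (k + 1) := by
    rw [Fin.val_rev, Nat.cast_sub k.2]; push_cast; ring
  constructor <;> rw [← Real.sin_pi_sub, h] <;> congr 1 <;> field_simp <;> ring

theorem odd_rev {m : ℕ} (hm : Even m) (k : Fin m) : Odd (Fin.rev k : ℕ) ↔ ¬ Odd (k : ℕ) := by
  rw [Fin.val_rev, Nat.odd_sub (by omega)]
  simp [← Nat.not_even_iff_odd, hm, Nat.even_add_one]

theorem evenLen_rev {m n : ℕ} (hm : Even m) (hn : Even n) (k : Fin m) :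
    evenLen m n (Fin.rev k : ℕ) = evenLen m n k := by
  have hn' : ¬ Odd n := by simpa using hn
  by_cases hk : Odd (k : ℕ) <;> simp [evenLen, hn', odd_rev hm, hk, sin_rev, -Fin.val_rev]

theorem oddLen_rev {m n : ℕ} (hm : Even m) (hn : Even n) (k : Fin m) :
    oddLen m n (Fin.rev k : ℕ) = oddLen m n k := by
  have hn' : ¬ Odd n := by simpa using hn
  by_cases hk : Odd (k : ℕ) <;> simp [oddLen, hn', odd_rev hm, hk, sin_rev, -Fin.val_rev]

theorem polyP_rev {m n : ℕ} (hm : Even m) (hn : Even n) (k : Fin m) :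
    polyP m n (Fin.rev k : ℕ) = polyP m n k := by
  simp only [polyP, evenLen_rev hm hn, oddLen_rev hm hn]

theorem sidePoint_rev {m n : ℕ} (hm : Even m) (hn : Even n) (k : Fin m) (i : ℕ) (t : ℝ) :
    sidePoint m n (Fin.rev k : ℕ) i t = sidePoint m n k i t := by
  simp only [sidePoint, evenLen_rev hm hn, oddLen_rev hm hn]

/-- The exchange of the polygons `P(k)` and `P(m-1-k)` by translation (here they have the same
position in the plane), on their disjoint union. -/
def iotaPoly {m n : ℕ} (hm : Even m) (hn : Even n) (x : Σ k : Fin m, polyP m n k) :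
    Σ k : Fin m, polyP m n k :=
  ⟨Fin.rev x.1, ⟨x.2.1, (polyP_rev hm hn x.1).symm ▸ x.2.2⟩⟩

theorem polyGlue_iotaPoly {m n : ℕ} (hm : Even m) (hn : Even n)
    {x y : Σ k : Fin m, polyP m n k} (h : PolyGlue m n x y) :
    PolyGlue m n (iotaPoly hm hn y) (iotaPoly hm hn x) := by
  have opp : ∀ i < 2 * n, ((i + n) % (2 * n) + n) % (2 * n) = i := by
    intro i hi
    rw [Nat.mod_add_mod, add_assoc, ← two_mul, Nat.add_mod_right, Nat.mod_eq_of_lt hi]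
  have hn2 : Even (2 * n) := even_two_mul n
  cases h with
  | even_side k k' p q hk hk' i hi hi' t ht hp hq =>
    refine PolyGlue.even_side _ _ _ _ ?_ ?_ ((i + n) % (2 * n)) (Nat.mod_lt _ (by omega)) ?_
      (1 - t) ⟨by linarith [ht.2], by linarith [ht.1]⟩ ?_ ?_
    · rw [odd_rev hm, hk', Nat.odd_add_one]; simpa using hk
    · simp only [Fin.val_rev]; omega
    · rw [hn2.mod_even_iff]; exact hi'.add hn
    · rw [sidePoint_rev hm hn]; exact hq
    · rw [sidePoint_rev hm hn, opp i hi, sub_sub_cancel]; exact hp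
  | odd_side k k' p q hk hk' i hi hi' t ht hp hq =>
    refine PolyGlue.odd_side _ _ _ _ ?_ ?_ ((i + n) % (2 * n)) (Nat.mod_lt _ (by omega)) ?_
      (1 - t) ⟨by linarith [ht.2], by linarith [ht.1]⟩ ?_ ?_
    · rw [← hk', Nat.odd_add_one] at hk; rwa [odd_rev hm]
    · simp only [Fin.val_rev]; omega
    · rw [← Nat.not_even_iff_odd, hn2.mod_even_iff, Nat.not_even_iff_odd]; exact hi'.add_even hn
    · rw [sidePoint_rev hm hn]; exact hq
    · rw [sidePoint_rev hm hn, opp i hi, sub_sub_cancel]; exact hp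

theorem iotaPoly_iotaPoly {m n : ℕ} (hm : Even m) (hn : Even n)
    (x : Σ k : Fin m, polyP m n k) : iotaPoly hm hn (iotaPoly hm hn x) = x := by
  obtain ⟨k, v, hv⟩ := x
  have cast : ∀ (k k' : Fin m) (_ : k = k') (v : Plane) (hv : v ∈ polyP m n k)
      (hv' : v ∈ polyP m n k'),
      (⟨k, ⟨v, hv⟩⟩ : Σ k : Fin m, polyP m n k) = ⟨k', ⟨v, hv'⟩⟩ := by
    rintro k _ rfl v hv hv'; rfl
  exact cast _ _ (Fin.rev_rev k) _ _ _

theorem continuous_iotaPoly {m n : ℕ} (hm : Even m) (hn : Even n) :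
    Continuous (iotaPoly (m := m) (n := n) hm hn) := by
  refine continuous_sigma fun k => ?_
  have h : ∀ v : polyP m n k, (v : Plane) ∈ polyP m n (Fin.rev k : ℕ) := fun v =>
    (polyP_rev hm hn k).symm ▸ v.2
  exact (continuous_sigmaMk (σ := fun k : Fin m => polyP m n k)).comp
    (continuous_subtype_val.subtype_mk h)

/-- The automorphism `ι'_*` of `Y_{m,n}` for `m` and `n` even, which interchanges `P(k)` and
`P(m-1-k)` by translation. -/
def iotaStar' {m n : ℕ} (hm : Even m) (hn : Even n) :
    (surfaceY m n).Point ≃ₜ (surfaceY m n).Point where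
  toFun := Quot.lift (fun x => Quot.mk _ (iotaPoly hm hn x)) fun _ _ h =>
    (Quot.sound (polyGlue_iotaPoly hm hn h)).symm
  invFun := Quot.lift (fun x => Quot.mk _ (iotaPoly hm hn x)) fun _ _ h =>
    (Quot.sound (polyGlue_iotaPoly hm hn h)).symm
  left_inv x := by
    induction x using Quot.ind
    simp only [iotaPoly_iotaPoly]; rfl
  right_inv x := by
    induction x using Quot.ind
    simp only [iotaPoly_iotaPoly]; rfl
  continuous_toFun :=
    continuous_quot_lift _ (continuous_quot_mk.comp (continuous_iotaPoly hm hn))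
  continuous_invFun :=
    continuous_quot_lift _ (continuous_quot_mk.comp (continuous_iotaPoly hm hn))

/-- The quotient `(Y^e_{m,n}, η^e_{m,n})` of `Y_{m,n}` by `ι'_*`, for `m` and `n` even. -/
def surfaceYe {m n : ℕ} (hm : Even m) (hn : Even n) : TiledSurface :=
  (surfaceY m n).quotient (iotaStar' hm hn)

/-- The derivative of `μ`. -/
def derivMu (n : ℕ) : Matrix (Fin 2) (Fin 2) ℝ :=
  !![1 / Real.sin (Real.pi / n), -Real.cot (Real.pi / n); 0, 1]

/-- The derivative of `ν`. -/
def derivNu (m : ℕ) : Matrix (Fin 2) (Fin 2) ℝ :=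
  !![-(1 / Real.sin (Real.pi / m)), -Real.cot (Real.pi / m); 0, 1]

end

/-! The surfaces `X` and `Y` are two ways of cutting up the same surface. Undo the derivative of
`μ`, that is, write a point of the plane as `shear n x y`. The side of length `s` and angle `iπ/n`
then becomes the vector `(s sin((i+1)π/n), s sin(iπ/n))`, the diagonal of an axis-parallel rectangle
(`semiEdge_eq_shear`). The horizontal and vertical lines through the vertices cut `P(k)` into a
staircase: row `r` meets only the columns `r - 1`, `r`, `r + 1`. The middle cell is a whole
rectangle; the outer two are triangles, halves of rectangles cut along sides of `P(k)`
(`exists_inCell`, `shear_mem_of_inCell`).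

The sizes of the cells are values of `w`: a row of `P(k)` has the weight of an even node as height,
a column that of an odd node as width (`gridWeight_rowNode`, `gridWeight_colNode`). A middle cell is
the rectangle of a horizontal edge between the abscissas `k` and `k + 1`. A triangle is half of the
rectangle of a vertical edge, and the gluing of neighbouring polygons joins the two halves along the
diagonal. A step to the right in a row is a quarter turn around the even node, a step up in a column
a quarter turn around the odd node, both in the sense prescribed for `X` (`turn_row_direction`,
`turn_col_direction`, `exists_cells_around_even`, `exists_cells_around_odd`).

The delicate point is degeneracy. A row or column whose node falls off the grid has size zero; `Y`
passes through such flat cells while `nextDir` skips them. That both lead to the same point is the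
content of `evenPt_turn`, `oddPt_turn` and `nextDir_chain`. With it, the maps `surfaceYToX` and
`surfaceXToY` are well defined (`cellPt_unique`, `polyToX_glue`, `edgePt_eq`, `rectToY_glue`) and
inverse to each other.

Both maps are affine with constant linear part on finitely many closed pieces of each tile, which
gives continuity and affinity in charts (`isAffineHomeo_of_piecewiseAffine`). Points of `X` other
than corners of rectangles are regular (`finite_not_hasPlacement`), and regularity is transported to
`Y` by the map. The exchange of `P(k)` and `P(m-1-k)` corresponds to `ι`, so everything descends to
the quotients. Finally, transposing the grid reflects `X_{m,n}` onto `X_{n,m}` (`flipX`), and `ν` is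
this reflection followed by `μ` for `(n, m)`. -/

/-! ### Piecewise affine maps between tiled surfaces -/

namespace TiledSurface

/-- `f` is affine with linear part `D` on each of finitely many closed pieces of every tile. -/
def PiecewiseAffine (S T : TiledSurface) (D : Matrix (Fin 2) (Fin 2) ℝ)
    (f : S.Point → T.Point) : Prop :=
  ∀ i, ∃ (ι : Type) (_ : Finite ι) (Q : ι → Set Plane) (j : ι → T.Tile) (c : ι → Plane),
    (∀ l, IsClosed (Q l)) ∧ (∀ y ∈ S.region i, ∃ l, y ∈ Q l) ∧
    ∀ l y (hy : y ∈ S.region i), y ∈ Q l → ∃ h : D.mulVec y + c l ∈ T.region (j l),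
      f (S.param ⟨i, y, hy⟩) = T.param ⟨j l, _, h⟩

theorem continuous_mulVec_add (D : Matrix (Fin 2) (Fin 2) ℝ) (c : Plane) :
    Continuous fun y : Plane => D.mulVec y + c :=
  (Continuous.matrix_mulVec continuous_const continuous_id).add continuous_const

variable {S T U : TiledSurface} {D : Matrix (Fin 2) (Fin 2) ℝ} {f : S.Point → T.Point}

namespace PiecewiseAffine

theorem continuous (hf : PiecewiseAffine S T D f) : Continuous f := by
  rw [S.isQuotientMap_param.continuous_iff]
  refine continuous_sigma fun i => ?_
  obtain ⟨ι, hι, Q, j, c, hQ, hcov, hmap⟩ := hf i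
  refine (locallyFinite_of_finite fun l => (Subtype.val ⁻¹' Q l : Set (S.region i))).continuous
    ?_ ?_ ?_
  · refine Set.eq_univ_of_forall fun y => ?_
    obtain ⟨l, hl⟩ := hcov y y.2
    exact Set.mem_iUnion.2 ⟨l, hl⟩
  · exact fun l => (hQ l).preimage continuous_subtype_val
  · intro l
    rw [continuousOn_iff_continuous_domRestrict]
    have h : ∀ y : (Subtype.val ⁻¹' Q l : Set (S.region i)),
        D.mulVec y.1.1 + c l ∈ T.region (j l) := fun y => (hmap l y.1.1 y.1.2 y.2).1
    have : Continuous fun y : (Subtype.val ⁻¹' Q l : Set (S.region i)) =>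
        T.param ⟨j l, ⟨D.mulVec y.1.1 + c l, h y⟩⟩ :=
      T.isQuotientMap_param.continuous.comp
        ((continuous_sigmaMk (σ := fun j => T.region j)).comp
          (((continuous_mulVec_add D (c l)).comp
            (continuous_subtype_val.comp continuous_subtype_val)).subtype_mk h))
    refine this.congr fun y => ?_
    exact (hmap l y.1.1 y.1.2 y.2).2.symm

/-- Near `x` only the closed pieces through `x` matter, and there are finitely many. On each of them
`f` is an affine map into one tile, and the chart `ψ` is a translation on that tile near the image
of `x`. -/
theorem eventually_chart (hf : PiecewiseAffine S T D f)
    {ψ : OpenPartialHomeomorph T.Point Plane} (hψ : T.IsTranslationChart ψ) (i : S.Tile)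
    (x : S.region i) (hx : f (S.param ⟨i, x⟩) ∈ ψ.source) :
    ∀ᶠ y in 𝓝 x, ψ (f (S.param ⟨i, y⟩)) - ψ (f (S.param ⟨i, x⟩)) =
      D.mulVec ((y : Plane) - (x : Plane)) := by
  obtain ⟨ι, hι, Q, j, c, hQ, hcov, hmap⟩ := hf i
  have key : ∀ l, ∀ᶠ y : S.region i in 𝓝 x, (y : Plane) ∈ Q l → ψ (f (S.param ⟨i, y⟩)) -
      ψ (f (S.param ⟨i, x⟩)) = D.mulVec ((y : Plane) - (x : Plane)) := by
    intro l
    by_cases hxl : (x : Plane) ∈ Q l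
    · obtain ⟨h, hfx⟩ := hmap l x x.2 hxl
      have h1 := hψ (j l) ⟨_, h⟩ (hfx ▸ hx)
      rw [nhds_subtype_eq_comap, Filter.eventually_comap] at h1
      have h2 : Filter.Tendsto (fun y : S.region i => D.mulVec (y : Plane) + c l) (𝓝 x)
          (𝓝 (D.mulVec (x : Plane) + c l)) :=
        ((continuous_mulVec_add D (c l)).comp continuous_subtype_val).tendsto x
      filter_upwards [h2.eventually h1] with y hy hyl
      obtain ⟨h', hfy⟩ := hmap l y y.2 hyl
      have := hy ⟨_, h'⟩ rfl
      rw [hfy, hfx, this, Matrix.mulVec_sub]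
      exact add_sub_add_right_eq_sub _ _ _
    · have : IsOpen (Subtype.val ⁻¹' Q l : Set (S.region i))ᶜ :=
        ((hQ l).preimage continuous_subtype_val).isOpen_compl
      filter_upwards [this.mem_nhds hxl] with y hy hyl
      exact absurd hyl hy
  filter_upwards [Filter.eventually_all.2 key] with y hy
  obtain ⟨l, hl⟩ := hcov y y.2
  exact hy l hl

theorem comp {E : Matrix (Fin 2) (Fin 2) ℝ} {g : T.Point → U.Point}
    (hg : PiecewiseAffine T U E g) (hf : PiecewiseAffine S T D f) :
    PiecewiseAffine S U (E * D) (g ∘ f) := by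
  intro i
  obtain ⟨ι, hι, Q, j, c, hQ, hcov, hmap⟩ := hf i
  choose κ hκ Q' j' c' hQ' hcov' hmap' using hg
  -- The condition that the image lies in the tile is part of the piece: `hmap` gives it only for
  -- points of `S.region i`, whereas closedness and the second map need it on the piece itself.
  refine ⟨Σ l : ι, κ (j l), inferInstance,
    fun p => Q p.1 ∩ {y | D.mulVec y + c p.1 ∈ T.region (j p.1) ∧
      D.mulVec y + c p.1 ∈ Q' (j p.1) p.2},
    fun p => j' (j p.1) p.2, fun p => E.mulVec (c p.1) + c' (j p.1) p.2, ?_, ?_, ?_⟩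
  · rintro ⟨l, l'⟩
    exact (hQ l).inter (((T.isCompact_region _).isClosed.inter (hQ' _ _)).preimage
      (continuous_mulVec_add D (c l)))
  · intro y hy
    obtain ⟨l, hl⟩ := hcov y hy
    obtain ⟨h, -⟩ := hmap l y hy hl
    obtain ⟨l', hl'⟩ := hcov' _ _ h
    exact ⟨⟨l, l'⟩, hl, h, hl'⟩
  · rintro ⟨l, l'⟩ y hy ⟨hl, h, hl'⟩
    obtain ⟨h1, hfy⟩ := hmap l y hy hl
    obtain ⟨h2, hgy⟩ := hmap' (j l) l' _ h hl'
    have : (E * D).mulVec y + (E.mulVec (c l) + c' (j l) l') =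
        E.mulVec (D.mulVec y + c l) + c' (j l) l' := by
      rw [Matrix.mulVec_add, Matrix.mulVec_mulVec, add_assoc]
    simp only [this]
    exact ⟨h2, by rw [Function.comp, hfy, hgy]⟩

/-- Piecewise affine maps that commute with two self-homeomorphisms descend to the quotients. -/
theorem quotient_map (hf : PiecewiseAffine S T D f) {a : S.Point ≃ₜ S.Point}
    {b : T.Point ≃ₜ T.Point} (h : ∀ x y, a x = y → b (f x) = f y) :
    PiecewiseAffine (S.quotient a) (T.quotient b) D (Quot.map f h) := by
  intro i
  obtain ⟨ι, hι, Q, j, c, hQ, hcov, hmap⟩ := hf i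
  refine ⟨ι, hι, Q, j, c, hQ, hcov, fun l y hy hl => ?_⟩
  obtain ⟨h1, h2⟩ := hmap l y hy hl
  exact ⟨h1, congrArg (Quot.mk _) h2⟩

end PiecewiseAffine

/-- `ψ ∘ f - D φ` is locally constant because it is so on every tile. Regular points of `S` suffice
for the finiteness clause: a chart of `S`, composed with the inverse of `f` and with `D`, is a chart
of `T`. -/
theorem isAffineHomeo_of_piecewiseAffine {f : S.Point ≃ₜ T.Point}
    {E : Matrix (Fin 2) (Fin 2) ℝ} (hDE : D * E = 1) (hED : E * D = 1)
    (hf : PiecewiseAffine S T D f) (hg : PiecewiseAffine T S E f.symm)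
    (hS : {p : S.Point | ¬ S.IsRegularPoint p}.Finite) : S.IsAffineHomeo T f D where
  affine_in_charts := by
    intro φ ψ hφ hψ p hp hfp
    set V : Set S.Point := φ.source ∩ f ⁻¹' ψ.source with hV
    have hVo : IsOpen V := φ.open_source.inter (ψ.open_source.preimage f.continuous)
    -- Several tiles meet at `p`, so openness of the level set is tested tile by tile, as the
    -- quotient topology allows.
    set W : Set S.Point := V ∩ {q | ψ (f q) - D.mulVec (φ q) = ψ (f p) - D.mulVec (φ p)} with hW
    have hWo : IsOpen W := by
      rw [← S.isQuotientMap_param.isOpen_preimage, isOpen_sigma_iff]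
      intro i
      rw [isOpen_iff_mem_nhds]
      rintro x ⟨⟨hx1, hx2⟩, hx3⟩
      have hV' : ∀ᶠ y in 𝓝 x, S.param ⟨i, y⟩ ∈ V :=
        ((S.isQuotientMap_param.continuous.comp
          (continuous_sigmaMk (σ := fun j => S.region j))).tendsto x).eventually
          (hVo.mem_nhds ⟨hx1, hx2⟩)
      filter_upwards [hV', hφ i x hx1, hf.eventually_chart hψ i x hx2] with y hy1 hy2 hy3
      refine ⟨hy1, ?_⟩
      rw [← hy2, Matrix.mulVec_sub] at hy3
      rw [Set.mem_ofPred_eq] at hx3 ⊢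
      rw [← hx3]
      linear_combination hy3
    refine ⟨ψ (f p) - D.mulVec (φ p), ?_⟩
    filter_upwards [hWo.mem_nhds ⟨⟨hp, hfp⟩, rfl⟩] with q hq
    rw [← hq.2]; abel
  finite_singular := by
    refine hS.subset fun p hp hreg => hp ⟨hreg, ?_⟩
    obtain ⟨φ, hφ, hpφ⟩ := hreg
    have hleft : ∀ v, E.mulVec (D.mulVec v) = v := fun v => by
      rw [Matrix.mulVec_mulVec, hED, Matrix.one_mulVec]
    have hright : ∀ v, D.mulVec (E.mulVec v) = v := fun v => by
      rw [Matrix.mulVec_mulVec, hDE, Matrix.one_mulVec]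
    let L : Plane ≃ₜ Plane :=
      { toFun := D.mulVec
        invFun := E.mulVec
        left_inv := hleft
        right_inv := hright
        continuous_toFun := Continuous.matrix_mulVec continuous_const continuous_id
        continuous_invFun := Continuous.matrix_mulVec continuous_const continuous_id }
    refine ⟨(f.symm.transOpenPartialHomeomorph φ).transHomeomorph L, ?_, ?_⟩
    · intro j y hy
      have hy' : f.symm (T.param ⟨j, y⟩) ∈ φ.source := hy
      filter_upwards [hg.eventually_chart hφ j y hy'] with z hz
      change D.mulVec (φ (f.symm (T.param ⟨j, z⟩))) - D.mulVec (φ (f.symm (T.param ⟨j, y⟩))) = _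
      rw [← Matrix.mulVec_sub, hz, hright]
    · change f.symm (f p) ∈ φ.source
      rwa [f.symm_apply_apply]

/-- A point of the surface is regular if a plane neighbourhood, cut into pieces that are translated
into tiles, is mapped injectively onto a saturated neighbourhood of the point. -/
theorem isRegularPoint_of_placements (S : TiledSurface) {A : Type} [Finite A] (t : A → S.Tile)
    (τ : A → Plane) (z₀ : Plane) {O : Set Plane} (hO : IsOpen O) (hz₀ : z₀ ∈ O)
    (hcov : ∀ z ∈ O, ∃ α, z - τ α ∈ S.region (t α))
    (hag : ∀ z ∈ O, ∀ α β (hα : z - τ α ∈ S.region (t α)) (hβ : z - τ β ∈ S.region (t β)),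
      S.param ⟨t α, _, hα⟩ = S.param ⟨t β, _, hβ⟩)
    (hfib : ∀ z ∈ O, ∀ α (hα : z - τ α ∈ S.region (t α)) (i : S.Tile) (x : S.region i),
      S.param ⟨i, x⟩ = S.param ⟨t α, _, hα⟩ → ∃ β, i = t β ∧ (x : Plane) = z - τ β)
    (α₀ : A) (hα₀ : z₀ - τ α₀ ∈ S.region (t α₀)) :
    S.IsRegularPoint (S.param ⟨t α₀, _, hα₀⟩) := by
  classical
  -- A ball of radius `ρ` contains no two points whose difference is that of two distinct shifts.
  -- This excludes that one point of the surface is placed twice near `z₀`.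
  obtain ⟨ρ, hρ, hsep⟩ : ∃ ρ > 0, ∀ α β, τ α ≠ τ β → 2 * ρ ≤ dist (τ α) (τ β) := by
    have : ∀ p : A × A, ∃ ρ > 0, τ p.1 ≠ τ p.2 → 2 * ρ ≤ dist (τ p.1) (τ p.2) := by
      intro p
      by_cases h : τ p.1 = τ p.2
      · exact ⟨1, one_pos, fun h' => absurd h h'⟩
      · exact ⟨dist (τ p.1) (τ p.2) / 2, by have := dist_pos.2 h; positivity, fun _ => by linarith⟩
    choose r hr hr' using this
    obtain ⟨p₀, hp₀⟩ := @Finite.exists_min (A × A) ℝ _ ⟨(α₀, α₀)⟩ _ r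
    exact ⟨r p₀, hr p₀, fun α β h => by linarith [hr' (α, β) h, hp₀ (α, β)]⟩
  set B : Set Plane := O ∩ Metric.ball z₀ ρ with hB
  have hBo : IsOpen B := hO.inter Metric.isOpen_ball
  have : Nonempty A := ⟨α₀⟩
  choose! a ha using hcov
  let σ : B → S.Point := fun z => S.param ⟨t (a z), _, ha z z.2.1⟩
  have hσ : ∀ (z : B) α (hα : (z : Plane) - τ α ∈ S.region (t α)),
      S.param ⟨t α, _, hα⟩ = σ z := fun z α hα => hag z z.2.1 _ _ _ _
  have hσ' : ∀ (z : B) i (x : S.region i), S.param ⟨i, x⟩ = σ z →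
      ∃ β, i = t β ∧ (x : Plane) = z - τ β := fun z i x h => hfib z z.2.1 _ _ i x h
  have hopen : ∀ V : Set Plane, IsOpen V → IsOpen (σ '' (Subtype.val ⁻¹' V)) := by
    intro V hV
    rw [← S.isQuotientMap_param.isOpen_preimage, isOpen_sigma_iff]
    intro i
    -- In the tile `i` the preimage is the union of the translated copies of `V ∩ B`, one for each
    -- placement of the tile.
    have : (Sigma.mk i ⁻¹' (S.param ⁻¹' (σ '' (Subtype.val ⁻¹' V)))) =
        ⋃ β : {β // t β = i}, (fun x : S.region i => (x : Plane) + τ β) ⁻¹' (V ∩ B) := by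
      ext x
      simp only [Set.mem_preimage, Set.mem_image, Set.mem_iUnion]
      constructor
      · rintro ⟨z, hzV, hz⟩
        obtain ⟨β, hβ, hx⟩ := hσ' z i x hz.symm
        refine ⟨⟨β, hβ.symm⟩, ?_⟩
        rw [hx, sub_add_cancel]
        exact ⟨hzV, z.2⟩
      · rintro ⟨⟨β, rfl⟩, hV', hB'⟩
        refine ⟨⟨_, hB'⟩, hV', ?_⟩
        have hx : (x : Plane) + τ β - τ β ∈ S.region (t β) := by
          rw [add_sub_cancel_right]; exact x.2
        rw [← hσ ⟨_, hB'⟩ β hx]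
        congr 3
        exact add_sub_cancel_right _ _
    rw [this]
    exact isOpen_iUnion fun β => (hV.inter hBo).preimage
      (continuous_subtype_val.add continuous_const)
  have hopenMap : IsOpenMap σ := by
    rintro _ ⟨V, hV, rfl⟩
    exact hopen V hV
  have hinj : Function.Injective σ := by
    intro z z' h
    obtain ⟨β, hβ, hx⟩ := hσ' z' _ _ h
    simp only at hx
    have h1 : (z : Plane) - z' = τ (a z) - τ β := by
      linear_combination hx
    by_cases h2 : τ (a z) = τ β
    · rw [h2, sub_self, sub_eq_zero] at h1
      exact Subtype.ext h1
    · have h3 := hsep _ _ h2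
      rw [dist_eq_norm, ← h1, ← dist_eq_norm] at h3
      have h4 := dist_triangle_right (z : Plane) z' z₀
      have h5 := Metric.mem_ball.1 z.2.2
      have h6 := Metric.mem_ball.1 z'.2.2
      linarith
  have hcont : Continuous σ := by
    have hcl : ∀ α, IsClosed {z : B | (z : Plane) - τ α ∈ S.region (t α)} := fun α =>
      (S.isCompact_region (t α)).isClosed.preimage (continuous_subtype_val.sub continuous_const)
    refine (locallyFinite_of_finite
      fun α => {z : B | (z : Plane) - τ α ∈ S.region (t α)}).continuous ?_ hcl ?_
    · exact Set.eq_univ_of_forall fun z => Set.mem_iUnion.2 ⟨a z, ha z z.2.1⟩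
    · intro α
      rw [continuousOn_iff_continuous_domRestrict]
      have : Continuous fun z : {z : B | (z : Plane) - τ α ∈ S.region (t α)} =>
          S.param ⟨t α, ⟨z.1.1 - τ α, z.2⟩⟩ :=
        S.isQuotientMap_param.continuous.comp
          ((continuous_sigmaMk (σ := fun j => S.region j)).comp
            (((continuous_subtype_val.comp continuous_subtype_val).sub
              continuous_const).subtype_mk _))
      exact this.congr fun z => hσ z.1 α z.2
  have hemb : IsOpenEmbedding σ := .of_continuous_injective_isOpenMap hcont hinj hopenMap
  have hz₀B : z₀ ∈ B := ⟨hz₀, Metric.mem_ball_self hρ⟩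
  have : Nonempty B := ⟨⟨z₀, hz₀B⟩⟩
  let Bo : TopologicalSpace.Opens Plane := ⟨B, hBo⟩
  have : Nonempty Bo := ⟨⟨z₀, hz₀B⟩⟩
  let φ : OpenPartialHomeomorph S.Point Plane :=
    (hemb.toOpenPartialHomeomorph σ).symm.trans (Bo.openPartialHomeomorphSubtypeCoe ⟨⟨z₀, hz₀B⟩⟩)
  have hsrc : ∀ q, q ∈ φ.source ↔ q ∈ Set.range σ := by
    intro q
    simp [φ]
  have hval : ∀ z : B, φ (σ z) = z := by
    intro z
    change (((hemb.toOpenPartialHomeomorph σ).symm (σ z) : B) : Plane) = z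
    rw [hemb.toOpenPartialHomeomorph_left_inv]
  refine ⟨φ, ?_, ?_⟩
  · intro i x hx
    obtain ⟨z, hz⟩ := (hsrc _).1 hx
    obtain ⟨β, rfl, hxz⟩ := hσ' z i x hz.symm
    have hnear : ∀ᶠ y : S.region (t β) in 𝓝 x, (y : Plane) + τ β ∈ B := by
      refine (hBo.preimage (continuous_subtype_val.add continuous_const)).mem_nhds ?_
      change (x : Plane) + τ β ∈ B
      rw [hxz, sub_add_cancel]; exact z.2
    filter_upwards [hnear] with y hy
    have hy' : (y : Plane) + τ β - τ β ∈ S.region (t β) := by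
      rw [add_sub_cancel_right]; exact y.2
    have hy2 : S.param ⟨t β, y⟩ = σ ⟨_, hy⟩ := by
      rw [← hσ ⟨_, hy⟩ β hy']
      exact congrArg (fun w => S.param ⟨t β, w⟩) (Subtype.ext (add_sub_cancel_right _ _).symm)
    rw [hy2, ← hz, hval, hval, hxz]
    simp only
    abel
  · rw [hsrc]
    exact ⟨⟨z₀, hz₀B⟩, (hσ ⟨z₀, hz₀B⟩ α₀ hα₀).symm⟩

end TiledSurface

/-! ### Regular points of the surfaces `X` and `X^e` -/

theorem sin_nat_mul_pi_div_pos {N : ℕ} {i : ℤ} (h0 : 0 < i) (h1 : i < N) :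
    0 < Real.sin (i * Real.pi / N) := by
  have hN : (0 : ℝ) < N := by exact_mod_cast h0.trans h1
  have hi : (0 : ℝ) < i := by exact_mod_cast h0
  have hi' : (i : ℝ) < N := by exact_mod_cast h1
  refine Real.sin_pos_of_pos_of_lt_pi (by positivity) ?_
  rw [div_lt_iff₀ hN, mul_comm]
  exact mul_lt_mul_of_pos_left hi' Real.pi_pos

theorem gridWeight_pos {m n : ℕ} {v : ℤ × ℤ} (hv : IsGridNode m n v) : 0 < gridWeight m n v :=
  mul_pos (sin_nat_mul_pi_div_pos hv.1 hv.2.1) (sin_nat_mul_pi_div_pos hv.2.2.1 hv.2.2.2)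

theorem mem_gridRect {m n : ℕ} {e : GridEdge m n} {v : Plane} :
    v ∈ gridRect e ↔ (0 ≤ v 0 ∧ v 0 ≤ gridWeight m n e.b) ∧
      (0 ≤ v 1 ∧ v 1 ≤ gridWeight m n e.a) := by
  simp only [gridRect, Set.mem_Icc, Pi.le_def, Fin.forall_fin_two, Matrix.cons_val_zero,
    Matrix.cons_val_one]
  tauto

theorem plane_ext {v w : Plane} (h0 : v 0 = w 0) (h1 : v 1 = w 1) : v = w := by
  funext i; fin_cases i
  · exact h0
  · exact h1

theorem surfaceX_param_congr {m n : ℕ} {e e' : GridEdge m n} (h : e = e') {v v' : Plane}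
    (hv : v ∈ gridRect e) (hv' : v' ∈ gridRect e') (hvv : v = v') :
    (surfaceX m n).param ⟨e, v, hv⟩ = (surfaceX m n).param ⟨e', v', hv'⟩ := by
  subst h hvv; rfl

/-- A plane neighbourhood of `z₀` that is cut into pieces lying in rectangles, such that the gluing
relation matches exactly the copies of a point in these pieces. -/
def HasPlacement (m n : ℕ) (p : (surfaceX m n).Point) : Prop :=
  ∃ (A : Type) (_ : Finite A) (t : A → GridEdge m n) (τ : A → Plane) (z₀ : Plane) (O : Set Plane),
    IsOpen O ∧ z₀ ∈ O ∧ (∀ z ∈ O, ∃ α, z - τ α ∈ gridRect (t α)) ∧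
    (∀ z ∈ O, ∀ α β (hα : z - τ α ∈ gridRect (t α)) (hβ : z - τ β ∈ gridRect (t β)),
      (surfaceX m n).param ⟨t α, _, hα⟩ = (surfaceX m n).param ⟨t β, _, hβ⟩) ∧
    (∀ z ∈ O, ∀ x y, RectGlue m n x y →
      ((∃ β, x.1 = t β ∧ (x.2 : Plane) = z - τ β) ↔ ∃ β, y.1 = t β ∧ (y.2 : Plane) = z - τ β)) ∧
    ∃ α₀, ∃ hα₀ : z₀ - τ α₀ ∈ gridRect (t α₀), p = (surfaceX m n).param ⟨t α₀, _, hα₀⟩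

namespace HasPlacement

variable {m n : ℕ} {p : (surfaceX m n).Point}

theorem isRegularPoint (h : HasPlacement m n p) : (surfaceX m n).IsRegularPoint p := by
  obtain ⟨A, hA, t, τ, z₀, O, hO, hz₀, hcov, hag, hsat, α₀, hα₀, rfl⟩ := h
  refine TiledSurface.isRegularPoint_of_placements (surfaceX m n) t τ z₀ hO hz₀ hcov hag ?_ α₀ hα₀
  intro z hz α hα i x hx
  -- Being one of the placed copies of `z` is invariant under the generating relation, hence is a
  -- predicate on points of the surface.
  have := congrArg (Quot.lift (fun x : Σ e : GridEdge m n, gridRect e =>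
    ∃ β, x.1 = t β ∧ (x.2 : Plane) = z - τ β) fun x y h => propext (hsat z hz x y h)) hx
  exact this.mpr ⟨α, rfl, rfl⟩

/-- A point of the quotient has the copies of `z` and their images under `ι` as preimages. So every
rectangle is placed together with its image, with the same shift. -/
theorem isRegularPoint_quotient (hm : Even m) (hn : Even n) (h : HasPlacement m n p) :
    (surfaceXe hm hn).IsRegularPoint (Quot.mk _ p) := by
  obtain ⟨A, hA, t, τ, z₀, O, hO, hz₀, hcov, hag, hsat, α₀, hα₀, rfl⟩ := h
  let tt : A × Bool → GridEdge m n := fun α => if α.2 then (t α.1).iota hm hn else t α.1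
  have hreg : ∀ α, gridRect (tt α) = gridRect (t α.1) := by
    rintro ⟨α, _ | _⟩
    · rfl
    · exact GridEdge.gridRect_iota hm hn (t α)
  have hpar : ∀ (z : Plane) α (h : z ∈ gridRect (tt α)) (h' : z ∈ gridRect (t α.1)),
      (surfaceXe hm hn).param ⟨tt α, z, h⟩ =
        Quot.mk _ ((surfaceX m n).param ⟨t α.1, z, h'⟩) := by
    rintro z ⟨α, _ | _⟩ h h'
    · rfl
    · exact (Quot.sound (r := fun x y => iotaStar hm hn x = y)
        (a := (surfaceX m n).param ⟨t α, z, h'⟩) rfl).symm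
  refine TiledSurface.isRegularPoint_of_placements (surfaceXe hm hn) tt (fun α => τ α.1) z₀ hO hz₀
    ?_ ?_ ?_ (α₀, false) hα₀
  · intro z hz
    obtain ⟨α, hα⟩ := hcov z hz
    exact ⟨(α, false), hα⟩
  · intro z hz α β hα hβ
    rw [hpar _ α hα (hreg α ▸ hα), hpar _ β hβ (hreg β ▸ hβ), hag z hz α.1 β.1]
  · intro z hz α hα e x hx
    -- `K q ∨ K (ι q)` is invariant under `ι` because `ι` is an involution, so it descends to the
    -- quotient.
    let K : (surfaceX m n).Point → Prop := Quot.lift (fun x : Σ e : GridEdge m n, gridRect e =>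
      ∃ β, x.1 = t β ∧ (x.2 : Plane) = z - τ β) fun x y h => propext (hsat z hz x y h)
    have hinv : ∀ q, iotaStar hm hn (iotaStar hm hn q) = q := (iotaStar hm hn).left_inv
    have hK : ∀ q q' : (surfaceX m n).Point, iotaStar hm hn q = q' →
        (K q ∨ K (iotaStar hm hn q)) = (K q' ∨ K (iotaStar hm hn q')) := by
      rintro q _ rfl
      rw [hinv, or_comm]
    rw [hpar _ α hα (hreg α ▸ hα)] at hx
    have h1 := congrArg (Quot.lift (fun q => K q ∨ K (iotaStar hm hn q)) hK) hx
    rcases h1.mpr (Or.inl ⟨α.1, rfl, rfl⟩) with ⟨β, h2, h3⟩ | ⟨β, h2, h3⟩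
    · exact ⟨(β, false), h2, h3⟩
    · refine ⟨(β, true), ?_, h3⟩
      change e = (t β).iota hm hn
      rw [← h2]
      exact (GridEdge.iota_iota hm hn e).symm

/-- A point of `X` in the interior of a rectangle. -/
theorem of_interior (e : GridEdge m n) (v : Plane) (hv : v ∈ gridRect e) (h0 : 0 < v 0)
    (h0' : v 0 < gridWeight m n e.b) (h1 : 0 < v 1) (h1' : v 1 < gridWeight m n e.a) :
    HasPlacement m n ((surfaceX m n).param ⟨e, v, hv⟩) := by
  refine ⟨Unit, inferInstance, fun _ => e, fun _ => 0, v, {z | (0 < z 0 ∧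
    z 0 < gridWeight m n e.b) ∧ (0 < z 1 ∧ z 1 < gridWeight m n e.a)}, ?_, ⟨⟨h0, h0'⟩, h1, h1'⟩,
    ?_, ?_, ?_, (), by simpa using hv, surfaceX_param_congr rfl _ _ (sub_zero v).symm⟩
  · have hc0 : Continuous fun z : Plane => z 0 := continuous_apply 0
    have hc1 : Continuous fun z : Plane => z 1 := continuous_apply 1
    exact ((isOpen_lt continuous_const hc0).inter (isOpen_lt hc0 continuous_const)).inter
      ((isOpen_lt continuous_const hc1).inter (isOpen_lt hc1 continuous_const))
  · rintro z ⟨⟨h0, h0'⟩, h1, h1'⟩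
    refine ⟨(), mem_gridRect.2 ?_⟩
    simp only [sub_zero]
    exact ⟨⟨h0.le, h0'.le⟩, h1.le, h1'.le⟩
  · exact fun _ _ _ _ _ _ => rfl
  · rintro z ⟨⟨h0, h0'⟩, h1, h1'⟩ x y h
    simp only [sub_zero]
    -- The gluing relation involves boundary points only, and `z` is interior.
    refine ⟨?_, ?_⟩ <;> rintro ⟨-, rfl, hz⟩ <;> exfalso <;>
      cases h with
      | right_left e p q hp hq h => simp only at hz; subst hz; linarith
      | top_bottom e p q hp hq h => simp only at hz; subst hz; linarith

/-- A point of `X` in the interior of the right side of a rectangle. -/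
theorem of_right (e : GridEdge m n) (v : Plane) (hv : v ∈ gridRect e)
    (h0 : v 0 = gridWeight m n e.b) (h1 : 0 < v 1) (h1' : v 1 < gridWeight m n e.a) :
    HasPlacement m n ((surfaceX m n).param ⟨e, v, hv⟩) := by
  have hpos := gridWeight_pos e.b_node
  have hpos' := gridWeight_pos e.east.b_node
  have hea : e.east.a = e.a := rfl
  -- The index is a placement and not a tile: if `e.east = e`, the same rectangle is placed twice,
  -- side by side.
  refine ⟨Bool, inferInstance, fun s => if s then e.east else e,
    fun s => if s then ![gridWeight m n e.b, 0] else 0, v, {z | (0 < z 0 ∧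
    z 0 < gridWeight m n e.b + gridWeight m n e.east.b) ∧ (0 < z 1 ∧ z 1 < gridWeight m n e.a)}, ?_,
    ⟨⟨by linarith, by linarith⟩, h1, h1'⟩, ?_, ?_, ?_, false, by simpa using hv,
    surfaceX_param_congr rfl _ _ (sub_zero v).symm⟩
  · have hc0 : Continuous fun z : Plane => z 0 := continuous_apply 0
    have hc1 : Continuous fun z : Plane => z 1 := continuous_apply 1
    exact ((isOpen_lt continuous_const hc0).inter (isOpen_lt hc0 continuous_const)).inter
      ((isOpen_lt continuous_const hc1).inter (isOpen_lt hc1 continuous_const))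
  · rintro z ⟨⟨h0, h0'⟩, h1, h1'⟩
    rcases le_total (z 0) (gridWeight m n e.b) with h | h
    · refine ⟨false, mem_gridRect.2 ?_⟩
      simp only [Bool.false_eq_true, if_false, sub_zero]
      exact ⟨⟨h0.le, h⟩, h1.le, h1'.le⟩
    · refine ⟨true, mem_gridRect.2 ?_⟩
      simp only [if_true, Pi.sub_apply, Matrix.cons_val_zero, Matrix.cons_val_one, hea]
      exact ⟨⟨by linarith, by linarith⟩, by linarith, by linarith⟩
  · have key : ∀ z : Plane, ∀ (hα : z - (0 : Plane) ∈ gridRect e)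
        (hβ : z - ![gridWeight m n e.b, 0] ∈ gridRect e.east),
        (surfaceX m n).param ⟨e, _, hα⟩ = (surfaceX m n).param ⟨e.east, _, hβ⟩ := by
      intro z hα hβ
      have h1 := mem_gridRect.1 hα
      have h2 := mem_gridRect.1 hβ
      simp only [Pi.sub_apply, Matrix.cons_val_zero, Matrix.cons_val_one, Pi.zero_apply, sub_zero]
          at h1 h2
      refine Quot.sound (RectGlue.right_left e _ _ ?_ ?_ ?_) <;>
        simp only [Pi.sub_apply, Matrix.cons_val_zero, Matrix.cons_val_one, Pi.zero_apply,
            sub_zero] <;> linarith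
    rintro z - (_ | _) (_ | _) hα hβ
    · rfl
    · exact key z hα hβ
    · exact (key z hβ hα).symm
    · rfl
  · rintro z ⟨⟨h0, h0'⟩, h1, h1'⟩ x y h
    simp only [Bool.exists_bool, Bool.false_eq_true, if_false, if_true, sub_zero]
    cases h with
    | right_left e₁ p q hp hq h =>
      simp only [EmbeddingLike.apply_eq_iff_eq]
      constructor
      · rintro (⟨rfl, hz⟩ | ⟨rfl, hz⟩)
        · refine Or.inr ⟨rfl, plane_ext ?_ ?_⟩
          · simp [← hz, hq, hp]
          · simp [← hz, h]
        · rw [hz] at hp; simp at hp; linarith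
      · rintro (⟨rfl, hz⟩ | ⟨rfl, hz⟩)
        · rw [hz] at hq; linarith
        · refine Or.inl ⟨rfl, plane_ext ?_ ?_⟩
          · rw [hz] at hq; simp at hq; linarith
          · rw [← h, hz]; simp
    | top_bottom e₁ p q hp hq h =>
      constructor
      · rintro (⟨rfl, hz⟩ | ⟨rfl, hz⟩) <;> rw [hz] at hp
        · linarith
        · simp [hea] at hp; linarith
      · rintro (⟨-, hz⟩ | ⟨-, hz⟩) <;> rw [hz] at hq
        · linarith
        · simp at hq; linarith

/-- A point of `X` in the interior of the top side of a rectangle. -/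
theorem of_top (e : GridEdge m n) (v : Plane) (hv : v ∈ gridRect e)
    (h0 : v 1 = gridWeight m n e.a) (h1 : 0 < v 0) (h1' : v 0 < gridWeight m n e.b) :
    HasPlacement m n ((surfaceX m n).param ⟨e, v, hv⟩) := by
  have hpos := gridWeight_pos e.a_node
  have hpos' := gridWeight_pos e.north.a_node
  have hea : e.north.b = e.b := rfl
  refine ⟨Bool, inferInstance, fun s => if s then e.north else e,
    fun s => if s then ![0, gridWeight m n e.a] else 0, v, {z | (0 < z 1 ∧
    z 1 < gridWeight m n e.a + gridWeight m n e.north.a) ∧ (0 < z 0 ∧ z 0 < gridWeight m n e.b)},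
    ?_, ⟨⟨by linarith, by linarith⟩, h1, h1'⟩, ?_, ?_, ?_, false, by simpa using hv,
    surfaceX_param_congr rfl _ _ (sub_zero v).symm⟩
  · have hc0 : Continuous fun z : Plane => z 0 := continuous_apply 0
    have hc1 : Continuous fun z : Plane => z 1 := continuous_apply 1
    exact ((isOpen_lt continuous_const hc1).inter (isOpen_lt hc1 continuous_const)).inter
      ((isOpen_lt continuous_const hc0).inter (isOpen_lt hc0 continuous_const))
  · rintro z ⟨⟨h0, h0'⟩, h1, h1'⟩
    rcases le_total (z 1) (gridWeight m n e.a) with h | h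
    · refine ⟨false, mem_gridRect.2 ?_⟩
      simp only [Bool.false_eq_true, if_false, sub_zero]
      exact ⟨⟨h1.le, h1'.le⟩, h0.le, h⟩
    · refine ⟨true, mem_gridRect.2 ?_⟩
      simp only [if_true, Pi.sub_apply, Matrix.cons_val_zero, Matrix.cons_val_one, hea]
      exact ⟨⟨by linarith, by linarith⟩, by linarith, by linarith⟩
  · have key : ∀ z : Plane, ∀ (hα : z - (0 : Plane) ∈ gridRect e)
        (hβ : z - ![0, gridWeight m n e.a] ∈ gridRect e.north),
        (surfaceX m n).param ⟨e, _, hα⟩ = (surfaceX m n).param ⟨e.north, _, hβ⟩ := by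
      intro z hα hβ
      have h1 := mem_gridRect.1 hα
      have h2 := mem_gridRect.1 hβ
      simp only [Pi.sub_apply, Matrix.cons_val_zero, Matrix.cons_val_one, Pi.zero_apply, sub_zero]
          at h1 h2
      refine Quot.sound (RectGlue.top_bottom e _ _ ?_ ?_ ?_) <;>
        simp only [Pi.sub_apply, Matrix.cons_val_zero, Matrix.cons_val_one, Pi.zero_apply,
            sub_zero] <;> linarith
    rintro z - (_ | _) (_ | _) hα hβ
    · rfl
    · exact key z hα hβ
    · exact (key z hβ hα).symm
    · rfl
  · rintro z ⟨⟨h0, h0'⟩, h1, h1'⟩ x y h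
    simp only [Bool.exists_bool, Bool.false_eq_true, if_false, if_true, sub_zero]
    cases h with
    | top_bottom e₁ p q hp hq h =>
      simp only [EmbeddingLike.apply_eq_iff_eq]
      constructor
      · rintro (⟨rfl, hz⟩ | ⟨rfl, hz⟩)
        · refine Or.inr ⟨rfl, plane_ext ?_ ?_⟩
          · simp [← hz, h]
          · simp [← hz, hq, hp]
        · rw [hz] at hp; simp at hp; linarith
      · rintro (⟨rfl, hz⟩ | ⟨rfl, hz⟩)
        · rw [hz] at hq; linarith
        · refine Or.inl ⟨rfl, plane_ext ?_ ?_⟩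
          · rw [← h, hz]; simp
          · rw [hz] at hq; simp at hq; linarith
    | right_left e₁ p q hp hq h =>
      constructor
      · rintro (⟨rfl, hz⟩ | ⟨rfl, hz⟩) <;> rw [hz] at hp
        · linarith
        · simp [hea] at hp; linarith
      · rintro (⟨-, hz⟩ | ⟨-, hz⟩) <;> rw [hz] at hq
        · linarith
        · simp at hq; linarith

end HasPlacement

/-- Only corners of rectangles can fail, and there are four for each edge. No cone angles have to be
computed. -/
theorem finite_not_hasPlacement (m n : ℕ) : {p | ¬ HasPlacement m n p}.Finite := by
  have hmem : ∀ (e : GridEdge m n) (s s' : Bool), ![if s then gridWeight m n e.b else 0,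
      if s' then gridWeight m n e.a else 0] ∈ gridRect e := by
    intro e s s'
    have h1 := (gridWeight_pos e.a_node).le
    have h2 := (gridWeight_pos e.b_node).le
    rw [mem_gridRect]
    cases s <;> cases s' <;> simp [h1, h2]
  refine (Set.finite_range fun x : GridEdge m n × Bool × Bool =>
    (surfaceX m n).param ⟨x.1, _, hmem x.1 x.2.1 x.2.2⟩).subset ?_
  intro p hp
  by_contra hnc
  refine hp ?_
  obtain ⟨⟨e, v, hv⟩, rfl⟩ := (surfaceX m n).isQuotientMap_param.surjective p
  have hv' := mem_gridRect.1 hv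
  have hcorner : ∀ s s' : Bool, ¬ (v 0 = (if s then gridWeight m n e.b else 0) ∧
      v 1 = if s' then gridWeight m n e.a else 0) := by
    rintro s s' ⟨h0, h1⟩
    exact hnc ⟨⟨e, s, s'⟩, surfaceX_param_congr rfl _ _ (plane_ext h0.symm h1.symm)⟩
  have c00 := hcorner false false
  have c01 := hcorner false true
  have c10 := hcorner true false
  have c11 := hcorner true true
  simp only [Bool.false_eq_true, if_false, if_true] at c00 c01 c10 c11
  obtain ⟨⟨h0, h0'⟩, h1, h1'⟩ := hv'
  rcases h0.eq_or_lt with h0 | h0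
  · have ha : 0 < v 1 := lt_of_le_of_ne h1 fun h => c00 ⟨h0.symm, h.symm⟩
    have ha' : v 1 < gridWeight m n e.a := lt_of_le_of_ne h1' fun h => c01 ⟨h0.symm, h⟩
    -- A point of a left side also lies on the right side of the preceding rectangle.
    obtain ⟨e, rfl⟩ := GridEdge.east.surjective e
    have hw : ![gridWeight m n e.b, v 1] ∈ gridRect e := by
      rw [mem_gridRect]
      exact ⟨⟨(gridWeight_pos e.b_node).le, le_rfl⟩, ha.le, h1'⟩
    have : (surfaceX m n).param ⟨e.east, v, hv⟩ = (surfaceX m n).param ⟨e, _, hw⟩ :=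
      (Quot.sound (RectGlue.right_left e ⟨_, hw⟩ ⟨v, hv⟩ rfl h0.symm rfl)).symm
    rw [this]
    exact .of_right e _ hw rfl ha ha'
  rcases h1.eq_or_lt with h1 | h1
  · have ha' : v 0 < gridWeight m n e.b := lt_of_le_of_ne h0' fun h => c10 ⟨h, h1.symm⟩
    obtain ⟨e, rfl⟩ := GridEdge.north.surjective e
    have hw : ![v 0, gridWeight m n e.a] ∈ gridRect e := by
      rw [mem_gridRect]
      exact ⟨⟨h0.le, h0'⟩, (gridWeight_pos e.a_node).le, le_rfl⟩
    have : (surfaceX m n).param ⟨e.north, v, hv⟩ = (surfaceX m n).param ⟨e, _, hw⟩ :=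
      (Quot.sound (RectGlue.top_bottom e ⟨_, hw⟩ ⟨v, hv⟩ rfl h1.symm rfl)).symm
    rw [this]
    exact .of_top e _ hw rfl h0 ha'
  rcases h0'.eq_or_lt with h0' | h0'
  · exact .of_right e v hv h0' h1 (lt_of_le_of_ne h1' fun h => c11 ⟨h0', h⟩)
  rcases h1'.eq_or_lt with h1' | h1'
  · exact .of_top e v hv h1' h0 h0'
  · exact .of_interior e v hv h0 h0' h1 h1'

theorem finite_not_isRegularPoint_surfaceX (m n : ℕ) :
    {p | ¬ (surfaceX m n).IsRegularPoint p}.Finite :=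
  (finite_not_hasPlacement m n).subset fun _ hp h => hp h.isRegularPoint

theorem finite_not_isRegularPoint_surfaceXe {m n : ℕ} (hm : Even m) (hn : Even n) :
    {p | ¬ (surfaceXe hm hn).IsRegularPoint p}.Finite := by
  refine ((finite_not_hasPlacement m n).image (Quot.mk _)).subset fun p hp => ?_
  induction p using Quot.ind with
  | mk p => exact ⟨p, fun h => hp (h.isRegularPoint_quotient hm hn), rfl⟩

/-! ### Rows and columns of a semiregular polygon -/

noncomputable section

/-! ### The staircase decomposition of a semiregular polygon -/

/-- The point of the plane with sheared coordinates `(x, y)`. -/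
def shear (n : ℕ) (x y : ℝ) : Plane := (derivMu n).mulVec ![x, y]

/-- The first sheared coordinate of a point of the plane; the second one is its height. -/
def unshear (n : ℕ) (p : Plane) : ℝ := Real.sin (Real.pi / n) * p 0 + Real.cos (Real.pi / n) * p 1

/-- The height of row `r`, for side lengths `s`. -/
def rowHeight (n : ℕ) (s : ℕ → ℝ) (r : ℕ) : ℝ := s r * Real.sin (r * Real.pi / n)

/-- The width of column `c`, for side lengths `s`. -/
def colWidth (n : ℕ) (s : ℕ → ℝ) (c : ℕ) : ℝ := s (c + 1) * Real.sin (c * Real.pi / n)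

/-- The height of the lower side of row `r`. -/
def rowPos (n : ℕ) (s : ℕ → ℝ) (r : ℕ) : ℝ := ∑ l ∈ Finset.range r, rowHeight n s l

/-- The position of the left side of column `c`. -/
def colPos (n : ℕ) (s : ℕ → ℝ) (c : ℕ) : ℝ := ∑ l ∈ Finset.range c, colWidth n s l

/-- The point with sheared coordinates `(x, y)` lies in the part of the cell in row `r` and
column `c` that belongs to the polygon: the whole cell, its upper left triangle or its lower
right triangle. -/
def InCell (n : ℕ) (s : ℕ → ℝ) (r c : ℕ) (x y : ℝ) : Prop :=
  (colPos n s c ≤ x ∧ x ≤ colPos n s (c + 1)) ∧ (rowPos n s r ≤ y ∧ y ≤ rowPos n s (r + 1)) ∧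
  (c = r + 1 → (x - colPos n s c) * rowHeight n s r ≤ (y - rowPos n s r) * colWidth n s c) ∧
  (c + 1 = r → (y - rowPos n s r) * colWidth n s c ≤ (x - colPos n s c) * rowHeight n s r)

/-- The cells that meet the polygon. -/
def InBand (r c : ℕ) : Prop := c = r ∨ c = r + 1 ∨ c + 1 = r

theorem sin_pi_div_pos {n : ℕ} (hn : 2 ≤ n) : 0 < Real.sin (Real.pi / n) := by
  have := sin_nat_mul_pi_div_pos (N := n) (i := 1) one_pos (by omega)
  simpa using this

theorem shear_apply (n : ℕ) (x y : ℝ) :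
    shear n x y = ![x / Real.sin (Real.pi / n) - y * Real.cot (Real.pi / n), y] := by
  simp only [shear, derivMu]
  ext i; fin_cases i <;> (simp [Matrix.mulVec, dotProduct]; try ring)

theorem shear_zero {n : ℕ} (hn : 2 ≤ n) (x y : ℝ) :
    shear n x y 0 = (x - y * Real.cos (Real.pi / n)) / Real.sin (Real.pi / n) := by
  have := (sin_pi_div_pos hn).ne'
  rw [shear_apply, Real.cot_eq_cos_div_sin]
  simp only [Matrix.cons_val_zero]
  ring

theorem shear_one (n : ℕ) (x y : ℝ) : shear n x y 1 = y := by simp [shear_apply]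

theorem shear_add (n : ℕ) (x y x' y' : ℝ) :
    shear n (x + x') (y + y') = shear n x y + shear n x' y' := by
  rw [shear, shear, shear, ← Matrix.mulVec_add]; simp

theorem unshear_shear {n : ℕ} (hn : 2 ≤ n) (x y : ℝ) : unshear n (shear n x y) = x := by
  have := (sin_pi_div_pos hn).ne'
  rw [unshear, shear_zero hn, shear_one]
  field_simp
  ring

theorem shear_unshear {n : ℕ} (hn : 2 ≤ n) (p : Plane) : shear n (unshear n p) (p 1) = p := by
  have := (sin_pi_div_pos hn).ne'
  refine plane_ext ?_ (shear_one _ _ _)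
  rw [shear_zero hn, unshear]
  field_simp
  ring

section

variable {n : ℕ} {s : ℕ → ℝ}

theorem rowPos_succ (r : ℕ) : rowPos n s (r + 1) = rowPos n s r + rowHeight n s r :=
  Finset.sum_range_succ _ _

theorem colPos_succ (c : ℕ) : colPos n s (c + 1) = colPos n s c + colWidth n s c :=
  Finset.sum_range_succ _ _

theorem colPos_zero : colPos n s 0 = 0 := Finset.sum_range_zero _

theorem rowPos_zero : rowPos n s 0 = 0 := Finset.sum_range_zero _

theorem colWidth_zero : colWidth n s 0 = 0 := by simp [colWidth]

theorem rowHeight_zero : rowHeight n s 0 = 0 := by simp [rowHeight]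

theorem colPos_one : colPos n s 1 = 0 := by rw [colPos_succ, colPos_zero, colWidth_zero, add_zero]

theorem rowPos_one : rowPos n s 1 = 0 := by rw [rowPos_succ, rowPos_zero, rowHeight_zero, add_zero]

theorem colWidth_self (hn : 2 ≤ n) : colWidth n s n = 0 := by
  have : (n : ℝ) ≠ 0 := by positivity
  rw [colWidth, mul_div_cancel_left₀ _ this, Real.sin_pi, mul_zero]

theorem rowHeight_self (hn : 2 ≤ n) : rowHeight n s n = 0 := by
  have : (n : ℝ) ≠ 0 := by positivity
  rw [rowHeight, mul_div_cancel_left₀ _ this, Real.sin_pi, mul_zero]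

theorem periodic_congr (hs : ∀ r, s (r + 2) = s r) {a b : ℕ} (h : a % 2 = b % 2) : s a = s b := by
  have key : ∀ a, s a = s (a % 2) := by
    intro a
    induction a using Nat.twoStepInduction with
    | zero => rfl
    | one => rfl
    | more a ih _ => rw [hs, ih]; congr 1; omega
  rw [key a, key b, h]

theorem sin_nat_mul_nonneg {t : ℕ} (ht : t ≤ n) : 0 ≤ Real.sin (t * Real.pi / n) := by
  rcases Nat.eq_zero_or_pos n with rfl | hn
  · simp
  have hn' : (0 : ℝ) < n := by exact_mod_cast hn
  refine Real.sin_nonneg_of_nonneg_of_le_pi (by positivity) ?_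
  rw [div_le_iff₀ hn', mul_comm]
  exact mul_le_mul_of_nonneg_left (by exact_mod_cast ht) Real.pi_pos.le

theorem rowHeight_nonneg (h0 : ∀ r, 0 ≤ s r) {r : ℕ} (hr : r ≤ n) : 0 ≤ rowHeight n s r :=
  mul_nonneg (h0 r) (sin_nat_mul_nonneg hr)

theorem colWidth_nonneg (h0 : ∀ r, 0 ≤ s r) {c : ℕ} (hc : c ≤ n) : 0 ≤ colWidth n s c :=
  mul_nonneg (h0 _) (sin_nat_mul_nonneg hc)

/-- This is the addition formula for `sin((i+1)π/n)`. It makes side `i` the diagonal of a cell in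
row `i` and column `i + 1`; by the period 2 of `s`, both sizes contain the same factor `s i`. -/
theorem semiEdge_eq_shear (hn : 2 ≤ n) (hs : ∀ r, s (r + 2) = s r) (i : ℕ) :
    semiEdge n (s 0) (s 1) i = shear n (colWidth n s (i + 1)) (rowHeight n s i) := by
  have hsin := (sin_pi_div_pos hn).ne'
  have hi : (if Even i then s 0 else s 1) = s i := by
    split_ifs with h
    · exact periodic_congr hs (by rw [Nat.even_iff] at h; omega)
    · exact periodic_congr hs (by rw [Nat.not_even_iff] at h; omega)
  have harg : ((i + 1 : ℕ) : ℝ) * Real.pi / n = i * Real.pi / n + Real.pi / n := by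
    push_cast; ring
  rw [semiEdge, hi]
  refine plane_ext ?_ ?_
  · rw [shear_zero hn, colWidth, hs, rowHeight, harg, Real.sin_add]
    simp only [Pi.smul_apply, Matrix.cons_val_zero, smul_eq_mul]
    field_simp
    ring
  · rw [shear_one, rowHeight]
    simp

/-- The shift by one comes from side `i` spanning column `i + 1`. For large indices the sizes are
negative, so that the same sums also describe the way back along the left boundary. -/
theorem semiVertex_eq_shear (hn : 2 ≤ n) (hs : ∀ r, s (r + 2) = s r) (i : ℕ) :
    semiVertex n (s 0) (s 1) i = shear n (colPos n s (i + 1)) (rowPos n s i) := by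
  induction i with
  | zero =>
    rw [colPos_one, rowPos_zero]
    refine plane_ext ?_ ?_ <;> simp [semiVertex, shear_apply]
  | succ i ih =>
    rw [semiVertex, Finset.sum_range_succ, ← semiVertex, ih, semiEdge_eq_shear hn hs, ← shear_add,
      ← colPos_succ, ← rowPos_succ]

theorem sin_add_eq_neg_sin_sub (hn : 2 ≤ n) {a b t : ℕ} (ha : a = n + t) (hb : b + t = n) :
    Real.sin (a * Real.pi / n) = -Real.sin (b * Real.pi / n) := by
  have hn0 : (n : ℝ) ≠ 0 := by positivity
  have h1 : (a : ℝ) * Real.pi / n = t * Real.pi / n + Real.pi := by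
    rw [ha]; push_cast; field_simp; ring
  have h2 : (b : ℝ) * Real.pi / n = Real.pi - t * Real.pi / n := by
    have : (b : ℝ) = n - t := by rw [← hb]; push_cast; ring
    rw [this]; field_simp
  rw [h1, h2, Real.sin_add_pi, Real.sin_pi_sub]

/-- Sines at angles `π + α` are negative: beyond `n` the boundary walk undoes the columns in reverse
order. Period 2 of `s` makes the side lengths match. -/
theorem colPos_reflect (hn : 2 ≤ n) (hs : ∀ r, s (r + 2) = s r) {t : ℕ} (ht : t ≤ n) :
    colPos n s (n + 1 + t) = colPos n s (n - t) := by
  induction t with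
  | zero => rw [add_zero, colPos_succ, colWidth_self hn, add_zero, Nat.sub_zero]
  | succ t ih =>
    have h1 : n - t = n - (t + 1) + 1 := by omega
    rw [← add_assoc, colPos_succ, ih (by omega), h1, colPos_succ, colWidth, colWidth,
      sin_add_eq_neg_sin_sub hn (a := n + 1 + t) (t := t + 1) (b := n - (t + 1)) (by ring)
        (by omega),
      periodic_congr hs (a := n + 1 + t + 1) (b := n - (t + 1) + 1) (by omega)]
    ring

theorem rowPos_reflect (hn : 2 ≤ n) (hs : ∀ r, s (r + 2) = s r) {t : ℕ} (ht : t ≤ n) :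
    rowPos n s (n + t) = rowPos n s (n - t + 1) := by
  induction t with
  | zero => rw [add_zero, Nat.sub_zero, rowPos_succ, rowHeight_self hn, add_zero]
  | succ t ih =>
    have h1 : n - t = n - (t + 1) + 1 := by omega
    rw [← add_assoc, rowPos_succ, ih (by omega), rowPos_succ, rowHeight, rowHeight,
      sin_add_eq_neg_sin_sub hn (t := t) (b := n - t) rfl (by omega),
      periodic_congr hs (a := n + t) (b := n - t) (by omega), ← h1]
    ring

/-- The left vertices of the polygon. -/
theorem semiVertex_left (hn : 2 ≤ n) (hs : ∀ r, s (r + 2) = s r) {r : ℕ} (hr : r ≤ n) :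
    semiVertex n (s 0) (s 1) (2 * n - r) = shear n (colPos n s r) (rowPos n s (r + 1)) := by
  have h1 := colPos_reflect hn hs (t := n - r) (by omega)
  have h2 := rowPos_reflect hn hs (t := n - r) (by omega)
  rw [semiVertex_eq_shear hn hs]
  congr 1
  · rw [show 2 * n - r + 1 = n + 1 + (n - r) by omega, h1]; congr 1; omega
  · rw [show 2 * n - r = n + (n - r) by omega, h2]; congr 1; omega

theorem semiVertex_two_mul (hn : 2 ≤ n) (hs : ∀ r, s (r + 2) = s r) :
    semiVertex n (s 0) (s 1) (2 * n) = semiVertex n (s 0) (s 1) 0 := by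
  have := semiVertex_left hn hs (r := 0) (by omega)
  rw [Nat.sub_zero] at this
  rw [this, semiVertex_eq_shear hn hs, colPos_zero, colPos_one, rowPos_zero, rowPos_one]

/-! ### Supporting lines of the sides -/

/-- This and the next identity compute the change of the distance to a supporting line along one
side of the polygon; its sign is that of a single sine. -/
theorem sin_mul_sin_sub (a b t : ℝ) : Real.sin a * Real.sin (b + t) -
    Real.sin (a + t) * Real.sin b = Real.sin t * Real.sin (a - b) := by
  rw [Real.sin_add, Real.sin_add, Real.sin_sub]; ring

theorem sin_mul_sin_sub' (a b t : ℝ) : Real.sin (a + t) * Real.sin (b + t) -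
    Real.sin a * Real.sin b = Real.sin t * Real.sin (a + b + t) := by
  rw [Real.sin_add, Real.sin_add, Real.sin_add (a + b), Real.sin_add a b, Real.cos_add]
  have h := Real.sin_sq_add_cos_sq t
  linear_combination (Real.sin a * Real.sin b) * h

theorem succ_mul_pi_div (n r : ℕ) :
    ((r + 1 : ℕ) : ℝ) * Real.pi / n = r * Real.pi / n + Real.pi / n := by push_cast; ring

/-- Every vertex lies on the inner side of the line through the right side of row `r`. -/
theorem right_side_nonneg (hn : 2 ≤ n) (hs : ∀ r, s (r + 2) = s r) (h0 : ∀ r, 0 ≤ s r) {r l : ℕ}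
    (hr : r ≤ n) (hl : l ≤ 2 * n) :
    0 ≤ (rowPos n s l - rowPos n s r) * Real.sin ((r + 1 : ℕ) * Real.pi / n) -
      (colPos n s (l + 1) - colPos n s (r + 1)) * Real.sin (r * Real.pi / n) := by
  have hn0 : (n : ℝ) ≠ 0 := by positivity
  have hθ := (sin_pi_div_pos hn).le
  set T : ℕ → ℝ := fun l =>
    (rowPos n s l - rowPos n s r) * Real.sin ((r + 1 : ℕ) * Real.pi / n) -
      (colPos n s (l + 1) - colPos n s (r + 1)) * Real.sin (r * Real.pi / n) with hT
  -- `T` vanishes at vertex `r`, increases along the next `n` sides and then decreases until the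
  -- walk around the polygon closes up. Thus vertex `r` is a minimum; `up`, `down` and `last` are
  -- the arcs of this walk.
  have step : ∀ l, T (l + 1) = T l + s l * (Real.sin (Real.pi / n) *
      Real.sin (l * Real.pi / n - r * Real.pi / n)) := by
    intro l
    rw [← sin_mul_sin_sub]
    simp only [hT]
    rw [rowPos_succ, colPos_succ (l + 1), rowHeight, colWidth, hs, succ_mul_pi_div n l,
      succ_mul_pi_div n r]
    ring
  have up : ∀ t ≤ n, 0 ≤ T (r + t) := by
    intro t
    induction t with
    | zero => intro _; simp [hT]
    | succ t ih =>
      intro ht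
      rw [← add_assoc, step]
      have h1 : ((r + t : ℕ) : ℝ) * Real.pi / n - r * Real.pi / n = t * Real.pi / n := by
        push_cast; ring
      rw [h1]
      have h2 := sin_nat_mul_nonneg (n := n) (t := t) (by omega)
      have h3 := ih (by omega)
      have h4 := h0 (r + t)
      positivity
  have down : ∀ t ≤ r, 0 ≤ T (r - t) := by
    intro t
    induction t with
    | zero => intro _; simp [hT]
    | succ t ih =>
      intro ht
      have h3 := ih (by omega)
      have h5 : r - t = r - (t + 1) + 1 := by omega
      rw [h5, step] at h3
      have h1 : ((r - (t + 1) : ℕ) : ℝ) * Real.pi / n - r * Real.pi / n =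
          -((t + 1 : ℕ) * Real.pi / n) := by
        rw [Nat.cast_sub ht]; push_cast; ring
      rw [h1, Real.sin_neg] at h3
      have h2 := sin_nat_mul_nonneg (n := n) (t := t + 1) (by omega)
      have h4 := mul_nonneg (h0 (r - (t + 1))) (mul_nonneg hθ h2)
      linarith
  have per : T (2 * n) = T 0 := by
    have h1 := colPos_reflect hn hs (t := n) le_rfl
    have h2 := rowPos_reflect hn hs (t := n) le_rfl
    rw [Nat.sub_self] at h1 h2
    simp only [hT]
    rw [show 2 * n + 1 = n + 1 + n by ring, two_mul, h1, h2, colPos_zero, zero_add, colPos_one,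
      rowPos_one, rowPos_zero]
  have last : ∀ t ≤ n - r, 0 ≤ T (2 * n - t) := by
    intro t
    induction t with
    | zero =>
      intro _
      rw [Nat.sub_zero, per]
      simpa using down r le_rfl
    | succ t ih =>
      intro ht
      have h3 := ih (by omega)
      have h5 : 2 * n - t = 2 * n - (t + 1) + 1 := by omega
      rw [h5, step] at h3
      have h1 : ((2 * n - (t + 1) : ℕ) : ℝ) * Real.pi / n - r * Real.pi / n =
          2 * Real.pi - (t + 1 + r : ℕ) * Real.pi / n := by
        rw [Nat.cast_sub (by omega)]; push_cast; field_simp; ring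
      rw [h1, Real.sin_two_pi_sub] at h3
      have h2 := sin_nat_mul_nonneg (n := n) (t := t + 1 + r) (by omega)
      have h4 := mul_nonneg (h0 (2 * n - (t + 1))) (mul_nonneg hθ h2)
      linarith
  change 0 ≤ T l
  rcases le_total l r with h | h
  · have := down (r - l) (by omega)
    rwa [Nat.sub_sub_self h] at this
  rcases le_total l (r + n) with h' | h'
  · have := up (l - r) (by omega)
    rwa [Nat.add_sub_cancel' h] at this
  · have := last (2 * n - l) (by omega)
    rwa [Nat.sub_sub_self hl] at this

/-- Every vertex lies on the inner side of the line through the left side of row `r + 1`. -/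
theorem left_side_nonneg (hn : 2 ≤ n) (hs : ∀ r, s (r + 2) = s r) (h0 : ∀ r, 0 ≤ s r) {r l : ℕ}
    (hr : r < n) (hl : l ≤ 2 * n) :
    0 ≤ (colPos n s (l + 1) - colPos n s r) * Real.sin ((r + 1 : ℕ) * Real.pi / n) -
      (rowPos n s l - rowPos n s (r + 1)) * Real.sin (r * Real.pi / n) := by
  have hn0 : (n : ℝ) ≠ 0 := by positivity
  have hθ := (sin_pi_div_pos hn).le
  set T : ℕ → ℝ := fun l =>
    (colPos n s (l + 1) - colPos n s r) * Real.sin ((r + 1 : ℕ) * Real.pi / n) -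
      (rowPos n s l - rowPos n s (r + 1)) * Real.sin (r * Real.pi / n) with hT
  -- The same walk, now with its minimum at the left vertex `2n - (r + 1)`.
  have step : ∀ l, T (l + 1) = T l + s l * (Real.sin (Real.pi / n) *
      Real.sin (l * Real.pi / n + r * Real.pi / n + Real.pi / n)) := by
    intro l
    rw [← sin_mul_sin_sub']
    simp only [hT]
    rw [rowPos_succ l, colPos_succ (l + 1), rowHeight, colWidth, hs, succ_mul_pi_div n l,
      succ_mul_pi_div n r]
    ring
  have zero : T (2 * n - (r + 1)) = 0 := by
    have h1 := colPos_reflect hn hs (t := n - (r + 1)) (by omega)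
    have h2 := rowPos_reflect hn hs (t := n - (r + 1)) (by omega)
    rw [show n - (n - (r + 1)) = r + 1 by omega] at h1 h2
    simp only [hT]
    rw [show 2 * n - (r + 1) + 1 = n + 1 + (n - (r + 1)) by omega,
      show 2 * n - (r + 1) = n + (n - (r + 1)) by omega, h1, h2, rowPos_succ (r + 1),
      colPos_succ, rowHeight, colWidth]
    ring
  have up : ∀ t ≤ r + 1, 0 ≤ T (2 * n - (r + 1) + t) := by
    intro t
    induction t with
    | zero => intro _; rw [add_zero, zero]
    | succ t ih =>
      intro ht
      rw [← add_assoc, step]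
      have h1 : ((2 * n - (r + 1) + t : ℕ) : ℝ) * Real.pi / n + r * Real.pi / n + Real.pi / n =
          t * Real.pi / n + 2 * Real.pi := by
        rw [Nat.cast_add, Nat.cast_sub (by omega)]; push_cast; field_simp; ring
      rw [h1, Real.sin_add_two_pi]
      have h2 := sin_nat_mul_nonneg (n := n) (t := t) (by omega)
      have h3 := ih (by omega)
      have h4 := h0 (2 * n - (r + 1) + t)
      positivity
  have down : ∀ t ≤ n, t ≤ 2 * n - (r + 1) → 0 ≤ T (2 * n - (r + 1) - t) := by
    intro t
    induction t with
    | zero => intro _ _; rw [Nat.sub_zero, zero]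
    | succ t ih =>
      intro ht ht'
      have h3 := ih (by omega) (by omega)
      have h5 : 2 * n - (r + 1) - t = 2 * n - (r + 1) - (t + 1) + 1 := by omega
      rw [h5, step] at h3
      have h1 : ((2 * n - (r + 1) - (t + 1) : ℕ) : ℝ) * Real.pi / n + r * Real.pi / n +
          Real.pi / n = 2 * Real.pi - (t + 1 : ℕ) * Real.pi / n := by
        rw [Nat.cast_sub ht', Nat.cast_sub (by omega)]; push_cast; field_simp; ring
      rw [h1, Real.sin_two_pi_sub] at h3
      have h2 := sin_nat_mul_nonneg (n := n) (t := t + 1) (by omega)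
      have h4 := mul_nonneg (h0 (2 * n - (r + 1) - (t + 1))) (mul_nonneg hθ h2)
      linarith
  have per : T (2 * n) = T 0 := by
    have h1 := colPos_reflect hn hs (t := n) le_rfl
    have h2 := rowPos_reflect hn hs (t := n) le_rfl
    rw [Nat.sub_self] at h1 h2
    simp only [hT]
    rw [show 2 * n + 1 = n + 1 + n by ring, two_mul, h1, h2, colPos_zero, zero_add, colPos_one,
      rowPos_one, rowPos_zero]
  have first : ∀ t ≤ n - (r + 1), 0 ≤ T t := by
    intro t
    induction t with
    | zero =>
      intro _
      rw [← per]
      have := up (r + 1) le_rfl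
      rwa [Nat.sub_add_cancel (by omega)] at this
    | succ t ih =>
      intro ht
      rw [step]
      have h1 : (t : ℝ) * Real.pi / n + r * Real.pi / n + Real.pi / n =
          (t + r + 1 : ℕ) * Real.pi / n := by
        push_cast; ring
      rw [h1]
      have h2 := sin_nat_mul_nonneg (n := n) (t := t + r + 1) (by omega)
      have h3 := ih (by omega)
      have h4 := h0 t
      positivity
  change 0 ≤ T l
  rcases le_total l (n - (r + 1)) with h | h
  · exact first l h
  rcases le_total l (2 * n - (r + 1)) with h' | h'
  · have := down (2 * n - (r + 1) - l) (by omega) (by omega)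
    rwa [Nat.sub_sub_self h'] at this
  · have := up (l - (2 * n - (r + 1))) (by omega)
    rwa [Nat.add_sub_cancel' h'] at this

end

end

/-! ### Cells of a semiregular polygon -/

noncomputable section

section

variable {n : ℕ} {s : ℕ → ℝ}

theorem rowPos_mono (h0 : ∀ r, 0 ≤ s r) {a b : ℕ} (hab : a ≤ b) (hb : b ≤ n + 1) :
    rowPos n s a ≤ rowPos n s b := by
  induction b, hab using Nat.le_induction with
  | base => exact le_rfl
  | succ b hab ih =>
    rw [rowPos_succ]
    have := rowHeight_nonneg h0 (n := n) (r := b) (by omega)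
    linarith [ih (by omega)]

theorem colPos_mono (h0 : ∀ r, 0 ≤ s r) {a b : ℕ} (hab : a ≤ b) (hb : b ≤ n + 1) :
    colPos n s a ≤ colPos n s b := by
  induction b, hab using Nat.le_induction with
  | base => exact le_rfl
  | succ b hab ih =>
    rw [colPos_succ]
    have := colWidth_nonneg h0 (n := n) (c := b) (by omega)
    linarith [ih (by omega)]

theorem le_of_mem_semiPolygon {a b : ℝ} {α β γ : ℝ}
    (h : ∀ l < 2 * n, γ ≤ α * semiVertex n a b l 0 + β * semiVertex n a b l 1) {p : Plane}
    (hp : p ∈ semiPolygon n a b) : γ ≤ α * p 0 + β * p 1 := by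
  have hconv : Convex ℝ {p : Plane | γ ≤ α * p 0 + β * p 1} := by
    refine convex_halfSpace_ge ⟨fun x y => ?_, fun c x => ?_⟩ γ
    · simp only [Pi.add_apply]; ring
    · simp only [Pi.smul_apply, smul_eq_mul]; ring
  refine convexHull_min ?_ hconv hp
  rintro _ ⟨l, rfl⟩
  exact h l l.2

/-- The sides `0` and `n` are horizontal, so their supporting lines bound the height. -/
theorem rowPos_bounds_of_mem (hn : 2 ≤ n) (hs : ∀ r, s (r + 2) = s r) (h0 : ∀ r, 0 ≤ s r)
    {p : Plane} (hp : p ∈ semiPolygon n (s 0) (s 1)) : 0 ≤ p 1 ∧ p 1 ≤ rowPos n s n := by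
  have hn0 : (n : ℝ) ≠ 0 := by positivity
  have hθ := sin_pi_div_pos hn
  constructor
  · have := le_of_mem_semiPolygon (n := n) (α := 0) (β := 1) (γ := 0) (fun l hl => by
      have h := right_side_nonneg hn hs h0 (r := 0) (l := l) (by omega) (by omega)
      rw [semiVertex_eq_shear hn hs, shear_one]
      simp only [rowPos_zero, sub_zero, zero_add, Nat.cast_one, one_mul, Nat.cast_zero, zero_mul,
        zero_div, Real.sin_zero, mul_zero] at h ⊢
      exact nonneg_of_mul_nonneg_left h hθ) hp
    linarith
  · have := le_of_mem_semiPolygon (n := n) (α := 0) (β := -1) (γ := -rowPos n s n) (fun l hl => by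
      have h := right_side_nonneg hn hs h0 (r := n) (l := l) (by omega) (by omega)
      rw [semiVertex_eq_shear hn hs, shear_one]
      rw [succ_mul_pi_div, mul_div_cancel_left₀ _ hn0, Real.sin_pi, add_comm Real.pi,
        Real.sin_add_pi] at h
      have : 0 ≤ (rowPos n s n - rowPos n s l) * Real.sin (Real.pi / n) := by linarith
      have := nonneg_of_mul_nonneg_left this hθ
      linarith) hp
    linarith

/-- Multiplication of the half-plane inequality by `s r` turns the sines into the sizes of a cell.
In this form it is the diagonal condition of `InCell`. -/
theorem right_side_of_mem (hn : 2 ≤ n) (hs : ∀ r, s (r + 2) = s r) (h0 : ∀ r, 0 ≤ s r)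
    {p : Plane} (hp : p ∈ semiPolygon n (s 0) (s 1)) {r : ℕ} (hr : r ≤ n) :
    (unshear n p - colPos n s (r + 1)) * rowHeight n s r ≤
      (p 1 - rowPos n s r) * colWidth n s (r + 1) := by
  set A := Real.sin ((r + 1 : ℕ) * Real.pi / n) with hA
  set B := Real.sin (r * Real.pi / n) with hB
  have := le_of_mem_semiPolygon (n := n) (α := -B * Real.sin (Real.pi / n))
    (β := A - B * Real.cos (Real.pi / n)) (γ := rowPos n s r * A - colPos n s (r + 1) * B)
    (fun l hl => by
      have h := right_side_nonneg hn hs h0 (r := r) (l := l) hr (by omega)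
      have h1 : unshear n (semiVertex n (s 0) (s 1) l) = colPos n s (l + 1) := by
        rw [semiVertex_eq_shear hn hs, unshear_shear hn]
      have h2 : semiVertex n (s 0) (s 1) l 1 = rowPos n s l := by
        rw [semiVertex_eq_shear hn hs, shear_one]
      rw [← h1, ← h2, unshear] at h
      linarith) hp
  rw [rowHeight, colWidth, hs, unshear]
  have h3 := mul_nonneg (h0 r) (sub_nonneg.2 this)
  linarith

theorem left_side_of_mem (hn : 2 ≤ n) (hs : ∀ r, s (r + 2) = s r) (h0 : ∀ r, 0 ≤ s r)
    {p : Plane} (hp : p ∈ semiPolygon n (s 0) (s 1)) {r : ℕ} (hr : r < n) :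
    (p 1 - rowPos n s (r + 1)) * colWidth n s r ≤
      (unshear n p - colPos n s r) * rowHeight n s (r + 1) := by
  set A := Real.sin ((r + 1 : ℕ) * Real.pi / n) with hA
  set B := Real.sin (r * Real.pi / n) with hB
  have := le_of_mem_semiPolygon (n := n) (α := A * Real.sin (Real.pi / n))
    (β := A * Real.cos (Real.pi / n) - B) (γ := colPos n s r * A - rowPos n s (r + 1) * B)
    (fun l hl => by
      have h := left_side_nonneg hn hs h0 (r := r) (l := l) hr (by omega)
      have h1 : unshear n (semiVertex n (s 0) (s 1) l) = colPos n s (l + 1) := by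
        rw [semiVertex_eq_shear hn hs, unshear_shear hn]
      have h2 : semiVertex n (s 0) (s 1) l 1 = rowPos n s l := by
        rw [semiVertex_eq_shear hn hs, shear_one]
      rw [← h1, ← h2, unshear] at h
      linarith) hp
  rw [rowHeight, colWidth, unshear]
  have h3 := mul_nonneg (h0 (r + 1)) (sub_nonneg.2 this)
  linarith

/-- The polygon is covered by its cells in the nondegenerate rows. -/
theorem exists_inCell (hn : 2 ≤ n) (hs : ∀ r, s (r + 2) = s r) (h0 : ∀ r, 0 ≤ s r) (h1 : 0 < s 1)
    {p : Plane} (hp : p ∈ semiPolygon n (s 0) (s 1)) :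
    ∃ r c, 1 ≤ r ∧ r < n ∧ 0 < s r ∧ InBand r c ∧ InCell n s r c (unshear n p) (p 1) := by
  obtain ⟨hy0, hy1⟩ := rowPos_bounds_of_mem hn hs h0 hp
  obtain ⟨r, hr1, hrn, hr⟩ : ∃ r, 1 ≤ r ∧ r < n ∧
      rowPos n s r ≤ p 1 ∧ p 1 ≤ rowPos n s (r + 1) := by
    -- Row `0` is flat, so the search runs over the rows `r + 1`, whose upper side has index `r +
    -- 2`.
    have hex : ∃ r, p 1 ≤ rowPos n s (r + 2) := ⟨n - 2, by rwa [Nat.sub_add_cancel hn]⟩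
    classical
    have hle : Nat.find hex ≤ n - 2 := Nat.find_min' hex (by rwa [Nat.sub_add_cancel hn])
    refine ⟨Nat.find hex + 1, by omega, by omega, ?_, Nat.find_spec hex⟩
    rcases Nat.eq_zero_or_pos (Nat.find hex) with h | h
    · rw [h, rowPos_one]; exact hy0
    · have h2 := Nat.find_min hex (m := Nat.find hex - 1) (by omega)
      rw [show Nat.find hex - 1 + 2 = Nat.find hex + 1 by omega] at h2
      exact (not_le.1 h2).le
  obtain ⟨r, hr1, hrn, hr, hsr⟩ : ∃ r, 1 ≤ r ∧ r < n ∧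
      (rowPos n s r ≤ p 1 ∧ p 1 ≤ rowPos n s (r + 1)) ∧ 0 < s r := by
    rcases (h0 r).lt_or_eq with h | h
    · exact ⟨r, hr1, hrn, hr, h⟩
    -- Since `s 1 > 0`, a row with `s r = 0` has even index. It is flat, so the point lies on the
    -- upper side of the odd row below, which is nondegenerate.
    · have hodd : r % 2 = 0 := by
        by_contra hne
        rw [periodic_congr hs (a := r) (b := 1) (by omega)] at h
        exact h1.ne h
      obtain ⟨q, rfl⟩ : ∃ q, r = q + 1 := ⟨r - 1, by omega⟩
      have hq : s q = s 1 := periodic_congr hs (by omega)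
      have hmono := rowPos_mono (n := n) h0 (Nat.le_succ q) (by omega)
      rw [rowPos_succ (q + 1), rowHeight, ← h, zero_mul, add_zero] at hr
      exact ⟨q, by omega, by omega, ⟨hmono.trans hr.1, hr.2⟩, hq ▸ h1⟩
  have hsin : 0 < Real.sin (r * Real.pi / n) := by
    have := sin_nat_mul_pi_div_pos (N := n) (i := r) (by omega) (by omega)
    exact_mod_cast this
  have hpos : 0 < rowHeight n s r := mul_pos hsr hsin
  obtain ⟨q, rfl⟩ : ∃ q, r = q + 1 := ⟨r - 1, by omega⟩
  have hR := right_side_of_mem hn hs h0 hp (r := q + 1) (by omega)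
  have hL := left_side_of_mem hn hs h0 hp (r := q) (by omega)
  have hw := colWidth_nonneg h0 (n := n) (c := q) (by omega)
  have hw' := colWidth_nonneg h0 (n := n) (c := q + 2) (by omega)
  have hh := rowPos_succ (n := n) (s := s) (q + 1)
  set x := unshear n p with hx
  rcases le_total x (colPos n s (q + 1)) with hx1 | hx1
  · refine ⟨q + 1, q, hr1, hrn, hsr, Or.inr (Or.inr rfl), ⟨?_, hx1⟩, hr, by omega, fun _ => hL⟩
    -- The supporting line of the left side also keeps the point from going beyond the neighbouring
    -- column.
    have : 0 ≤ (x - colPos n s q) * rowHeight n s (q + 1) :=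
      (mul_nonneg (sub_nonneg.2 hr.1) hw).trans hL
    linarith [nonneg_of_mul_nonneg_left this hpos]
  rcases le_total x (colPos n s (q + 1 + 1)) with hx2 | hx2
  · exact ⟨q + 1, q + 1, hr1, hrn, hsr, Or.inl rfl, ⟨hx1, hx2⟩, hr, by omega, by omega⟩
  · refine ⟨q + 1, q + 2, hr1, hrn, hsr, Or.inr (Or.inl rfl), ⟨hx2, ?_⟩, hr, fun _ => hR, by omega⟩
    have h3 : (x - colPos n s (q + 2)) * rowHeight n s (q + 1) ≤
        colWidth n s (q + 2) * rowHeight n s (q + 1) := by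
      refine hR.trans ?_
      rw [mul_comm]
      exact mul_le_mul_of_nonneg_left (by linarith [hr.2]) hw'
    have h4 := le_of_mul_le_mul_right h3 hpos
    rw [colPos_succ]
    linarith

/-! ### Convexity: the cells lie in the polygon -/

theorem shear_horizontal_mem {K : Set Plane} (hK : Convex ℝ K) {x x₁ x₂ y : ℝ}
    (h1 : shear n x₁ y ∈ K) (h2 : shear n x₂ y ∈ K) (hx1 : x₁ ≤ x) (hx2 : x ≤ x₂) :
    shear n x y ∈ K := by
  rcases hx1.eq_or_lt with rfl | hx1
  · exact h1
  have hpos : 0 < x₂ - x₁ := by linarith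
  have := hK h1 h2 (a := (x₂ - x) / (x₂ - x₁)) (b := (x - x₁) / (x₂ - x₁))
    (div_nonneg (by linarith) hpos.le) (div_nonneg (by linarith) hpos.le)
    (by rw [← add_div, sub_add_sub_cancel, div_self hpos.ne'])
  convert this using 1
  rw [shear, shear, shear, ← Matrix.mulVec_smul, ← Matrix.mulVec_smul, ← Matrix.mulVec_add]
  congr 1
  refine plane_ext ?_ ?_
  · simp; field_simp; ring
  · simp; field_simp; ring

theorem shear_segment_mem {K : Set Plane} (hK : Convex ℝ K) {x₁ x₂ y₁ y₂ t : ℝ}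
    (h1 : shear n x₁ y₁ ∈ K) (h2 : shear n x₂ y₂ ∈ K) (ht0 : 0 ≤ t) (ht1 : t ≤ 1) :
    shear n (x₁ + t * (x₂ - x₁)) (y₁ + t * (y₂ - y₁)) ∈ K := by
  have := hK h1 h2 (a := 1 - t) (b := t) (by linarith) ht0 (by ring)
  convert this using 1
  rw [shear, shear, shear, ← Matrix.mulVec_smul, ← Matrix.mulVec_smul, ← Matrix.mulVec_add]
  congr 1
  refine plane_ext ?_ ?_
  · simp; ring
  · simp; ring

/-- A point of a trapezoid with horizontal parallel sides, in sheared coordinates. -/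
theorem shear_trapezoid_mem {K : Set Plane} (hK : Convex ℝ K) {x₁ x₂ x₃ x₄ y₁ h x y : ℝ}
    (h1 : shear n x₁ y₁ ∈ K) (h2 : shear n x₂ y₁ ∈ K) (h3 : shear n x₃ (y₁ + h) ∈ K)
    (h4 : shear n x₄ (y₁ + h) ∈ K) (hy : y₁ ≤ y) (hy' : y ≤ y₁ + h)
    (hl : (y - y₁) * (x₃ - x₁) ≤ (x - x₁) * h)
    (hr : (x - x₂) * h ≤ (y - y₁) * (x₄ - x₂)) (hx : x₁ ≤ x ∨ x₃ ≤ x) (hx' : x ≤ x₂ ∨ x ≤ x₄) :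
    shear n x y ∈ K := by
  -- For height zero the slanted inequalities are void; the disjunctions `hx`, `hx'` are there for
  -- this case.
  rcases (show 0 ≤ h by linarith).eq_or_lt with rfl | hpos
  · rw [add_zero] at *
    obtain rfl : y = y₁ := le_antisymm hy' hy
    have hlow : ∃ z, shear n z y ∈ K ∧ z ≤ x := by
      rcases hx with hx | hx
      · exact ⟨_, h1, hx⟩
      · exact ⟨_, h3, hx⟩
    have hupp : ∃ z, shear n z y ∈ K ∧ x ≤ z := by
      rcases hx' with hx | hx
      · exact ⟨_, h2, hx⟩
      · exact ⟨_, h4, hx⟩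
    obtain ⟨z, hz, hzx⟩ := hlow
    obtain ⟨w, hw, hwx⟩ := hupp
    exact shear_horizontal_mem hK hz hw hzx hwx
  · set t := (y - y₁) / h with ht
    have ht0 : 0 ≤ t := div_nonneg (by linarith) hpos.le
    have ht1 : t ≤ 1 := by rw [ht, div_le_one hpos]; linarith
    have hth : t * h = y - y₁ := div_mul_cancel₀ _ hpos.ne'
    have hyt : y = y₁ + t * (y₁ + h - y₁) := by linear_combination -hth
    rw [hyt]
    refine shear_horizontal_mem hK (shear_segment_mem hK h1 h3 ht0 ht1)
      (shear_segment_mem hK h2 h4 ht0 ht1) ?_ ?_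
    · have : (t * (x₃ - x₁)) * h ≤ (x - x₁) * h := by linarith [congrArg (· * (x₃ - x₁)) hth]
      linarith [le_of_mul_le_mul_right this hpos]
    · have : (x - x₂) * h ≤ (t * (x₄ - x₂)) * h := by linarith [congrArg (· * (x₄ - x₂)) hth]
      linarith [le_of_mul_le_mul_right this hpos]

theorem shear_right_mem (hn : 2 ≤ n) (hs : ∀ r, s (r + 2) = s r) {r : ℕ} (hr : r ≤ n) :
    shear n (colPos n s (r + 1)) (rowPos n s r) ∈ semiPolygon n (s 0) (s 1) := by
  rw [← semiVertex_eq_shear hn hs]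
  exact subset_convexHull ℝ _ ⟨⟨r, by omega⟩, rfl⟩

theorem shear_left_mem (hn : 2 ≤ n) (hs : ∀ r, s (r + 2) = s r) {r : ℕ} (hr : r ≤ n) :
    shear n (colPos n s r) (rowPos n s (r + 1)) ∈ semiPolygon n (s 0) (s 1) := by
  rw [← semiVertex_left hn hs hr]
  rcases Nat.eq_zero_or_pos r with rfl | h
  · rw [Nat.sub_zero, semiVertex_two_mul hn hs]
    exact subset_convexHull ℝ _ ⟨⟨0, by omega⟩, rfl⟩
  · exact subset_convexHull ℝ _ ⟨⟨2 * n - r, by omega⟩, rfl⟩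

/-- The inner corners of the staircase lie on the horizontal chords that join a left vertex to the
right vertex of the same height. -/
theorem shear_chord_mem (hn : 2 ≤ n) (hs : ∀ r, s (r + 2) = s r) (h0 : ∀ r, 0 ≤ s r) {r : ℕ}
    (hr : r < n) : shear n (colPos n s (r + 1)) (rowPos n s (r + 1)) ∈ semiPolygon n (s 0) (s 1) :=
  shear_horizontal_mem (convex_convexHull ℝ _) (shear_left_mem hn hs hr.le)
    (shear_right_mem hn hs (r := r + 1) hr) (colPos_mono h0 (Nat.le_succ _) (by omega))
    (colPos_mono h0 (Nat.le_succ _) (by omega))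

/-- The points of the cells belong to the polygon. -/
theorem shear_mem_of_inCell (hn : 2 ≤ n) (hs : ∀ r, s (r + 2) = s r) (h0 : ∀ r, 0 ≤ s r) {r c : ℕ}
    (hr : r ≤ n) (hc : c ≤ n) (hrc : c = r → 1 ≤ r ∧ r < n) (hb : InBand r c) {x y : ℝ}
    (h : InCell n s r c x y) : shear n x y ∈ semiPolygon n (s 0) (s 1) := by
  have hK : Convex ℝ (semiPolygon n (s 0) (s 1)) := convex_convexHull ℝ _
  obtain ⟨⟨hx, hx'⟩, ⟨hy, hy'⟩, hup, hlow⟩ := h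
  rcases hb with rfl | rfl | rfl
  · obtain ⟨h1, h2⟩ := hrc rfl
    -- A whole cell has two vertices of the polygon and two points of chords as corners. In the
    -- triangles below, two corners are vertices and one lies on a chord.
    obtain ⟨q, rfl⟩ : ∃ q, c = q + 1 := ⟨c - 1, by omega⟩
    have e1 := shear_chord_mem hn hs h0 (r := q) (by omega)
    have e2 := shear_right_mem hn hs (r := q + 1) (by omega)
    have e3 := shear_left_mem hn hs (r := q + 1) (by omega)
    have e4 := shear_chord_mem hn hs h0 (r := q + 1) (by omega)
    rw [rowPos_succ] at e3 e4 hy'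
    have hm := colPos_mono (n := n) h0 (Nat.le_succ (q + 1)) (by omega)
    have hh := rowHeight_nonneg h0 (n := n) (r := q + 1) (by omega)
    refine shear_trapezoid_mem hK e1 e2 e3 e4 hy hy' ?_ ?_ (Or.inl hx) (Or.inl hx')
    · rw [sub_self, mul_zero]; exact mul_nonneg (by linarith) hh
    · rw [sub_self, mul_zero]; exact mul_nonpos_of_nonpos_of_nonneg (by linarith) hh
  · have e1 := shear_right_mem hn hs (r := r) hr
    have e3 := shear_chord_mem hn hs h0 (r := r) (by omega)
    have e4 := shear_right_mem hn hs (r := r + 1) hc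
    rw [rowPos_succ] at e3 e4 hy'
    have hm := colPos_mono (n := n) h0 (Nat.le_succ (r + 1)) (by omega)
    have hh := rowHeight_nonneg h0 (n := n) (r := r) (by omega)
    refine shear_trapezoid_mem hK e1 e1 e3 e4 hy hy' ?_ ?_ (Or.inl hx) (Or.inr hx')
    · rw [sub_self, mul_zero]; exact mul_nonneg (by linarith) hh
    · refine (hup rfl).trans_eq ?_
      rw [colPos_succ (r + 1)]; ring
  · have e1 := shear_left_mem hn hs (r := c) hc
    have e2 := shear_chord_mem hn hs h0 (r := c) (by omega)
    have e3 := shear_left_mem hn hs (r := c + 1) hr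
    rw [rowPos_succ (c + 1)] at e3 hy'
    have hm := colPos_mono (n := n) h0 (Nat.le_succ c) (by omega)
    have hh := rowHeight_nonneg h0 (n := n) (r := c + 1) (by omega)
    refine shear_trapezoid_mem hK e1 e2 e3 e3 hy hy' ?_ ?_ (Or.inl hx) (Or.inl hx')
    · refine le_trans (le_of_eq ?_) (hlow rfl)
      rw [colPos_succ]; ring
    · rw [sub_self, mul_zero]; exact mul_nonpos_of_nonpos_of_nonneg (by linarith) hh

end

end

/-! ### Rows and columns as nodes of the grid -/

noncomputable section

/-! ### The cells of the polygons and the edges of the grid graph -/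

/-- The first coordinate of the grid node of row `r` of `P(k)`: the one of `k`, `k + 1` that has
the parity of `r`. -/
def nodeCol (k r : ℕ) : ℕ := k + (k + r) % 2

/-- The second coordinate of the grid nodes of row and column `r` of `P(k)`. -/
def nodeRow (n k r : ℕ) : ℤ := if k % 2 = 1 then r else n - r

/-- The grid node of row `r` of `P(k)`. -/
def rowNode (n k r : ℕ) : ℤ × ℤ := (nodeCol k r, nodeRow n k r)

/-- The grid node of column `c` of `P(k)`. -/
def colNode (n k c : ℕ) : ℤ × ℤ := (nodeCol k (c + 1), nodeRow n k c)

/-- The length of side `r` of `P(k)`. -/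
def sideLen (m k r : ℕ) : ℝ := Real.sin (nodeCol k r * Real.pi / m)

variable {m n k : ℕ}

theorem sideLen_add_two (r : ℕ) : sideLen m k (r + 2) = sideLen m k r := by
  rw [sideLen, sideLen, nodeCol, nodeCol, show (k + (r + 2)) % 2 = (k + r) % 2 by omega]

theorem sideLen_nonneg (hk : k < m) (r : ℕ) : 0 ≤ sideLen m k r :=
  sin_nat_mul_nonneg (by unfold nodeCol; omega)

theorem sideLen_pos {r : ℕ} (h0 : 0 < nodeCol k r) (h1 : nodeCol k r < m) : 0 < sideLen m k r := by
  have := sin_nat_mul_pi_div_pos (N := m) (i := nodeCol k r) (by omega) (by omega)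
  exact_mod_cast this

/-- As `m` is even, only the even sides can degenerate, namely in `P(0)` and `P(m-1)`. -/
theorem sideLen_one_pos (hm : Even m) (hk : k < m) : 0 < sideLen m k 1 := by
  rw [Nat.even_iff] at hm
  exact sideLen_pos (by unfold nodeCol; omega) (by unfold nodeCol; omega)

theorem nodeCol_pos_of_sideLen_pos {r : ℕ} (hk : k < m) (h : 0 < sideLen m k r) :
    0 < nodeCol k r ∧ nodeCol k r < m := by
  constructor
  · by_contra h0
    rw [sideLen, Nat.eq_zero_of_not_pos h0] at h
    simp at h
  · by_contra h1
    have hm : (m : ℝ) ≠ 0 := by have : 0 < m := by omega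
                                positivity
    have h2 : nodeCol k r = m := by unfold nodeCol at h1 ⊢; omega
    rw [sideLen, h2, mul_div_cancel_left₀ _ hm, Real.sin_pi] at h
    exact h.ne rfl

theorem evenLen_eq_sideLen (hn : Even n) : evenLen m n k = sideLen m k 0 := by
  have hn' : ¬ Odd n := by simpa using hn
  simp only [evenLen, hn', false_or, sideLen, nodeCol, Nat.odd_iff, add_zero]
  rcases Nat.mod_two_eq_zero_or_one k with h | h <;> simp [h]

theorem oddLen_eq_sideLen (hn : Even n) : oddLen m n k = sideLen m k 1 := by
  have hn' : ¬ Odd n := by simpa using hn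
  simp only [oddLen, hn', false_or, sideLen, nodeCol, Nat.odd_iff]
  rcases Nat.mod_two_eq_zero_or_one k with h | h <;> simp [h, Nat.add_mod]

theorem polyP_eq (hn : Even n) : polyP m n k = semiPolygon n (sideLen m k 0) (sideLen m k 1) := by
  rw [polyP, evenLen_eq_sideLen hn, oddLen_eq_sideLen hn]

theorem sidePoint_eq (hn2 : 2 ≤ n) (hn : Even n) (i : ℕ) (t : ℝ) :
    sidePoint m n k i t =
      shear n (colPos n (sideLen m k) (i + 1) + t * colWidth n (sideLen m k) (i + 1))
        (rowPos n (sideLen m k) i + t * rowHeight n (sideLen m k) i) := by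
  rw [sidePoint, evenLen_eq_sideLen hn, oddLen_eq_sideLen hn,
    semiVertex_eq_shear hn2 sideLen_add_two, semiEdge_eq_shear hn2 sideLen_add_two, shear_add]
  congr 1
  rw [shear, shear, ← Matrix.mulVec_smul]; simp

/-- The points of the left side of row `r + 1`. -/
theorem sidePoint_left_eq (hn2 : 2 ≤ n) (hn : Even n) {r : ℕ} (hr : r < n) (t : ℝ) :
    sidePoint m n k (2 * n - (r + 1)) (1 - t) =
      shear n (colPos n (sideLen m k) r + t * colWidth n (sideLen m k) r)
        (rowPos n (sideLen m k) (r + 1) + t * rowHeight n (sideLen m k) (r + 1)) := by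
  have h : sidePoint m n k (2 * n - (r + 1)) (1 - t) =
      semiVertex n (sideLen m k 0) (sideLen m k 1) (2 * n - (r + 1)) + (1 - t) •
        (semiVertex n (sideLen m k 0) (sideLen m k 1) (2 * n - r) -
          semiVertex n (sideLen m k 0) (sideLen m k 1) (2 * n - (r + 1))) := by
    rw [sidePoint, evenLen_eq_sideLen hn, oddLen_eq_sideLen hn,
      show 2 * n - r = 2 * n - (r + 1) + 1 by omega, semiVertex, semiVertex,
      Finset.sum_range_succ, add_sub_cancel_left]
  rw [h, semiVertex_left hn2 sideLen_add_two hr.le, semiVertex_left hn2 sideLen_add_two hr,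
    rowPos_succ (r + 1), colPos_succ, shear_add, shear_add]
  have h2 : shear n (t * colWidth n (sideLen m k) r) (t * rowHeight n (sideLen m k) (r + 1)) =
      t • shear n (colWidth n (sideLen m k) r) (rowHeight n (sideLen m k) (r + 1)) := by
    rw [shear, shear, ← Matrix.mulVec_smul]; simp
  rw [h2]
  module

theorem sin_nodeRow (hn2 : 2 ≤ n) (r : ℕ) :
    Real.sin ((nodeRow n k r : ℤ) * Real.pi / n) = Real.sin (r * Real.pi / n) := by
  have hn0 : (n : ℝ) ≠ 0 := by positivity
  unfold nodeRow
  split_ifs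
  · simp
  · rw [← Real.sin_pi_sub]
    congr 1; push_cast; field_simp; ring

/-- The side length supplies the factor in `m` of the weight and the direction of the side the
factor in `n`. This identity and the next one are why the rectangles of `X` fit into the polygons.
-/
theorem gridWeight_rowNode (hn2 : 2 ≤ n) (r : ℕ) :
    gridWeight m n (rowNode n k r) = rowHeight n (sideLen m k) r := by
  simp only [gridWeight, rowNode, rowHeight, sideLen, sin_nodeRow hn2]
  simp

theorem gridWeight_colNode (hn2 : 2 ≤ n) (c : ℕ) :
    gridWeight m n (colNode n k c) = colWidth n (sideLen m k) c := by
  simp only [gridWeight, colNode, colWidth, sideLen, sin_nodeRow hn2]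
  simp

theorem isGridNode_rowNode {r : ℕ} :
    IsGridNode m n (rowNode n k r) ↔ (0 < nodeCol k r ∧ nodeCol k r < m) ∧ 0 < r ∧ r < n := by
  unfold IsGridNode rowNode nodeRow
  split_ifs <;> simp only <;> omega

theorem isGridNode_colNode {c : ℕ} :
    IsGridNode m n (colNode n k c) ↔
      (0 < nodeCol k (c + 1) ∧ nodeCol k (c + 1) < m) ∧ 0 < c ∧ c < n := by
  unfold IsGridNode colNode nodeRow
  split_ifs <;> simp only <;> omega

theorem rowNode_injective {r r' : ℕ} (h : rowNode n k r = rowNode n k r') : r = r' := by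
  have := congrArg Prod.snd h
  simp only [rowNode, nodeRow] at this
  split_ifs at this <;> omega

theorem colNode_injective {c c' : ℕ} (h : colNode n k c = colNode n k c') : c = c' := by
  have := congrArg Prod.snd h
  simp only [colNode, nodeRow] at this
  split_ifs at this <;> omega

theorem even_rowNode (hn : Even n) (r : ℕ) : Even ((rowNode n k r).1 + (rowNode n k r).2) := by
  rw [Nat.even_iff] at hn
  rw [Int.even_iff]
  simp only [rowNode, nodeCol, nodeRow]
  split_ifs <;> push_cast <;> omega

theorem odd_colNode (hn : Even n) (c : ℕ) : Odd ((colNode n k c).1 + (colNode n k c).2) := by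
  rw [Nat.even_iff] at hn
  rw [Int.odd_iff]
  simp only [colNode, nodeCol, nodeRow]
  split_ifs <;> push_cast <;> omega

/-- The four unit vectors. -/
theorem unit_direction {d : ℤ × ℤ} (hd : d.1 ^ 2 + d.2 ^ 2 = 1) :
    d = (1, 0) ∨ d = (-1, 0) ∨ d = (0, 1) ∨ d = (0, -1) := by
  obtain ⟨x, y⟩ := d
  simp only at hd
  have hx : -1 ≤ x ∧ x ≤ 1 := ⟨by nlinarith [sq_nonneg y], by nlinarith [sq_nonneg y]⟩
  have hy : -1 ≤ y ∧ y ≤ 1 := ⟨by nlinarith [sq_nonneg x], by nlinarith [sq_nonneg x]⟩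
  obtain ⟨hx1, hx2⟩ := hx
  obtain ⟨hy1, hy2⟩ := hy
  interval_cases x <;> interval_cases y <;> simp_all

/-- For `c = r` the nodes have equal ordinate and abscissas `k`, `k + 1`. For `c = r ± 1` they have
equal abscissa and consecutive ordinates. So whole cells are horizontal edges and triangles are
vertical ones. -/
theorem dist_rowNode_colNode {r c : ℕ} (hb : InBand r c) :
    ((rowNode n k r).1 - (colNode n k c).1) ^ 2 + ((rowNode n k r).2 - (colNode n k c).2) ^ 2 =
      1 := by
  have h : ((rowNode n k r).1 - (colNode n k c).1 = 0 ∧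
      ((rowNode n k r).2 - (colNode n k c).2 = 1 ∨ (rowNode n k r).2 - (colNode n k c).2 = -1)) ∨
      ((rowNode n k r).2 - (colNode n k c).2 = 0 ∧
      ((rowNode n k r).1 - (colNode n k c).1 = 1 ∨ (rowNode n k r).1 - (colNode n k c).1 = -1)) :=
          by
    simp only [rowNode, colNode, nodeCol, nodeRow]
    rcases hb with rfl | rfl | rfl <;> split_ifs <;> push_cast <;> omega
  rcases h with ⟨h1, h2 | h2⟩ | ⟨h1, h2 | h2⟩ <;> rw [h1, h2] <;> norm_num

/-! ### Quarter turns around a node as steps between cells -/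

/-- Two consecutive edges around an even node run through two neighbouring cells of a row. -/
theorem exists_cells_around_even (hn : Even n) {a d : ℤ × ℤ} (ha : IsGridNode m n a)
    (hae : Even (a.1 + a.2)) (hd : d.1 ^ 2 + d.2 ^ 2 = 1) :
    ∃ k r c, k < m ∧ (1 ≤ r ∧ r < n) ∧ (c = r ∨ c + 1 = r) ∧ rowNode n k r = a ∧
      colNode n k c = a + d ∧ colNode n k (c + 1) = a + turn a.1 d := by
  obtain ⟨i, j⟩ := a
  obtain ⟨h1, h2, h3, h4⟩ := ha
  simp only at h1 h2 h3 h4 hae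
  lift i to ℕ using h1.le
  lift j to ℕ using h3.le
  rw [Int.even_iff] at hae
  rw [Nat.even_iff] at hn
  -- Exactly one of `d` and `turn i d` is horizontal. The polygon is the one on the side to which it
  -- points: `k = i` for the right side, `k = i - 1` for the left.
  obtain ⟨k, hk⟩ : ∃ k : ℕ, k = if d = (1, 0) ∨ (d.1 = 0 ∧ (d.2 = 1 ↔ i % 2 = 0)) then i else i - 1
      :=
    ⟨_, rfl⟩
  obtain ⟨r, hr⟩ : ∃ r : ℕ, r = if k % 2 = 1 then j else n - j := ⟨_, rfl⟩
  -- A vertical `d` that is followed by a horizontal direction comes from the left triangle of the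
  -- row; a horizontal `d` comes from the middle cell.
  obtain ⟨c, hc⟩ : ∃ c : ℕ, c = if d.1 = 0 then r - 1 else r := ⟨_, rfl⟩
  refine ⟨k, r, c, ?_⟩
  simp only [turn, Int.even_iff, rowNode, colNode, nodeCol, nodeRow]
  rcases unit_direction hd with rfl | rfl | rfl | rfl <;>
    rcases Nat.mod_two_eq_zero_or_one i with hi | hi <;>
    simp [hi] at hk hc <;>
    (have hi' : (i : ℤ) % 2 = i % 2 := rfl
     split_ifs at hr ⊢ <;> simp only [Prod.mk_add_mk, Prod.mk.injEq] <;> omega)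

/-- Two consecutive edges around an odd node run through two neighbouring cells of a column. -/
theorem exists_cells_around_odd (hn : Even n) {b d : ℤ × ℤ} (hb : IsGridNode m n b)
    (hbo : Odd (b.1 + b.2)) (hd : d.1 ^ 2 + d.2 ^ 2 = 1) :
    ∃ k r c, k < m ∧ (1 ≤ c ∧ c < n) ∧ (r = c ∨ r + 1 = c) ∧ colNode n k c = b ∧
      rowNode n k r = b + d ∧ rowNode n k (r + 1) = b + turn b.1 d := by
  obtain ⟨i, j⟩ := b
  obtain ⟨h1, h2, h3, h4⟩ := hb
  simp only at h1 h2 h3 h4 hbo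
  lift i to ℕ using h1.le
  lift j to ℕ using h3.le
  rw [Int.odd_iff] at hbo
  rw [Nat.even_iff] at hn
  obtain ⟨k, hk⟩ : ∃ k : ℕ, k = if d = (1, 0) ∨ (d.1 = 0 ∧ (d.2 = 1 ↔ i % 2 = 0)) then i else i - 1
      :=
    ⟨_, rfl⟩
  obtain ⟨c, hc⟩ : ∃ c : ℕ, c = if k % 2 = 1 then j else n - j := ⟨_, rfl⟩
  obtain ⟨r, hr⟩ : ∃ r : ℕ, r = if d.1 = 0 then c - 1 else c := ⟨_, rfl⟩
  refine ⟨k, r, c, ?_⟩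
  simp only [turn, Int.even_iff, rowNode, colNode, nodeCol, nodeRow]
  rcases unit_direction hd with rfl | rfl | rfl | rfl <;>
    rcases Nat.mod_two_eq_zero_or_one i with hi | hi <;>
    simp [hi] at hk hr <;>
    (have hi' : (i : ℤ) % 2 = i % 2 := rfl
     split_ifs at hc ⊢ <;> simp only [Prod.mk_add_mk, Prod.mk.injEq] <;> omega)

end

/-! ### Points of `X`, and the rectangles around a node -/

noncomputable section

theorem nextDir_of_turn {P : ℤ × ℤ → Prop} [DecidablePred P] {i : ℤ} {d : ℤ × ℤ}
    (h : P (turn i d)) : nextDir P i d = turn i d := if_pos h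

/-- Skipping an absent direction does not change which one comes next. If all four were absent, the
fallback values `d` and `turn i d` would differ, hence `hex`. -/
theorem nextDir_eq_nextDir_turn {P : ℤ × ℤ → Prop} [DecidablePred P] {i : ℤ} {d : ℤ × ℤ}
    (h : ¬ P (turn i d)) (hex : P d ∨ P (turn i d) ∨ P (turn i (turn i d)) ∨
      P (turn i (turn i (turn i d)))) : nextDir P i d = nextDir P i (turn i d) := by
  unfold nextDir
  rw [turn_four]
  split_ifs <;> tauto

/-- The assumptions on the size of the grid. -/
structure EvenGrid (m n : ℕ) : Prop where
  two_le_left : 2 ≤ m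
  two_le_right : 2 ≤ n
  six_le : 6 ≤ m * n
  even_left : Even m
  even_right : Even n

variable {m n : ℕ}

/-- This is where `6 ≤ m * n` enters: the only excluded even grid is `m = n = 2`, a single node
without edges. -/
theorem exists_neighbor (hp : EvenGrid m n)
    {v : ℤ × ℤ} (hv : IsGridNode m n v) (i : ℤ) {d : ℤ × ℤ} (hd : d.1 ^ 2 + d.2 ^ 2 = 1) :
    IsGridNode m n (v + d) ∨ IsGridNode m n (v + turn i d) ∨
      IsGridNode m n (v + turn i (turn i d)) ∨
      IsGridNode m n (v + turn i (turn i (turn i d))) := by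
  obtain ⟨hm2, hn2, hmn, hm, hn⟩ := hp
  rw [Nat.even_iff] at hm hn
  have h4 : 4 ≤ m ∨ 4 ≤ n := by
    by_contra h
    have h1 : m = 2 := by omega
    have h2 : n = 2 := by omega
    subst h1 h2
    omega
  obtain ⟨x, y⟩ := v
  unfold IsGridNode at *
  simp only at hv
  rcases unit_direction hd with rfl | rfl | rfl | rfl <;> by_cases hi : Even i <;>
    simp only [turn, hi, if_true, if_false, Prod.mk_add_mk, neg_zero, neg_neg] <;> omega

theorem isGridNode_add_turn_norm {i : ℤ} {d : ℤ × ℤ} (hd : d.1 ^ 2 + d.2 ^ 2 = 1) :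
    (turn i d).1 ^ 2 + (turn i d).2 ^ 2 = 1 := by
  by_cases h : Even i <;> simp [turn, h] <;> linarith

/-- The edge between an even and an odd node at distance one. -/
@[simps]
def GridEdge.ofNodes {a b : ℤ × ℤ} (ha : IsGridNode m n a) (hb : IsGridNode m n b)
    (hae : Even (a.1 + a.2)) (hbo : Odd (b.1 + b.2))
    (hd : (a.1 - b.1) ^ 2 + (a.2 - b.2) ^ 2 = 1) : GridEdge m n :=
  ⟨a, b, ha, hb, hae, hbo, hd⟩

open Classical in
/-- The point with coordinates `(u, v)` in the rectangle of the edge from `a` to `b`. -/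
def rectPt (m n : ℕ) [Nonempty (surfaceX m n).Point] (a b : ℤ × ℤ) (u v : ℝ) :
    (surfaceX m n).Point :=
  if h : ∃ x : Σ e : GridEdge m n, gridRect e, x.1.a = a ∧ x.1.b = b ∧ (x.2 : Plane) = ![u, v] then
    (surfaceX m n).param h.choose else Classical.arbitrary _

theorem GridEdge.east_b (e : GridEdge m n) : e.east.b =
    e.a + nextDir (fun d => IsGridNode m n (e.a + d)) e.a.1 (e.b - e.a) := by
  simp only [GridEdge.east, Equiv.coe_fn_mk, GridEdge.rotA, add_zero]

theorem GridEdge.north_a (e : GridEdge m n) : e.north.a =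
    e.b + nextDir (fun d => IsGridNode m n (e.b + d)) e.b.1 (e.a - e.b) := by
  simp only [GridEdge.north, Equiv.coe_fn_mk, GridEdge.rotB, add_zero]

variable [Nonempty (surfaceX m n).Point]

theorem rectPt_eq (e : GridEdge m n) {u v : ℝ} (h : ![u, v] ∈ gridRect e) :
    rectPt m n e.a e.b u v = (surfaceX m n).param ⟨e, _, h⟩ := by
  have hex : ∃ x : Σ e : GridEdge m n, gridRect e,
      x.1.a = e.a ∧ x.1.b = e.b ∧ (x.2 : Plane) = ![u, v] := ⟨⟨e, _, h⟩, rfl, rfl, rfl⟩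
  rw [rectPt, dif_pos hex]
  obtain ⟨h1, h2, h3⟩ := hex.choose_spec
  exact surfaceX_param_congr (GridEdge.ext h1 h2) hex.choose.2.2 h h3

theorem rectPt_east (e : GridEdge m n) {v : ℝ} (h0 : 0 ≤ v) (h1 : v ≤ gridWeight m n e.a) :
    rectPt m n e.a e.b (gridWeight m n e.b) v = rectPt m n e.a e.east.b 0 v := by
  have h2 : ![gridWeight m n e.b, v] ∈ gridRect e :=
    mem_gridRect.2 ⟨⟨(gridWeight_pos e.b_node).le, le_rfl⟩, h0, h1⟩
  have h3 : ![0, v] ∈ gridRect e.east :=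
    mem_gridRect.2 ⟨⟨le_rfl, (gridWeight_pos e.east.b_node).le⟩, h0, h1⟩
  rw [rectPt_eq e h2]
  exact (Quot.sound (RectGlue.right_left e ⟨_, h2⟩ ⟨_, h3⟩ rfl rfl rfl)).trans
    (rectPt_eq e.east h3).symm

theorem rectPt_north (e : GridEdge m n) {u : ℝ} (h0 : 0 ≤ u) (h1 : u ≤ gridWeight m n e.b) :
    rectPt m n e.a e.b u (gridWeight m n e.a) = rectPt m n e.north.a e.b u 0 := by
  have h2 : ![u, gridWeight m n e.a] ∈ gridRect e :=
    mem_gridRect.2 ⟨⟨h0, h1⟩, (gridWeight_pos e.a_node).le, le_rfl⟩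
  have h3 : ![u, 0] ∈ gridRect e.north :=
    mem_gridRect.2 ⟨⟨h0, h1⟩, le_rfl, (gridWeight_pos e.north.a_node).le⟩
  rw [rectPt_eq e h2]
  exact (Quot.sound (RectGlue.top_bottom e ⟨_, h2⟩ ⟨_, h3⟩ rfl rfl rfl)).trans
    (rectPt_eq e.north h3).symm

/-- The point with coordinates `(u, v)` in the rectangle that points from the even node `a` in the
direction `d`; if `a + d` is not a node, the rectangle degenerates to the left side of the next
one. -/
def evenPt (m n : ℕ) [Nonempty (surfaceX m n).Point] (a d : ℤ × ℤ) (u v : ℝ) :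
    (surfaceX m n).Point :=
  if IsGridNode m n (a + d) then rectPt m n a (a + d) u v
  else rectPt m n a (a + nextDir (fun d => IsGridNode m n (a + d)) a.1 d) 0 v

/-- The point with coordinates `(u, v)` in the rectangle that points from the odd node `b` in the
direction `d`; if `b + d` is not a node, the rectangle degenerates to the lower side of the next
one. -/
def oddPt (m n : ℕ) [Nonempty (surfaceX m n).Point] (b d : ℤ × ℤ) (u v : ℝ) :
    (surfaceX m n).Point :=
  if IsGridNode m n (b + d) then rectPt m n (b + d) b u v
  else rectPt m n (b + nextDir (fun d => IsGridNode m n (b + d)) b.1 d) b u 0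

/-- The gluing by `east`, written as single quarter turns: an absent neighbour contributes a
rectangle of width zero, so consecutive quarter turns compose to `nextDir`. -/
theorem evenPt_turn {a d : ℤ × ℤ} (ha : IsGridNode m n a) (hae : Even (a.1 + a.2))
    (hd : d.1 ^ 2 + d.2 ^ 2 = 1)
    (hex : IsGridNode m n (a + d) ∨ IsGridNode m n (a + turn a.1 d) ∨
      IsGridNode m n (a + turn a.1 (turn a.1 d)) ∨
      IsGridNode m n (a + turn a.1 (turn a.1 (turn a.1 d)))) {v : ℝ} (h0 : 0 ≤ v)
    (h1 : v ≤ gridWeight m n a) :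
    evenPt m n a d (gridWeight m n (a + d)) v = evenPt m n a (turn a.1 d) 0 v := by
  have key : evenPt m n a d (gridWeight m n (a + d)) v =
      rectPt m n a (a + nextDir (fun d => IsGridNode m n (a + d)) a.1 d) 0 v := by
    by_cases h : IsGridNode m n (a + d)
    · have hbo : Odd ((a + d).1 + (a + d).2) := by
        have := hae.add_odd (odd_add_of_sq_add_sq hd)
        rwa [Prod.fst_add, Prod.snd_add, add_add_add_comm]
      let e := GridEdge.ofNodes ha h hae hbo
        (by rw [← hd, Prod.fst_add, Prod.snd_add]; ring)
      have := rectPt_east e h0 h1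
      rw [GridEdge.east_b] at this
      simp only [e, GridEdge.ofNodes_a, GridEdge.ofNodes_b, add_sub_cancel_left] at this
      rw [evenPt, if_pos h, this]
    · rw [evenPt, if_neg h]
  rw [key]
  by_cases h : IsGridNode m n (a + turn a.1 d)
  · rw [evenPt, if_pos h, nextDir_of_turn (P := fun d => IsGridNode m n (a + d)) h]
  · rw [evenPt, if_neg h,
      nextDir_eq_nextDir_turn (P := fun d => IsGridNode m n (a + d)) h hex]

theorem oddPt_turn {b d : ℤ × ℤ} (hb : IsGridNode m n b) (hbo : Odd (b.1 + b.2))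
    (hd : d.1 ^ 2 + d.2 ^ 2 = 1)
    (hex : IsGridNode m n (b + d) ∨ IsGridNode m n (b + turn b.1 d) ∨
      IsGridNode m n (b + turn b.1 (turn b.1 d)) ∨
      IsGridNode m n (b + turn b.1 (turn b.1 (turn b.1 d)))) {u : ℝ} (h0 : 0 ≤ u)
    (h1 : u ≤ gridWeight m n b) :
    oddPt m n b d u (gridWeight m n (b + d)) = oddPt m n b (turn b.1 d) u 0 := by
  have key : oddPt m n b d u (gridWeight m n (b + d)) =
      rectPt m n (b + nextDir (fun d => IsGridNode m n (b + d)) b.1 d) b u 0 := by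
    by_cases h : IsGridNode m n (b + d)
    · have hae : Even ((b + d).1 + (b + d).2) := by
        have := hbo.add_odd (odd_add_of_sq_add_sq hd)
        rwa [Prod.fst_add, Prod.snd_add, add_add_add_comm]
      let e := GridEdge.ofNodes h hb hae hbo
        (by rw [← hd, Prod.fst_add, Prod.snd_add]; ring)
      have := rectPt_north e h0 h1
      rw [GridEdge.north_a] at this
      simp only [e, GridEdge.ofNodes_a, GridEdge.ofNodes_b, add_sub_cancel_left] at this
      rw [oddPt, if_pos h, this]
    · rw [oddPt, if_neg h]
  rw [key]
  by_cases h : IsGridNode m n (b + turn b.1 d)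
  · rw [oddPt, if_pos h, nextDir_of_turn (P := fun d => IsGridNode m n (b + d)) h]
  · rw [oddPt, if_neg h,
      nextDir_eq_nextDir_turn (P := fun d => IsGridNode m n (b + d)) h hex]

end

/-! ### Points of `X` in the cells of a polygon -/

noncomputable section

variable {m n k : ℕ}

/-- The reversed numbering of the rows for even `k` in `nodeRow` matches the alternating sense of
rotation, so that a step to the right is always a turn in the prescribed sense. -/
theorem turn_row_direction {r c : ℕ} (h : c = r ∨ c + 1 = r) :
    turn (rowNode n k r).1 (colNode n k c - rowNode n k r) =
      colNode n k (c + 1) - rowNode n k r := by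
  simp only [turn, rowNode, colNode, nodeCol, nodeRow, Int.even_iff]
  rcases h with rfl | rfl <;> split_ifs <;>
    simp only [Prod.mk_sub_mk, Prod.mk.injEq] <;> push_cast at * <;> omega

theorem turn_col_direction {r c : ℕ} (h : r = c ∨ r + 1 = c) :
    turn (colNode n k c).1 (rowNode n k r - colNode n k c) =
      rowNode n k (r + 1) - colNode n k c := by
  simp only [turn, rowNode, colNode, nodeCol, nodeRow, Int.even_iff]
  rcases h with rfl | rfl <;> split_ifs <;>
    simp only [Prod.mk_sub_mk, Prod.mk.injEq] <;> push_cast at * <;> omega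

theorem norm_row_direction {r c : ℕ} (h : InBand r c) :
    (colNode n k c - rowNode n k r).1 ^ 2 + (colNode n k c - rowNode n k r).2 ^ 2 = 1 := by
  rw [← dist_rowNode_colNode (n := n) (k := k) h, Prod.fst_sub, Prod.snd_sub]; ring

theorem norm_col_direction {r c : ℕ} (h : InBand r c) :
    (rowNode n k r - colNode n k c).1 ^ 2 + (rowNode n k r - colNode n k c).2 ^ 2 = 1 := by
  rw [← dist_rowNode_colNode (n := n) (k := k) h, Prod.fst_sub, Prod.snd_sub]

/-- The nodes of the rows and columns of two glued polygons, turned upside down with respect to each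
other. -/
theorem opposite_nodes (hn : Even n) {k' r : ℕ} (hk : Odd k)
    (h : Even r ∧ k' = k + 1 ∨ Odd r ∧ k' + 1 = k) (hr : r < n) :
    (rowNode n k r = rowNode n k' (n - r) ∧ colNode n k (r + 1) = colNode n k' (n - (r + 1))) ∧
    (rowNode n k' r = rowNode n k (n - r) ∧ colNode n k' (r + 1) = colNode n k (n - (r + 1))) := by
  rw [Nat.even_iff] at hn
  rw [Nat.odd_iff] at hk
  rw [Nat.even_iff, Nat.odd_iff] at h
  simp only [rowNode, colNode, nodeCol, nodeRow]
  split_ifs <;> simp only [Prod.mk.injEq] <;> omega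

/-- The two glued sides share the abscissa `max k k'`, which is strictly between `0` and `m`. Hence
degenerate sides are never glued. -/
theorem opposite_sideLen_pos {k' r : ℕ} (hk : Odd k) (hkm : k < m) (hk'm : k' < m)
    (h : Even r ∧ k' = k + 1 ∨ Odd r ∧ k' + 1 = k) : 0 < sideLen m k r ∧ 0 < sideLen m k' r := by
  rw [Nat.odd_iff] at hk
  rw [Nat.even_iff, Nat.odd_iff] at h
  constructor <;> apply sideLen_pos <;> unfold nodeCol <;> omega

theorem isGridNode_rowNode_of_pos {r : ℕ} (hk : k < m) (h1 : 1 ≤ r) (h2 : r < n)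
    (h : 0 < sideLen m k r) : IsGridNode m n (rowNode n k r) :=
  isGridNode_rowNode.2 ⟨nodeCol_pos_of_sideLen_pos hk h, h1, h2⟩

theorem isGridNode_colNode_of_pos {c : ℕ} (hk : k < m) (h1 : 1 ≤ c) (h2 : c < n)
    (h : 0 < sideLen m k (c + 1)) : IsGridNode m n (colNode n k c) :=
  isGridNode_colNode.2 ⟨nodeCol_pos_of_sideLen_pos hk h, h1, h2⟩

/-- These are the ends of the chord at the upper side of row `r`. Of the lower right triangle in
column `r - 1` only the right upper corner reaches this height. -/
theorem colPos_bounds_of_top (hn2 : 2 ≤ n) (hk : k < m) {r c : ℕ} (h1 : 1 ≤ r) (h2 : r < n)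
    (hs : 0 < sideLen m k r)
    (hb : InBand r c) {x y : ℝ} (h : InCell n (sideLen m k) r c x y)
    (hy : y = rowPos n (sideLen m k) (r + 1)) :
    colPos n (sideLen m k) r ≤ x ∧ x ≤ colPos n (sideLen m k) (r + 2) := by
  have h0 := sideLen_nonneg hk
  have hpos : 0 < rowHeight n (sideLen m k) r := by
    rw [← gridWeight_rowNode hn2]
    exact gridWeight_pos (isGridNode_rowNode_of_pos hk h1 h2 hs)
  obtain ⟨⟨hx, hx'⟩, -, hup, hlow⟩ := h
  rcases hb with rfl | rfl | rfl
  · exact ⟨hx, hx'.trans (colPos_mono h0 (by omega) (by omega))⟩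
  · exact ⟨(colPos_mono h0 (by omega) (by omega)).trans hx, hx'⟩
  · refine ⟨?_, hx'.trans (colPos_mono h0 (by omega) (by omega))⟩
    have := hlow rfl
    rw [hy, rowPos_succ (c + 1), add_sub_cancel_left, mul_comm] at this
    have := le_of_mul_le_mul_right this hpos
    rw [colPos_succ]
    linarith

theorem colPos_bounds_of_bottom (hn2 : 2 ≤ n) (hk : k < m) {r c : ℕ} (h2 : r + 1 < n)
    (hs : 0 < sideLen m k (r + 1))
    (hb : InBand (r + 1) c) {x y : ℝ} (h : InCell n (sideLen m k) (r + 1) c x y)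
    (hy : y = rowPos n (sideLen m k) (r + 1)) :
    colPos n (sideLen m k) r ≤ x ∧ x ≤ colPos n (sideLen m k) (r + 2) := by
  have h0 := sideLen_nonneg hk
  have hpos : 0 < rowHeight n (sideLen m k) (r + 1) := by
    rw [← gridWeight_rowNode hn2]
    exact gridWeight_pos (isGridNode_rowNode_of_pos hk (by omega) h2 hs)
  obtain ⟨⟨hx, hx'⟩, -, hup, hlow⟩ := h
  rcases hb with rfl | rfl | hb
  · exact ⟨(colPos_mono h0 (by omega) (by omega)).trans hx, hx'⟩
  · refine ⟨(colPos_mono h0 (by omega) (by omega)).trans hx, ?_⟩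
    have := hup rfl
    rw [hy, sub_self, zero_mul] at this
    linarith [nonpos_of_mul_nonpos_left this hpos]
  · obtain rfl : c = r := by omega
    exact ⟨hx, hx'.trans (colPos_mono h0 (by omega) (by omega))⟩

variable [Nonempty (surfaceX m n).Point]

/-- The point of `X` that belongs to the point with sheared coordinates `(x, y)` of the cell
`(r, c)` of `P(k)`, in terms of the even node. -/
def cellPt (m n : ℕ) [Nonempty (surfaceX m n).Point] (k r c : ℕ) (x y : ℝ) :
    (surfaceX m n).Point :=
  evenPt m n (rowNode n k r) (colNode n k c - rowNode n k r) (x - colPos n (sideLen m k) c)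
    (y - rowPos n (sideLen m k) r)

/-- The point of `X` that belongs to the point with sheared coordinates `(x, y)` of the cell
`(r, c)` of `P(k)`, in terms of the odd node. -/
def colCellPt (m n : ℕ) [Nonempty (surfaceX m n).Point] (k r c : ℕ) (x y : ℝ) :
    (surfaceX m n).Point :=
  oddPt m n (colNode n k c) (rowNode n k r - colNode n k c) (x - colPos n (sideLen m k) c)
    (y - rowPos n (sideLen m k) r)

/-- The passage between the two descriptions, which makes steps within a row and steps within a
column composable. -/
theorem cellPt_eq_colCellPt {r c : ℕ} (hr : IsGridNode m n (rowNode n k r))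
    (hc : IsGridNode m n (colNode n k c)) (x y : ℝ) : cellPt m n k r c x y =
      colCellPt m n k r c x y := by
  rw [cellPt, colCellPt, evenPt, oddPt, if_pos (by rwa [add_sub_cancel]),
    if_pos (by rwa [add_sub_cancel]), add_sub_cancel, add_sub_cancel]

theorem cellPt_succ (hp : EvenGrid m n) (hk : k < m) {r c : ℕ} (h1 : 1 ≤ r) (h2 : r < n)
    (hs : 0 < sideLen m k r)
    (hrc : c = r ∨ c + 1 = r) {y : ℝ} (hy : rowPos n (sideLen m k) r ≤ y)
    (hy' : y ≤ rowPos n (sideLen m k) (r + 1)) :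
    cellPt m n k r c (colPos n (sideLen m k) (c + 1)) y =
      cellPt m n k r (c + 1) (colPos n (sideLen m k) (c + 1)) y := by
  have ha := isGridNode_rowNode_of_pos hk h1 h2 hs
  have hd := norm_row_direction (n := n) (k := k) (r := r) (c := c) (by unfold InBand; omega)
  rw [rowPos_succ] at hy'
  have := evenPt_turn ha (even_rowNode hp.even_right r) hd (exists_neighbor hp ha _ hd)
    (v := y - rowPos n (sideLen m k) r) (by linarith)
      (by rw [gridWeight_rowNode hp.two_le_right]; linarith)
  rw [add_sub_cancel, gridWeight_colNode hp.two_le_right, turn_row_direction hrc] at this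
  rw [cellPt, cellPt, sub_self, ← this, colPos_succ, add_sub_cancel_left]

theorem colCellPt_succ (hp : EvenGrid m n) (hk : k < m) {r c : ℕ} (h1 : 1 ≤ c) (h2 : c < n)
    (hs : 0 < sideLen m k (c + 1))
    (hrc : r = c ∨ r + 1 = c) {x : ℝ} (hx : colPos n (sideLen m k) c ≤ x)
    (hx' : x ≤ colPos n (sideLen m k) (c + 1)) :
    colCellPt m n k r c x (rowPos n (sideLen m k) (r + 1)) =
      colCellPt m n k (r + 1) c x (rowPos n (sideLen m k) (r + 1)) := by
  have hb := isGridNode_colNode_of_pos hk h1 h2 hs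
  have hd := norm_col_direction (n := n) (k := k) (r := r) (c := c) (by unfold InBand; omega)
  rw [colPos_succ] at hx'
  have := oddPt_turn hb (odd_colNode hp.even_right c) hd (exists_neighbor hp hb _ hd)
    (u := x - colPos n (sideLen m k) c) (by linarith)
      (by rw [gridWeight_colNode hp.two_le_right]; linarith)
  rw [add_sub_cancel, gridWeight_rowNode hp.two_le_right, turn_col_direction hrc] at this
  rw [colCellPt, colCellPt, sub_self, ← this, rowPos_succ, add_sub_cancel_left]

theorem cellPt_same_row (hp : EvenGrid m n) (hk : k < m) {r c c' : ℕ} (h1 : 1 ≤ r) (h2 : r < n)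
    (hs : 0 < sideLen m k r)
    (hb : InBand r c) (hb' : InBand r c') {x y : ℝ} (hy : rowPos n (sideLen m k) r ≤ y)
    (hy' : y ≤ rowPos n (sideLen m k) (r + 1)) (hx : colPos n (sideLen m k) c ≤ x)
    (hx' : x ≤ colPos n (sideLen m k) (c + 1)) (hz : colPos n (sideLen m k) c' ≤ x)
    (hz' : x ≤ colPos n (sideLen m k) (c' + 1)) :
    cellPt m n k r c x y = cellPt m n k r c' x y := by
  wlog hcc : c ≤ c' generalizing c c'
  · exact (this hb' hb hz hz' hx hx' (le_of_not_ge hcc)).symm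
  have h0 := sideLen_nonneg hk
  unfold InBand at hb hb'
  obtain rfl | rfl | rfl : c' = c ∨ c' = c + 1 ∨ c' = c + 2 := by omega
  · rfl
  · obtain rfl := le_antisymm hx' hz
    exact cellPt_succ hp hk h1 h2 hs (by omega) hy hy'
  -- The outer columns of a row can share a point only if the middle one has width zero; then both
  -- steps are taken at the same `x`.
  · have hmono := colPos_mono (n := n) h0 (Nat.le_succ (c + 1)) (by omega)
    have hx1 : x = colPos n (sideLen m k) (c + 1) := le_antisymm hx' (hmono.trans hz)
    have hx2 : x = colPos n (sideLen m k) (c + 1 + 1) := le_antisymm (hx'.trans hmono) hz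
    have e1 := cellPt_succ hp hk h1 h2 hs (c := c) (by omega) hy hy'
    have e2 := cellPt_succ hp hk h1 h2 hs (c := c + 1) (by omega) hy hy'
    rw [← hx1] at e1
    rw [← hx2] at e2
    exact e1.trans e2

/-- Any two cells of `P(k)` in nondegenerate rows define the same point of `X`. -/
theorem cellPt_unique (hp : EvenGrid m n) (hk : k < m) {r c r' c' : ℕ} (h1 : 1 ≤ r) (h2 : r < n)
    (hs : 0 < sideLen m k r)
    (h1' : 1 ≤ r') (h2' : r' < n) (hs' : 0 < sideLen m k r') (hb : InBand r c)
    (hb' : InBand r' c') {x y : ℝ} (h : InCell n (sideLen m k) r c x y)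
    (h' : InCell n (sideLen m k) r' c' x y) : cellPt m n k r c x y = cellPt m n k r' c' x y := by
  wlog hrr : r ≤ r' generalizing r c r' c'
  · exact (this h1' h2' hs' h1 h2 hs hb' hb h' h (le_of_not_ge hrr)).symm
  have h0 := sideLen_nonneg hk
  obtain ⟨⟨hx, hx'⟩, ⟨hy, hy'⟩, -⟩ := id h
  obtain ⟨⟨hz, hz'⟩, ⟨hw, hw'⟩, -⟩ := id h'
  rcases hrr.eq_or_lt with rfl | hlt
  · exact cellPt_same_row hp hk h1 h2 hs hb hb' hy hy' hx hx' hz hz'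
  have hmono := rowPos_mono (n := n) h0 (a := r + 1) (b := r') hlt (by omega)
  have hytop : y = rowPos n (sideLen m k) (r + 1) := le_antisymm hy' (hmono.trans hw)
  have hybot : y = rowPos n (sideLen m k) r' := le_antisymm (hy'.trans hmono) hw
  have hrow := isGridNode_rowNode_of_pos hk h1 h2 hs
  have hrow' := isGridNode_rowNode_of_pos hk h1' h2' hs'
  obtain ⟨htop, htop'⟩ := colPos_bounds_of_top hp.two_le_right hk h1 h2 hs hb h hytop
  obtain ⟨q, rfl⟩ : ∃ q, r' = q + 1 := ⟨r' - 1, by omega⟩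
  obtain ⟨hbot, hbot'⟩ := colPos_bounds_of_bottom hp.two_le_right hk h2' hs' hb' h' hybot
  obtain rfl | rfl | h3 : q = r ∨ q = r + 1 ∨ r + 2 ≤ q := by omega
  -- Adjacent rows: the chord between them is covered by the columns `r` and `r + 1`, both with
  -- genuine nodes. Move to such a column in each row and then step up in it.
  · obtain ⟨c₀, hc₀, hxc, hxc'⟩ : ∃ c₀, (c₀ = q ∨ c₀ = q + 1) ∧
        colPos n (sideLen m k) c₀ ≤ x ∧ x ≤ colPos n (sideLen m k) (c₀ + 1) := by
      rcases le_total x (colPos n (sideLen m k) (q + 1)) with h4 | h4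
      · exact ⟨q, Or.inl rfl, htop, h4⟩
      · exact ⟨q + 1, Or.inr rfl, h4, htop'⟩
    have hsc : 0 < sideLen m k (c₀ + 1) := by
      rcases hc₀ with rfl | rfl
      · exact hs'
      · rwa [sideLen_add_two]
    have hcol := isGridNode_colNode_of_pos (n := n) hk (c := c₀) (by omega) (by omega) hsc
    rw [cellPt_same_row hp hk h1 h2 hs hb (c' := c₀) (by unfold InBand; omega)
        hy hy' hx hx' hxc hxc',
      cellPt_same_row hp hk h1' h2' hs' hb' (c' := c₀) (by unfold InBand; omega)
        hw hw' hz hz' hxc hxc',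
      cellPt_eq_colCellPt hrow hcol, cellPt_eq_colCellPt hrow' hcol, hytop]
    exact colCellPt_succ hp hk (r := q) (by omega) (by omega) hsc (by omega) hxc hxc'
  -- Rows `r` and `r + 2` meet only across a flat row `r + 1`. The common points lie in column `r +
  -- 1`, where two upward steps connect them.
  · have hsc : 0 < sideLen m k (r + 1 + 1) := by rwa [sideLen_add_two]
    have hcol := isGridNode_colNode_of_pos (n := n) hk (c := r + 1) (by omega) (by omega) hsc
    rw [cellPt_same_row hp hk h1 h2 hs hb (c' := r + 1) (by unfold InBand; omega)
        hy hy' hx hx' hbot htop',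
      cellPt_same_row hp hk h1' h2' hs' hb' (c' := r + 1) (by unfold InBand; omega)
        hw hw' hz hz' hbot htop',
      cellPt_eq_colCellPt hrow hcol, cellPt_eq_colCellPt hrow' hcol]
    have e1 := colCellPt_succ hp hk (r := r) (c := r + 1) (by omega) (by omega) hsc
      (by omega) hbot htop'
    have e2 := colCellPt_succ hp hk (r := r + 1) (c := r + 1) (by omega) (by omega)
      hsc (by omega) hbot htop'
    rw [← hytop] at e1
    rw [← hybot] at e2
    exact e1.trans e2
  -- Rows further apart are separated by row `r + 2`, which has positive height because `r + 2` has
  -- the parity of `r`.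
  · exfalso
    have h4 := rowPos_mono (n := n) h0 (a := r + 1) (b := r + 2) (by omega) (by omega)
    have h5 := rowPos_mono (n := n) h0 (a := r + 3) (b := q + 1) (by omega) (by omega)
    have h6 := rowPos_succ (n := n) (s := sideLen m k) (r + 2)
    have h7 : 0 < rowHeight n (sideLen m k) (r + 2) := by
      rw [← gridWeight_rowNode hp.two_le_right]
      exact gridWeight_pos (isGridNode_rowNode_of_pos hk (by omega) (by omega)
        (by rwa [sideLen_add_two]))
    linarith

end

/-! ### The map from `Y` to `X` -/

noncomputable section

/-- The inverse of the derivative of `μ`. -/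
def derivMuInv (n : ℕ) : Matrix (Fin 2) (Fin 2) ℝ :=
  !![Real.sin (Real.pi / n), Real.cos (Real.pi / n); 0, 1]

theorem derivMuInv_mulVec (n : ℕ) (p : Plane) : (derivMuInv n).mulVec p = ![unshear n p, p 1] := by
  ext i; fin_cases i <;> simp [derivMuInv, unshear, Matrix.mulVec, dotProduct]

theorem continuous_unshear (n : ℕ) : Continuous (unshear n) :=
  (continuous_const.mul (continuous_apply 0)).add (continuous_const.mul (continuous_apply 1))

theorem isClosed_inCell (n : ℕ) (s : ℕ → ℝ) (r c : ℕ) {X Y : Plane → ℝ} (hX : Continuous X)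
    (hY : Continuous Y) : IsClosed {p | InCell n s r c (X p) (Y p)} := by
  unfold InCell
  simp only [Set.ofPred_and]
  refine .inter (.inter (isClosed_le ?_ ?_) (isClosed_le ?_ ?_))
    (.inter (.inter (isClosed_le ?_ ?_) (isClosed_le ?_ ?_)) (.inter ?_ ?_)) <;> try fun_prop
  · by_cases h : c = r + 1
    · simp only [h, true_imp_iff]
      exact isClosed_le (by fun_prop) (by fun_prop)
    · simp [h]
  · by_cases h : c + 1 = r
    · simp only [h, true_imp_iff]
      exact isClosed_le (by fun_prop) (by fun_prop)
    · simp [h]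

theorem nextDir_mem {P : ℤ × ℤ → Prop} [DecidablePred P] {i : ℤ} {d : ℤ × ℤ}
    (hex : P d ∨ P (turn i d) ∨ P (turn i (turn i d)) ∨ P (turn i (turn i (turn i d)))) :
    P (nextDir P i d) := by
  unfold nextDir
  split_ifs <;> tauto

variable {m n k : ℕ}

theorem sideLen_eq_zero {r : ℕ} (hk : k < m) (h : ¬ (0 < nodeCol k r ∧ nodeCol k r < m)) :
    sideLen m k r = 0 := by
  by_contra hne
  exact h (nodeCol_pos_of_sideLen_pos hk (lt_of_le_of_ne (sideLen_nonneg hk r) (Ne.symm hne)))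

theorem colWidth_eq_zero (hn2 : 2 ≤ n) {c : ℕ} (hk : k < m) (hc : c ≤ n)
    (h : ¬ IsGridNode m n (colNode n k c)) : colWidth n (sideLen m k) c = 0 := by
  rw [isGridNode_colNode, not_and_or] at h
  rcases h with h | h
  · rw [colWidth, sideLen_eq_zero hk h, zero_mul]
  · obtain rfl | rfl : c = 0 ∨ c = n := by omega
    · exact colWidth_zero
    · exact colWidth_self hn2

theorem even_add_of_odd_sub {a d : ℤ × ℤ} (hae : Even (a.1 + a.2)) (hd : d.1 ^ 2 + d.2 ^ 2 = 1) :
    Odd ((a + d).1 + (a + d).2) := by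
  have := hae.add_odd (odd_add_of_sq_add_sq hd)
  rwa [Prod.fst_add, Prod.snd_add, add_add_add_comm]

theorem exists_inCell_polyP (hp : EvenGrid m n) (hk : k < m) {p : Plane} (h : p ∈ polyP m n k) :
    ∃ r c, 1 ≤ r ∧ r < n ∧ 0 < sideLen m k r ∧ InBand r c ∧
      InCell n (sideLen m k) r c (unshear n p) (p 1) := by
  rw [polyP_eq hp.even_right] at h
  exact exists_inCell hp.two_le_right sideLen_add_two (sideLen_nonneg hk)
    (sideLen_one_pos hp.even_left hk) h

variable [Nonempty (surfaceX m n).Point]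

/-- On each cell of a nondegenerate row, `cellPt` is a translation into some rectangle. -/
theorem exists_cellPt_eq_param (hp : EvenGrid m n) (hk : k < m) {r c : ℕ} (h1 : 1 ≤ r) (h2 : r < n)
    (hs : 0 < sideLen m k r) (hb : InBand r c) : ∃ (e : GridEdge m n) (c₀ : Plane), ∀ x y,
      InCell n (sideLen m k) r c x y → ∃ h : ![x, y] + c₀ ∈ gridRect e,
        cellPt m n k r c x y = (surfaceX m n).param ⟨e, _, h⟩ := by
  have ha := isGridNode_rowNode_of_pos hk h1 h2 hs
  have hae := even_rowNode (k := k) hp.even_right r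
  have hd := norm_row_direction (n := n) (k := k) hb
  have hcn : c ≤ n := by unfold InBand at hb; omega
  have key : ∃ e : GridEdge m n, e.a = rowNode n k r ∧ ∀ u v, 0 ≤ u →
      u ≤ colWidth n (sideLen m k) c → 0 ≤ v → v ≤ rowHeight n (sideLen m k) r →
      ∃ h : ![u, v] ∈ gridRect e, evenPt m n (rowNode n k r) (colNode n k c - rowNode n k r) u v =
        (surfaceX m n).param ⟨e, _, h⟩ := by
    by_cases hc : IsGridNode m n (colNode n k c)
    · refine ⟨GridEdge.ofNodes ha hc hae (odd_colNode hp.even_right c) (dist_rowNode_colNode hb),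
        rfl, fun u v hu hu' hv hv' => ?_⟩
      rw [← gridWeight_rowNode hp.two_le_right] at hv'
      rw [← gridWeight_colNode hp.two_le_right] at hu'
      refine ⟨mem_gridRect.2 ⟨⟨hu, hu'⟩, hv, hv'⟩, ?_⟩
      rw [evenPt, add_sub_cancel, if_pos hc, ← rectPt_eq]
      rfl
    -- The column is flat, so the cell is a segment; it goes to the left side of the rectangle of
    -- the next edge that exists.
    · have hmem := nextDir_mem (P := fun d => IsGridNode m n (rowNode n k r + d))
        (exists_neighbor hp ha (rowNode n k r).1 hd)
      have hnorm := (nextDir_norm (fun d => IsGridNode m n (rowNode n k r + d))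
        (rowNode n k r).1 (colNode n k c - rowNode n k r)).trans hd
      refine ⟨GridEdge.ofNodes ha hmem hae (even_add_of_odd_sub hae hnorm)
        (by rw [← hnorm, Prod.fst_add, Prod.snd_add]; ring), rfl, fun u v hu hu' hv hv' => ?_⟩
      rw [colWidth_eq_zero hp.two_le_right hk hcn hc] at hu'
      obtain rfl := le_antisymm hu' hu
      rw [← gridWeight_rowNode hp.two_le_right] at hv'
      refine ⟨mem_gridRect.2 ⟨⟨le_rfl, (gridWeight_pos hmem).le⟩, hv, hv'⟩, ?_⟩
      rw [evenPt, add_sub_cancel, if_neg hc, ← rectPt_eq]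
      rfl
  obtain ⟨e, -, he⟩ := key
  refine ⟨e, ![-colPos n (sideLen m k) c, -rowPos n (sideLen m k) r], fun x y h => ?_⟩
  obtain ⟨⟨hx, hx'⟩, ⟨hy, hy'⟩, -⟩ := h
  rw [colPos_succ] at hx'
  rw [rowPos_succ] at hy'
  obtain ⟨h3, h4⟩ := he (x - colPos n (sideLen m k) c) (y - rowPos n (sideLen m k) r)
    (by linarith) (by linarith) (by linarith) (by linarith)
  have h5 : ![x, y] + ![-colPos n (sideLen m k) c, -rowPos n (sideLen m k) r] =
      ![x - colPos n (sideLen m k) c, y - rowPos n (sideLen m k) r] := by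
    simp [sub_eq_add_neg]
  simp only [h5]
  exact ⟨h3, h4⟩

/-- The map from the polygons to `X`. -/
def polyToX (hp : EvenGrid m n) (x : Σ k : Fin m, polyP m n k) : (surfaceX m n).Point :=
  cellPt m n x.1 (exists_inCell_polyP hp x.1.2 x.2.2).choose
    (exists_inCell_polyP hp x.1.2 x.2.2).choose_spec.choose (unshear n x.2) (x.2.1 1)

theorem polyToX_eq (hp : EvenGrid m n) (k : Fin m) {p : Plane} (h : p ∈ polyP m n k) {r c : ℕ}
    (h1 : 1 ≤ r) (h2 : r < n) (hs : 0 < sideLen m k r) (hb : InBand r c)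
    (hc : InCell n (sideLen m k) r c (unshear n p) (p 1)) :
    polyToX hp ⟨k, p, h⟩ = cellPt m n k r c (unshear n p) (p 1) := by
  obtain ⟨h3, h4, h5, h6, h7⟩ := (exists_inCell_polyP hp k.2 h).choose_spec.choose_spec
  exact cellPt_unique hp k.2 h3 h4 h5 h1 h2 hs h6 hb h7 hc

theorem polyToX_shear (hp : EvenGrid m n) (k : Fin m) {p : Plane} (h : p ∈ polyP m n k) {r c : ℕ}
    (h1 : 1 ≤ r) (h2 : r < n) (hs : 0 < sideLen m k r) (hb : InBand r c) {x y : ℝ}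
    (hxy : p = shear n x y) (hc : InCell n (sideLen m k) r c x y) :
    polyToX hp ⟨k, p, h⟩ = cellPt m n k r c x y := by
  have hx : unshear n p = x := by rw [hxy, unshear_shear hp.two_le_right]
  have hy : p 1 = y := by rw [hxy, shear_one]
  rw [polyToX_eq hp k h h1 h2 hs hb (by rwa [hx, hy]), hx, hy]

/-- Compatibility with the gluing of a right side to a left side. -/
theorem polyToX_slanted_side (hp : EvenGrid m n) (k k' : Fin m) {r : ℕ} (h1 : 1 ≤ r) (h2 : r < n)
    (hs : 0 < sideLen m k r) (hnode : rowNode n k r = rowNode n k' (n - r))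
    (hnode' : colNode n k (r + 1) = colNode n k' (n - (r + 1))) {t : ℝ}
    (ht : t ∈ Set.Icc (0 : ℝ) 1) (p : polyP m n k) (q : polyP m n k')
    (hpp : p.1 = sidePoint m n k r t) (hq : q.1 = sidePoint m n k' (2 * n - (n - r)) (1 - t)) :
    polyToX hp ⟨k, p⟩ = polyToX hp ⟨k', q⟩ := by
  have hn2 := hp.two_le_right
  obtain ⟨l, hl⟩ : ∃ l, n - r = l + 1 := ⟨n - r - 1, by omega⟩
  have hl' : n - (r + 1) = l := by omega
  rw [hl] at hnode hq
  rw [hl'] at hnode'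
  have hs' : 0 < sideLen m k' (l + 1) := by
    obtain ⟨h3, -⟩ := isGridNode_rowNode.1 (hnode ▸ isGridNode_rowNode_of_pos k.2 h1 h2 hs)
    exact sideLen_pos h3.1 h3.2
  have hh : rowHeight n (sideLen m k) r = rowHeight n (sideLen m k') (l + 1) := by
    rw [← gridWeight_rowNode hn2, hnode, gridWeight_rowNode hn2]
  have hw : colWidth n (sideLen m k) (r + 1) = colWidth n (sideLen m k') l := by
    rw [← gridWeight_colNode hn2, hnode', gridWeight_colNode hn2]
  have hh0 := rowHeight_nonneg (sideLen_nonneg k.2) (n := n) h2.le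
  have hw0 := colWidth_nonneg (sideLen_nonneg k.2) (n := n) (c := r + 1) h2
  rw [sidePoint_eq hn2 hp.even_right] at hpp
  rw [sidePoint_left_eq hn2 hp.even_right (by omega)] at hq
  have e1 := mul_nonneg ht.1 hh0
  have e2 := mul_nonneg ht.1 hw0
  have e3 := mul_le_mul_of_nonneg_right ht.2 hh0
  have e4 := mul_le_mul_of_nonneg_right ht.2 hw0
  rw [one_mul] at e3 e4
  -- Both sides are the diagonal of one and the same rectangle, seen from its upper left half in
  -- `P(k)` and from its lower right half in `P(k')`.
  rw [polyToX_shear hp k p.2 h1 h2 hs (c := r + 1) (Or.inr (Or.inl rfl)) hpp,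
    polyToX_shear hp k' q.2 (r := l + 1) (c := l) (by omega) (by omega) hs' (Or.inr (Or.inr rfl))
      hq]
  · simp only [cellPt, add_sub_cancel_left, hnode, hnode', hh, hw]
  · rw [hh] at e1 e3
    rw [hw] at e2 e4
    refine ⟨⟨by linarith, by rw [colPos_succ]; linarith⟩,
      ⟨by linarith, by rw [rowPos_succ (l + 1)]; linarith⟩, by omega, fun _ => ?_⟩
    simp only [add_sub_cancel_left]
    exact le_of_eq (by ring)
  · refine ⟨⟨by linarith, by rw [colPos_succ (r + 1)]; linarith⟩,
      ⟨by linarith, by rw [rowPos_succ r]; linarith⟩, fun _ => ?_, by omega⟩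
    simp only [add_sub_cancel_left]
    exact le_of_eq (by ring)

/-- Compatibility with the gluing of a top side to a bottom side. -/
theorem polyToX_horizontal_side (hp : EvenGrid m n) (k k' : Fin m)
    (hs : 0 < sideLen m k (n - 1)) (hs' : 0 < sideLen m k' 1) (hsc : 0 < sideLen m k n)
    (hnode : rowNode n k n = rowNode n k' 0) (hnode' : colNode n k (n - 1) = colNode n k' 1)
    {t : ℝ} (ht : t ∈ Set.Icc (0 : ℝ) 1) (p : polyP m n k) (q : polyP m n k')
    (hpp : p.1 = sidePoint m n k n t) (hq : q.1 = sidePoint m n k' 0 (1 - t)) :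
    polyToX hp ⟨k, p⟩ = polyToX hp ⟨k', q⟩ := by
  have hn2 := hp.two_le_right
  obtain ⟨l, rfl⟩ : ∃ l, n = l + 1 := ⟨n - 1, by omega⟩
  rw [Nat.add_sub_cancel] at *
  have hl1 : 1 ≤ l := by omega
  have h0 := sideLen_nonneg k.2
  have hw : colWidth (l + 1) (sideLen m k) l = colWidth (l + 1) (sideLen m k') 1 := by
    rw [← gridWeight_colNode hn2, hnode', gridWeight_colNode hn2]
  have hw0 := colWidth_nonneg h0 (n := l + 1) (c := l) (by omega)
  have hcol := isGridNode_colNode_of_pos (n := l + 1) k.2 hl1 (by omega) hsc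
  have hrow := isGridNode_rowNode_of_pos (n := l + 1) k.2 hl1 (by omega) hs
  have hrow' := isGridNode_rowNode_of_pos (n := l + 1) (r := 1) k'.2 le_rfl (by omega) hs'
  have hcol' : IsGridNode m (l + 1) (colNode (l + 1) k' 1) := hnode' ▸ hcol
  have hsc' : 0 < sideLen m k' (1 + 1) := by
    obtain ⟨h3, -⟩ := isGridNode_colNode.1 hcol'
    exact sideLen_pos h3.1 h3.2
  -- The top side is traversed from right to left, so the point with parameter `t` has distance `u`
  -- from its left end.
  set u := (1 - t) * colWidth (l + 1) (sideLen m k) l with hu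
  have e1 : 0 ≤ u := mul_nonneg (by linarith [ht.2]) hw0
  have e2 : u ≤ colWidth (l + 1) (sideLen m k) l := by
    have := mul_le_mul_of_nonneg_right (show 1 - t ≤ 1 by linarith [ht.1]) hw0
    linarith
  have hpp' : p.1 = shear (l + 1) (colPos (l + 1) (sideLen m k) l + u)
      (rowPos (l + 1) (sideLen m k) (l + 1)) := by
    have h3 : colWidth (l + 1) (sideLen m k) (l + 1 + 1) = -colWidth (l + 1) (sideLen m k) l := by
      rw [colWidth, colWidth, sin_add_eq_neg_sin_sub hn2 (t := 1) (b := l) rfl (by omega),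
        sideLen_add_two]
      ring
    rw [hpp, sidePoint_eq hn2 hp.even_right, rowHeight_self hn2, h3, colPos_succ (l + 1),
      colWidth_self hn2, colPos_succ l, hu]
    congr 1 <;> ring
  have hq' : q.1 = shear (l + 1) (colPos (l + 1) (sideLen m k') 1 + u)
      (rowPos (l + 1) (sideLen m k') 1) := by
    rw [hq, sidePoint_eq hn2 hp.even_right, zero_add, rowHeight_zero, rowPos_zero, rowPos_one, hu,
      hw]
    congr 1; ring
  have hmono := rowPos_mono (n := l + 1) h0 (a := l) (b := l + 1) (by omega) (by omega)
  have hmono' := rowPos_mono (n := l + 1) (sideLen_nonneg k'.2) (a := 1) (b := 1 + 1) (by omega)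
    (by omega)
  -- Row `n` of `P(k)` and row `0` of `P(k')` belong to the same absent node. The gluing therefore
  -- amounts to two upward steps across a flat cell.
  have g1 := colCellPt_succ hp k.2 (r := l) (c := l) hl1 (by omega) hsc (Or.inl rfl)
    (x := colPos (l + 1) (sideLen m k) l + u) (by linarith) (by rw [colPos_succ]; linarith)
  have g2 := colCellPt_succ hp k'.2 (r := 0) (c := 1) le_rfl (by omega) hsc' (Or.inr rfl)
    (x := colPos (l + 1) (sideLen m k') 1 + u) (by linarith) (by rw [colPos_succ 1]; linarith)
  rw [polyToX_shear hp k p.2 hl1 (by omega) hs (Or.inl rfl) hpp',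
    polyToX_shear hp k' q.2 (r := 1) (c := 1) le_rfl (by omega) hs' (Or.inl rfl) hq',
    cellPt_eq_colCellPt hrow hcol, cellPt_eq_colCellPt hrow' hcol', g1]
  · rw [zero_add] at g2
    rw [← g2]
    simp only [colCellPt, add_sub_cancel_left, hnode, hnode', sub_self, rowPos_zero, rowPos_one]
  · exact ⟨⟨by linarith, by rw [colPos_succ 1]; linarith⟩, ⟨le_rfl, hmono'⟩, by omega, by omega⟩
  · exact ⟨⟨by linarith, by rw [colPos_succ]; linarith⟩, ⟨hmono, le_rfl⟩, by omega, by omega⟩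

/-- The sides `0` and `n` are horizontal, those in between lie on the right and those beyond `n` on
the left. For `i = 0` and `i > n` the two polygons exchange their roles. -/
theorem polyToX_side (hp : EvenGrid m n) (k k' : Fin m) (hk : Odd (k : ℕ)) {i : ℕ}
    (hi : i < 2 * n) (h : Even i ∧ (k' : ℕ) = k + 1 ∨ Odd i ∧ (k' : ℕ) + 1 = k) {t : ℝ}
    (ht : t ∈ Set.Icc (0 : ℝ) 1) (p : polyP m n k) (q : polyP m n k')
    (hpp : p.1 = sidePoint m n k i t) (hq : q.1 = sidePoint m n k' ((i + n) % (2 * n)) (1 - t)) :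
    polyToX hp ⟨k, p⟩ = polyToX hp ⟨k', q⟩ := by
  have hn := hp.even_right
  have hn' := hn
  rw [Nat.even_iff] at hn'
  have hn2 := hp.two_le_right
  have hm := hp.even_left
  rw [Nat.even_iff] at hm
  have ht' : 1 - t ∈ Set.Icc (0 : ℝ) 1 := ⟨by linarith [ht.2], by linarith [ht.1]⟩
  have hk2 := Nat.odd_iff.1 hk
  have hkm := k.2
  have hkm' := k'.2
  rcases Nat.eq_zero_or_pos i with rfl | hi0
  · have hk' : (k' : ℕ) = k + 1 := by rcases h with h | h; exacts [h.2, absurd h.1 (by simp)]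
    obtain ⟨⟨h1, h2⟩, -⟩ := opposite_nodes hn hk h (by omega : 0 < n)
    rw [Nat.sub_zero] at h1
    rw [zero_add, Nat.mod_eq_of_lt (by omega)] at hq
    refine (polyToX_horizontal_side hp k' k (sideLen_pos ?_ ?_) (sideLen_pos ?_ ?_)
      (sideLen_pos ?_ ?_) h1.symm h2.symm ht' q p hq (by rw [hpp, sub_sub_cancel])).symm <;>
      unfold nodeCol <;> omega
  rcases lt_trichotomy i n with hin | rfl | hin
  · obtain ⟨⟨h1, h2⟩, -⟩ := opposite_nodes hn hk h hin
    refine polyToX_slanted_side hp k k' hi0 hin (opposite_sideLen_pos hk k.2 k'.2 h).1 h1 h2 ht p q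
      hpp ?_
    rw [hq, Nat.mod_eq_of_lt (by omega)]
    congr 1; omega
  · have hk' : (k' : ℕ) = k + 1 := by
      rcases h with h | h
      exacts [h.2, absurd hn (Nat.not_even_iff_odd.2 h.1)]
    obtain ⟨-, h1, h2⟩ := opposite_nodes (r := 0) hn hk (Or.inl ⟨Even.zero, hk'⟩)
      (by omega : 0 < i)
    rw [Nat.sub_zero] at h1
    rw [← two_mul, Nat.mod_self] at hq
    refine polyToX_horizontal_side hp k k' (sideLen_pos ?_ ?_) (sideLen_pos ?_ ?_)
      (sideLen_pos ?_ ?_) h1.symm h2.symm ht p q hpp hq <;>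
      unfold nodeCol <;> omega
  · obtain ⟨r, rfl⟩ : ∃ r, i = r + n := ⟨i - n, by omega⟩
    have h' : Even r ∧ (k' : ℕ) = k + 1 ∨ Odd r ∧ (k' : ℕ) + 1 = k := by
      rwa [Nat.even_add, Nat.odd_add, iff_true_right hn, iff_true_right hn] at h
    obtain ⟨-, h1, h2⟩ := opposite_nodes hn hk h' (by omega)
    refine (polyToX_slanted_side hp k' k (by omega) (by omega)
      (opposite_sideLen_pos hk k.2 k'.2 h').2 h1 h2 ht' q p ?_ ?_).symm
    · rw [hq]
      congr 1
      rw [add_assoc, ← two_mul, Nat.add_mod_right, Nat.mod_eq_of_lt (by omega)]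
    · rw [hpp, sub_sub_cancel]
      congr 1; omega

theorem polyToX_glue (hp : EvenGrid m n) (x y : Σ k : Fin m, polyP m n k) (h : PolyGlue m n x y) :
    polyToX hp x = polyToX hp y := by
  cases h with
  | even_side k k' p q hk hk' i hi hi' t ht hp' hq =>
    exact polyToX_side hp k k' hk hi (Or.inl ⟨hi', hk'⟩) ht p q hp' hq
  | odd_side k k' p q hk hk' i hi hi' t ht hp' hq =>
    exact polyToX_side hp k k' hk hi (Or.inr ⟨hi', hk'⟩) ht p q hp' hq

/-- The map `Y → X`. -/
def surfaceYToX (hp : EvenGrid m n) : (surfaceY m n).Point → (surfaceX m n).Point :=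
  Quot.lift (polyToX hp) (polyToX_glue hp)

theorem piecewiseAffine_surfaceYToX (hp : EvenGrid m n) :
    TiledSurface.PiecewiseAffine (surfaceY m n) (surfaceX m n) (derivMuInv n)
      (surfaceYToX hp) := by
  intro (k : Fin m)
  let ι := {rc : Fin n × Fin (n + 1) // (1 ≤ (rc.1 : ℕ) ∧ 0 < sideLen m k rc.1) ∧
    InBand rc.1 rc.2}
  have hex : ∀ l : ι, ∃ (e : GridEdge m n) (c₀ : Plane), ∀ x y,
      InCell n (sideLen m k) l.1.1 l.1.2 x y → ∃ h : ![x, y] + c₀ ∈ gridRect e,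
        cellPt m n k l.1.1 l.1.2 x y = (surfaceX m n).param ⟨e, _, h⟩ := fun l =>
    exists_cellPt_eq_param hp k.2 l.2.1.1 l.1.1.2 l.2.1.2 l.2.2
  choose e c₀ hec using hex
  refine ⟨ι, inferInstance,
    fun l => {p | InCell n (sideLen m k) l.1.1 l.1.2 (unshear n p) (p 1)}, e, c₀,
    fun l => isClosed_inCell _ _ _ _ (continuous_unshear n) (continuous_apply 1), ?_, ?_⟩
  · intro p h
    obtain ⟨r, c, h1, h2, hs, hb, hc⟩ := exists_inCell_polyP hp k.2 h
    have hcn : c < n + 1 := by unfold InBand at hb; omega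
    exact ⟨⟨(⟨r, h2⟩, ⟨c, hcn⟩), ⟨h1, hs⟩, hb⟩, hc⟩
  · intro l p h hl
    obtain ⟨h1, h2⟩ := hec l _ _ hl
    simp only [derivMuInv_mulVec]
    exact ⟨h1, (polyToX_eq hp k h l.2.1.1 l.1.1.2 l.2.1.2 l.2.2 hl).trans h2⟩

end

/-! ### Points of `Y` in the rectangle of an edge -/

noncomputable section

variable {m n k : ℕ}

open Classical in
/-- The point `p` of the polygon `P(k)`. -/
def polyPt (m n : ℕ) [Nonempty (surfaceY m n).Point] (k : ℕ) (p : Plane) : (surfaceY m n).Point :=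
  if h : ∃ _ : k < m, p ∈ polyP m n k then
    (surfaceY m n).param ⟨(⟨k, h.choose⟩ : Fin m), ⟨p, h.choose_spec⟩⟩
  else Classical.arbitrary _

/-- The point with coordinates `(u, v)` in the rectangle of the edge from `a` to `b` lies in the
cell `(r, c)` of `P(k)`. -/
structure MatchesCell (m n : ℕ) (a b : ℤ × ℤ) (u v : ℝ) (k r c : ℕ) : Prop where
  lt : k < m
  row_le : r ≤ n
  col_le : c ≤ n
  diag : c = r → 1 ≤ r ∧ r < n
  band : InBand r c
  row : rowNode n k r = a
  col : colNode n k c = b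
  cell : InCell n (sideLen m k) r c (colPos n (sideLen m k) c + u) (rowPos n (sideLen m k) r + v)

theorem MatchesCell.mem (hp : EvenGrid m n) {a b : ℤ × ℤ} {u v : ℝ} {r c : ℕ}
    (h : MatchesCell m n a b u v k r c) :
    shear n (colPos n (sideLen m k) c + u) (rowPos n (sideLen m k) r + v) ∈ polyP m n k := by
  rw [polyP_eq hp.even_right]
  exact shear_mem_of_inCell hp.two_le_right sideLen_add_two (sideLen_nonneg h.lt) h.row_le h.col_le
    h.diag h.band h.cell

/-- A neighbour off the grid has an abscissa `0` or `m`, or an ordinate `0` or `n`, where one of the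
sines vanishes. -/
theorem gridWeight_add_eq_zero {v d : ℤ × ℤ} (hv : IsGridNode m n v) (hd : d.1 ^ 2 + d.2 ^ 2 = 1)
    (h : ¬ IsGridNode m n (v + d)) : gridWeight m n (v + d) = 0 := by
  obtain ⟨x, y⟩ := v
  obtain ⟨z, w⟩ := d
  obtain ⟨h1, h2, h3, h4⟩ := hv
  simp only at h1 h2 h3 h4
  have hb : x + z = 0 ∨ x + z = m ∨ y + w = 0 ∨ y + w = n := by
    simp only [IsGridNode, Prod.mk_add_mk] at h
    rcases unit_direction hd with h5 | h5 | h5 | h5 <;> rw [Prod.mk.injEq] at h5 <;> omega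
  have hm0 : (m : ℝ) ≠ 0 := by have : 0 < m := by omega
                               positivity
  have hn0 : (n : ℝ) ≠ 0 := by have : 0 < n := by omega
                               positivity
  simp only [gridWeight, Prod.mk_add_mk]
  rcases hb with hb | hb | hb | hb <;> rw [hb]
  · simp
  · rw [Int.cast_natCast, mul_div_cancel_left₀ _ hm0, Real.sin_pi, zero_mul]
  · simp
  · rw [Int.cast_natCast, mul_div_cancel_left₀ _ hn0, Real.sin_pi, mul_zero]

theorem exists_diagonal_parameter {u v w h : ℝ} (hu : 0 ≤ u) (huw : u ≤ w) (hv : 0 ≤ v)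
    (hvh : v ≤ h) (heq : u * h = v * w) : ∃ t ∈ Set.Icc (0 : ℝ) 1, u = t * w ∧ v = t * h := by
  rcases (hu.trans huw).eq_or_lt with rfl | hw
  · obtain rfl := le_antisymm huw hu
    rcases (hv.trans hvh).eq_or_lt with rfl | hh
    · exact ⟨0, ⟨le_rfl, zero_le_one⟩, by simp, by linarith⟩
    · exact ⟨v / h, ⟨by positivity, (div_le_one hh).2 hvh⟩, by simp, by field_simp⟩
  · refine ⟨u / w, ⟨by positivity, (div_le_one hw).2 huw⟩, by field_simp, ?_⟩
    rw [div_mul_eq_mul_div, heq]; field_simp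

/-- An edge belongs to a cell of a single polygon or to cells of two glued polygons on different
sides of the diagonal. -/
theorem MatchesCell.opposite (hn : Even n) {a b : ℤ × ℤ} {u v : ℝ} {r c k' r' c' : ℕ}
    (h : MatchesCell m n a b u v k r c) (h' : MatchesCell m n a b u v k' r' c') (hk : Odd k)
    (hkk : k' ≠ k) : (Even r ∧ k' = k + 1 ∨ Odd r ∧ k' + 1 = k) ∧ r + r' = n ∧
      (c = r + 1 ∧ c' + 1 = r' ∨ c + 1 = r ∧ c' = r' + 1) := by
  have h1 := h.row.trans h'.row.symm
  have h2 := h.col.trans h'.col.symm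
  have h3 := h.band
  have h4 := h'.band
  unfold InBand at h3 h4
  simp only [rowNode, colNode, nodeCol, nodeRow, Prod.mk.injEq] at h1 h2
  rw [Nat.even_iff] at hn
  rw [Nat.odd_iff] at hk
  rw [Nat.even_iff, Nat.odd_iff]
  have h5 := h.lt
  have h6 := h.row_le
  have h7 := h'.row_le
  split_ifs at h1 h2 <;> omega

variable [Nonempty (surfaceY m n).Point]

theorem polyPt_eq (k : Fin m) {p : Plane} (h : p ∈ polyP m n k) :
    polyPt m n k p = (surfaceY m n).param ⟨k, p, h⟩ := dif_pos (⟨k.2, h⟩ : ∃ _ : (k : ℕ) < m, _)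

/-- An edge occurring in two polygons is vertical, and the polygons contain opposite halves of its
rectangle. A point of both halves lies on the diagonal, which is a glued side. The end nodes may be
off the grid, as `nextDir_chain` requires. -/
theorem polyPt_glue (hp : EvenGrid m n) {a b : ℤ × ℤ} {u v : ℝ} {r c k' r' c' : ℕ}
    (h : MatchesCell m n a b u v k r c) (h' : MatchesCell m n a b u v k' r' c') (hk : Odd k)
    (hkk : k' ≠ k) :
    polyPt m n k (shear n (colPos n (sideLen m k) c + u) (rowPos n (sideLen m k) r + v)) =
      polyPt m n k' (shear n (colPos n (sideLen m k') c' + u) (rowPos n (sideLen m k') r' + v)) :=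
          by
  have hn := hp.even_right
  have hn2 := hp.two_le_right
  obtain ⟨hpar, hrr, hcc⟩ := h.opposite hn h' hk hkk
  rw [polyPt_eq ⟨k, h.lt⟩ (h.mem hp), polyPt_eq ⟨k', h'.lt⟩ (h'.mem hp)]
  have hw : colWidth n (sideLen m k) c = colWidth n (sideLen m k') c' := by
    rw [← gridWeight_colNode hn2, h.col, ← h'.col, gridWeight_colNode hn2]
  have hh : rowHeight n (sideLen m k) r = rowHeight n (sideLen m k') r' := by
    rw [← gridWeight_rowNode hn2, h.row, ← h'.row, gridWeight_rowNode hn2]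
  obtain ⟨⟨hx, hx'⟩, ⟨hy, hy'⟩, hup, hlow⟩ := h.cell
  obtain ⟨-, -, hup', hlow'⟩ := h'.cell
  rw [colPos_succ] at hx'
  rw [rowPos_succ] at hy'
  simp only [add_sub_cancel_left, ← hw, ← hh] at hup hlow hup' hlow'
  have heq : u * rowHeight n (sideLen m k) r = v * colWidth n (sideLen m k) c := by
    rcases hcc with ⟨h1, h2⟩ | ⟨h1, h2⟩
    · exact le_antisymm (hup h1) (hlow' h2)
    · exact le_antisymm (hup' h2) (hlow h1)
  obtain ⟨t, ht, rfl, rfl⟩ := exists_diagonal_parameter (by linarith) (by linarith) (by linarith)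
    (by linarith) heq
  have hr := h.row_le
  have hc := h.col_le
  have hr' := h'.row_le
  have hc' := h'.col_le
  have ht' : 1 - t ∈ Set.Icc (0 : ℝ) 1 := ⟨by linarith [ht.2], by linarith [ht.1]⟩
  have glue : ∀ (i : ℕ) (t' : ℝ), i < 2 * n → (Even i ↔ Even r) → t' ∈ Set.Icc (0 : ℝ) 1 →
      shear n (colPos n (sideLen m k) c + t * colWidth n (sideLen m k) c)
        (rowPos n (sideLen m k) r + t * rowHeight n (sideLen m k) r) = sidePoint m n k i t' →
      shear n (colPos n (sideLen m k') c' + t * colWidth n (sideLen m k) c)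
        (rowPos n (sideLen m k') r' + t * rowHeight n (sideLen m k) r) =
          sidePoint m n k' ((i + n) % (2 * n)) (1 - t') →
      (surfaceY m n).param ⟨(⟨k, h.lt⟩ : Fin m), ⟨_, h.mem hp⟩⟩ =
        (surfaceY m n).param ⟨(⟨k', h'.lt⟩ : Fin m), ⟨_, h'.mem hp⟩⟩ := by
    intro i t' hi hir ht' e1 e2
    rcases hpar with ⟨h3, h4⟩ | ⟨h3, h4⟩
    · exact Quot.sound (PolyGlue.even_side _ _ _ _ hk h4 i hi (hir.2 h3) t' ht' e1 e2)
    · refine Quot.sound (PolyGlue.odd_side _ _ _ _ hk h4 i hi ?_ t' ht' e1 e2)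
      rw [← Nat.not_even_iff_odd, hir, Nat.not_even_iff_odd]
      exact h3
  rcases hcc with ⟨rfl, rfl⟩ | ⟨rfl, rfl⟩
  · refine glue r t (by omega) Iff.rfl ht ?_ ?_
    · rw [sidePoint_eq hn2 hn]
    · rw [Nat.mod_eq_of_lt (by omega), show r + n = 2 * n - (c' + 1) by omega,
        sidePoint_left_eq hn2 hn (by omega), hw, hh]
  · refine glue (2 * n - (c + 1)) (1 - t) (by omega) ?_ ht' ?_ ?_
    · rw [Nat.even_sub (by omega), iff_true_left (even_two_mul n)]
    · rw [sidePoint_left_eq hn2 hn (by omega)]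
    · rw [sub_sub_cancel, show 2 * n - (c + 1) + n = r' + 2 * n by omega, Nat.add_mod_right,
        Nat.mod_eq_of_lt (by omega), sidePoint_eq hn2 hn, hw, hh]

open Classical in
/-- The point of `Y` that belongs to the point with coordinates `(u, v)` in the rectangle of the
edge from `a` to `b`. -/
def edgePt (m n : ℕ) [Nonempty (surfaceY m n).Point] (a b : ℤ × ℤ) (u v : ℝ) :
    (surfaceY m n).Point :=
  if h : ∃ x : ℕ × ℕ × ℕ, MatchesCell m n a b u v x.1 x.2.1 x.2.2 then
    polyPt m n h.choose.1
      (shear n (colPos n (sideLen m h.choose.1) h.choose.2.2 + u)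
        (rowPos n (sideLen m h.choose.1) h.choose.2.1 + v))
  else Classical.arbitrary _

/-- The chosen cell is immaterial: within one polygon the nodes determine row and column, and two
polygons are compared by the gluing. -/
theorem edgePt_eq (hp : EvenGrid m n) {a b : ℤ × ℤ} {u v : ℝ} {r c : ℕ}
    (h : MatchesCell m n a b u v k r c) : edgePt m n a b u v =
      polyPt m n k (shear n (colPos n (sideLen m k) c + u) (rowPos n (sideLen m k) r + v)) := by
  have hex : ∃ x : ℕ × ℕ × ℕ, MatchesCell m n a b u v x.1 x.2.1 x.2.2 := ⟨(k, r, c), h⟩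
  rw [edgePt, dif_pos hex]
  have h' := hex.choose_spec
  generalize hex.choose = x at h' ⊢
  obtain ⟨k', r', c'⟩ := x
  simp only at h' ⊢
  by_cases hkk : k' = k
  · subst hkk
    rw [rowNode_injective (h'.row.trans h.row.symm), colNode_injective (h'.col.trans h.col.symm)]
  · by_cases hk : Odd k
    · exact (polyPt_glue hp h h' hk hkk).symm
    · refine polyPt_glue hp h' h ?_ (Ne.symm hkk)
      -- Two different polygons with a common even node have consecutive indices, so one of the
      -- indices is odd.
      have h1 := congrArg Prod.fst (h.row.trans h'.row.symm)
      simp only [rowNode, nodeCol] at h1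
      rw [Nat.odd_iff] at hk ⊢
      omega

/-- Both points are the same point of one polygon, on the common vertical line of two neighbouring
cells of a row. Neither `a + d` nor `a + turn a.1 d` needs to be a node. -/
theorem edgePt_turn_even (hp : EvenGrid m n) {a d : ℤ × ℤ} (ha : IsGridNode m n a)
    (hae : Even (a.1 + a.2)) (hd : d.1 ^ 2 + d.2 ^ 2 = 1) {v : ℝ} (h0 : 0 ≤ v)
    (h1 : v ≤ gridWeight m n a) :
    edgePt m n a (a + d) (gridWeight m n (a + d)) v = edgePt m n a (a + turn a.1 d) 0 v := by
  have hn2 := hp.two_le_right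
  obtain ⟨k, r, c, hk, ⟨hr1, hr2⟩, hc, hrow, hcol, hcol'⟩ :=
    exists_cells_around_even hp.even_right ha hae hd
  have hs := sideLen_nonneg hk
  have hw := colWidth_nonneg hs (n := n) (c := c) (by omega)
  have hw' := colWidth_nonneg hs (n := n) (c := c + 1) (by omega)
  have hh := rowHeight_nonneg hs (n := n) (r := r) (by omega)
  rw [← hcol, gridWeight_colNode hn2, ← hcol']
  rw [← hrow, gridWeight_rowNode hn2] at h1
  have m1 : MatchesCell m n a (colNode n k c) (colWidth n (sideLen m k) c) v k r c := by
    refine ⟨hk, by omega, by omega, by omega, by unfold InBand; omega, hrow, rfl, ⟨by linarith,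
      (colPos_succ _).ge⟩, ⟨by linarith, by rw [rowPos_succ]; linarith⟩, by omega, fun _ => ?_⟩
    simp only [add_sub_cancel_left]
    rw [mul_comm]
    exact mul_le_mul_of_nonneg_left h1 hw
  have m2 : MatchesCell m n a (colNode n k (c + 1)) 0 v k r (c + 1) := by
    refine ⟨hk, by omega, by omega, by omega, by unfold InBand; omega, hrow, rfl, ⟨by linarith,
      by rw [colPos_succ (c + 1)]; linarith⟩, ⟨by linarith, by rw [rowPos_succ]; linarith⟩,
      fun _ => ?_, by omega⟩
    simp only [add_sub_cancel_left]
    rw [zero_mul]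
    exact mul_nonneg h0 hw'
  rw [edgePt_eq hp m1, edgePt_eq hp m2, ← colPos_succ, add_zero]

theorem edgePt_turn_odd (hp : EvenGrid m n) {b d : ℤ × ℤ} (hb : IsGridNode m n b)
    (hbo : Odd (b.1 + b.2)) (hd : d.1 ^ 2 + d.2 ^ 2 = 1) {u : ℝ} (h0 : 0 ≤ u)
    (h1 : u ≤ gridWeight m n b) :
    edgePt m n (b + d) b u (gridWeight m n (b + d)) = edgePt m n (b + turn b.1 d) b u 0 := by
  have hn2 := hp.two_le_right
  obtain ⟨k, r, c, hk, ⟨hc1, hc2⟩, hr, hcol, hrow, hrow'⟩ :=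
    exists_cells_around_odd hp.even_right hb hbo hd
  have hs := sideLen_nonneg hk
  have hw := colWidth_nonneg hs (n := n) (c := c) (by omega)
  have hh := rowHeight_nonneg hs (n := n) (r := r) (by omega)
  have hh' := rowHeight_nonneg hs (n := n) (r := r + 1) (by omega)
  rw [← hrow, gridWeight_rowNode hn2, ← hrow']
  rw [← hcol, gridWeight_colNode hn2] at h1
  have m1 : MatchesCell m n (rowNode n k r) b u (rowHeight n (sideLen m k) r) k r c := by
    refine ⟨hk, by omega, by omega, by omega, by unfold InBand; omega, rfl, hcol,
      ⟨by linarith, by rw [colPos_succ]; linarith⟩, ⟨by linarith, (rowPos_succ _).ge⟩,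
      fun _ => ?_, by omega⟩
    simp only [add_sub_cancel_left]
    rw [mul_comm]
    exact mul_le_mul_of_nonneg_left h1 hh
  have m2 : MatchesCell m n (rowNode n k (r + 1)) b u 0 k (r + 1) c := by
    refine ⟨hk, by omega, by omega, by omega, by unfold InBand; omega, rfl, hcol,
      ⟨by linarith, by rw [colPos_succ]; linarith⟩, ⟨by linarith,
      by rw [rowPos_succ (r + 1)]; linarith⟩, by omega, fun _ => ?_⟩
    simp only [add_sub_cancel_left]
    rw [zero_mul]
    exact mul_nonneg h0 hh'
  rw [edgePt_eq hp m1, edgePt_eq hp m2, ← rowPos_succ, add_zero]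

/-- A function of directions that is invariant under steps across degenerate directions is
invariant under `nextDir`. -/
theorem nextDir_chain {α : Type*} {P : ℤ × ℤ → Prop} [DecidablePred P] {i : ℤ} {w : ℤ × ℤ → ℝ}
    {F : ℤ × ℤ → ℝ → α} (hw : ∀ d, d.1 ^ 2 + d.2 ^ 2 = 1 → ¬ P d → w d = 0)
    (hF : ∀ d, d.1 ^ 2 + d.2 ^ 2 = 1 → F d (w d) = F (turn i d) 0) {d : ℤ × ℤ}
    (hd : d.1 ^ 2 + d.2 ^ 2 = 1) : F d (w d) = F (nextDir P i d) 0 := by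
  have h1 := isGridNode_add_turn_norm (i := i) hd
  have h2 := isGridNode_add_turn_norm (i := i) h1
  have h3 := isGridNode_add_turn_norm (i := i) h2
  have step : ∀ d, d.1 ^ 2 + d.2 ^ 2 = 1 → ¬ P d → F d 0 = F (turn i d) 0 := fun d hd h => by
    rw [← hF d hd, hw d hd h]
  unfold nextDir
  split_ifs with g1 g2 g3
  · exact hF d hd
  · rw [hF d hd, step _ h1 g1]
  · rw [hF d hd, step _ h1 g1, step _ h2 g2]
  · rw [hF d hd, step _ h1 g1, step _ h2 g2, step _ h3 g3, turn_four]

theorem edgePt_nextDir_even (hp : EvenGrid m n) {a d : ℤ × ℤ} (ha : IsGridNode m n a)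
    (hae : Even (a.1 + a.2)) (hd : d.1 ^ 2 + d.2 ^ 2 = 1) {v : ℝ} (h0 : 0 ≤ v)
    (h1 : v ≤ gridWeight m n a) :
    edgePt m n a (a + d) (gridWeight m n (a + d)) v =
      edgePt m n a (a + nextDir (fun d => IsGridNode m n (a + d)) a.1 d) 0 v :=
  nextDir_chain (P := fun d => IsGridNode m n (a + d)) (w := fun d => gridWeight m n (a + d))
    (F := fun d u => edgePt m n a (a + d) u v) (fun _ hd h => gridWeight_add_eq_zero ha hd h)
    (fun _ hd => edgePt_turn_even hp ha hae hd h0 h1) hd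

theorem edgePt_nextDir_odd (hp : EvenGrid m n) {b d : ℤ × ℤ} (hb : IsGridNode m n b)
    (hbo : Odd (b.1 + b.2)) (hd : d.1 ^ 2 + d.2 ^ 2 = 1) {u : ℝ} (h0 : 0 ≤ u)
    (h1 : u ≤ gridWeight m n b) :
    edgePt m n (b + d) b u (gridWeight m n (b + d)) =
      edgePt m n (b + nextDir (fun d => IsGridNode m n (b + d)) b.1 d) b u 0 :=
  nextDir_chain (P := fun d => IsGridNode m n (b + d)) (w := fun d => gridWeight m n (b + d))
    (F := fun d v => edgePt m n (b + d) b u v) (fun _ hd h => gridWeight_add_eq_zero hb hd h)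
    (fun _ hd => edgePt_turn_odd hp hb hbo hd h0 h1) hd

end

/-! ### The map from `X` to `Y` -/

noncomputable section

variable {m n : ℕ}

theorem GridEdge.norm_sub (e : GridEdge m n) : (e.b - e.a).1 ^ 2 + (e.b - e.a).2 ^ 2 = 1 := by
  rw [← e.dist_one, Prod.fst_sub, Prod.snd_sub]; ring

theorem GridEdge.norm_sub' (e : GridEdge m n) : (e.a - e.b).1 ^ 2 + (e.a - e.b).2 ^ 2 = 1 := by
  rw [← e.dist_one, Prod.fst_sub, Prod.snd_sub]

/-- Every point of a rectangle lies in some cell. -/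
theorem exists_matchesCell (hp : EvenGrid m n) (e : GridEdge m n) {u v : ℝ} (hu : 0 ≤ u)
    (hu' : u ≤ gridWeight m n e.b) (hv : 0 ≤ v) (hv' : v ≤ gridWeight m n e.a) :
    ∃ k r c, MatchesCell m n e.a e.b u v k r c := by
  have hn2 := hp.two_le_right
  have cell : ∀ k r c, k < m → 1 ≤ r → r < n → InBand r c → rowNode n k r = e.a →
      colNode n k c = e.b → (c = r + 1 → u * gridWeight m n e.a ≤ v * gridWeight m n e.b) →
      (c + 1 = r → v * gridWeight m n e.b ≤ u * gridWeight m n e.a) →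
      MatchesCell m n e.a e.b u v k r c := by
    intro k r c hk hr1 hr2 hb hrow hcol h1 h2
    rw [← hrow, gridWeight_rowNode hn2] at hv' h1 h2
    rw [← hcol, gridWeight_colNode hn2] at hu' h1 h2
    refine ⟨hk, hr2.le, by unfold InBand at hb; omega, fun _ => ⟨hr1, hr2⟩, hb, hrow, hcol,
      ⟨by linarith, by rw [colPos_succ]; linarith⟩, ⟨by linarith, by rw [rowPos_succ]; linarith⟩,
      ?_, ?_⟩
    · simpa only [add_sub_cancel_left] using h1
    · simpa only [add_sub_cancel_left] using h2
  obtain ⟨k, r, c, hk, ⟨hr1, hr2⟩, hc, hrow, hcol, -⟩ :=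
    exists_cells_around_even hp.even_right e.a_node e.a_even e.norm_sub
  rw [add_sub_cancel] at hcol
  rcases hc with rfl | rfl
  · exact ⟨k, c, c, cell k c c hk hr1 hr2 (Or.inl rfl) hrow hcol (by omega) (by omega)⟩
  rcases le_total (v * gridWeight m n e.b) (u * gridWeight m n e.a) with h | h
  · exact ⟨k, c + 1, c, cell k _ c hk hr1 hr2 (Or.inr (Or.inr rfl)) hrow hcol (by omega)
      fun _ => h⟩
  -- The point lies in the other half of the rectangle of a vertical edge. Its cell is found from
  -- the preceding direction, three quarter turns on, whose next direction is that of `e`.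
  · have hd := isGridNode_add_turn_norm (i := e.a.1) (isGridNode_add_turn_norm (i := e.a.1)
      (isGridNode_add_turn_norm (i := e.a.1) e.norm_sub))
    obtain ⟨k', r', c', hk', ⟨hr1', hr2'⟩, hc', hrow', -, hcol'⟩ :=
      exists_cells_around_even hp.even_right e.a_node e.a_even hd
    rw [turn_four, add_sub_cancel] at hcol'
    refine ⟨k', r', c' + 1, cell k' r' (c' + 1) hk' hr1' hr2' (by unfold InBand; omega) hrow' hcol'
      (fun _ => h) (by omega)⟩

/-! ### Compatibility with the involutions -/

theorem rowNode_rev (hm : Even m) {k : ℕ} (hk : k < m) (r : ℕ) :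
    rowNode n (m - 1 - k) r = iotaNode m n (rowNode n k r) := by
  rw [Nat.even_iff] at hm
  simp only [rowNode, iotaNode, nodeCol, nodeRow, Prod.mk.injEq]
  split_ifs <;> omega

theorem colNode_rev (hm : Even m) {k : ℕ} (hk : k < m) (c : ℕ) :
    colNode n (m - 1 - k) c = iotaNode m n (colNode n k c) := by
  rw [Nat.even_iff] at hm
  simp only [colNode, iotaNode, nodeCol, nodeRow, Prod.mk.injEq]
  split_ifs <;> omega

theorem sideLen_rev (hm : Even m) {k : ℕ} (hk : k < m) : sideLen m (m - 1 - k) = sideLen m k := by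
  rw [Nat.even_iff] at hm
  have hm0 : (m : ℝ) ≠ 0 := by have : 0 < m := by omega
                               positivity
  funext r
  have h : nodeCol k r ≤ m := by unfold nodeCol; omega
  have h' : nodeCol (m - 1 - k) r = m - nodeCol k r := by unfold nodeCol; omega
  rw [sideLen, sideLen, h', ← Real.sin_pi_sub, Nat.cast_sub h]
  congr 1; field_simp; ring

variable [Nonempty (surfaceY m n).Point]

/-- The map from the rectangles to `Y`. -/
def rectToY (x : Σ e : GridEdge m n, gridRect e) : (surfaceY m n).Point :=
  edgePt m n x.1.a x.1.b (x.2.1 0) (x.2.1 1)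

theorem rectToY_glue (hp : EvenGrid m n) (x y : Σ e : GridEdge m n, gridRect e)
    (h : RectGlue m n x y) : rectToY x = rectToY y := by
  cases h with
  | right_left e p q hp' hq h =>
    have h1 := mem_gridRect.1 p.2
    have h2 := edgePt_nextDir_even hp e.a_node e.a_even e.norm_sub h1.2.1 h1.2.2
    rw [← e.east_b, add_sub_cancel] at h2
    simp only [rectToY, hp', hq, h]
    exact h2
  | top_bottom e p q hp' hq h =>
    have h1 := mem_gridRect.1 p.2
    have h2 := edgePt_nextDir_odd hp e.b_node e.b_odd e.norm_sub' h1.1.1 h1.1.2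
    rw [← e.north_a, add_sub_cancel] at h2
    simp only [rectToY, hp', hq, h]
    exact h2

/-- The map `X → Y`. -/
def surfaceXToY (hp : EvenGrid m n) : (surfaceX m n).Point → (surfaceY m n).Point :=
  Quot.lift rectToY (rectToY_glue hp)

theorem derivMu_mulVec_add_shear (n : ℕ) (p : Plane) (x y : ℝ) :
    (derivMu n).mulVec p + shear n x y = shear n (x + p 0) (y + p 1) := by
  rw [shear_add, add_comm, shear, shear]
  congr 2
  exact plane_ext rfl rfl

theorem piecewiseAffine_surfaceXToY (hp : EvenGrid m n) :
    TiledSurface.PiecewiseAffine (surfaceX m n) (surfaceY m n) (derivMu n) (surfaceXToY hp) := by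
  intro (e : GridEdge m n)
  let ι := {x : Fin m × Fin (n + 1) × Fin (n + 1) //
    ((x.2.2 : ℕ) = x.2.1 → 1 ≤ (x.2.1 : ℕ) ∧ (x.2.1 : ℕ) < n) ∧ InBand x.2.1 x.2.2 ∧
      rowNode n x.1 x.2.1 = e.a ∧ colNode n x.1 x.2.2 = e.b}
  refine ⟨ι, inferInstance, fun l => {p | InCell n (sideLen m l.1.1) l.1.2.1 l.1.2.2
      (colPos n (sideLen m l.1.1) l.1.2.2 + p 0) (rowPos n (sideLen m l.1.1) l.1.2.1 + p 1)},
    fun l => l.1.1, fun l => shear n (colPos n (sideLen m l.1.1) l.1.2.2)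
      (rowPos n (sideLen m l.1.1) l.1.2.1),
    fun l => isClosed_inCell _ _ _ _ (continuous_const.add (continuous_apply 0))
      (continuous_const.add (continuous_apply 1)), ?_, ?_⟩
  · intro p h
    obtain ⟨⟨h0, h0'⟩, h1, h1'⟩ := mem_gridRect.1 h
    obtain ⟨k, r, c, hm⟩ := exists_matchesCell hp e h0 h0' h1 h1'
    exact ⟨⟨(⟨k, hm.lt⟩, ⟨r, Nat.lt_succ_of_le hm.row_le⟩, ⟨c, Nat.lt_succ_of_le hm.col_le⟩),
      hm.diag, hm.band, hm.row, hm.col⟩, hm.cell⟩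
  · rintro ⟨⟨k, r, c⟩, hdiag, hb, hrow, hcol⟩ p h hl
    have hm : MatchesCell m n e.a e.b (p 0) (p 1) k r c :=
      ⟨k.2, Nat.lt_succ_iff.1 r.2, Nat.lt_succ_iff.1 c.2, hdiag, hb, hrow, hcol, hl⟩
    simp only [derivMu_mulVec_add_shear]
    exact ⟨hm.mem hp, (edgePt_eq hp hm).trans (polyPt_eq k (hm.mem hp))⟩

/-- `P(m-1-k)` has the same side lengths as `P(k)` and the `ι`-images of its nodes. A point matching
the cell `(r, c)` of `P(k)` is thus carried to the same cell, with equal coordinates. -/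
theorem surfaceXToY_iotaStar (hp : EvenGrid m n) (q : (surfaceX m n).Point) :
    surfaceXToY hp (iotaStar hp.even_left hp.even_right q) =
      iotaStar' hp.even_left hp.even_right (surfaceXToY hp q) := by
  obtain ⟨⟨e, p, h⟩, rfl⟩ := (surfaceX m n).isQuotientMap_param.surjective q
  change GridEdge m n at e
  obtain ⟨⟨h0, h0'⟩, h1, h1'⟩ := mem_gridRect.1 h
  obtain ⟨k, r, c, hm⟩ := exists_matchesCell hp e h0 h0' h1 h1'
  have hlt : m - 1 - k < m := by have := hm.lt; omega
  have hm' : MatchesCell m n (e.iota hp.even_left hp.even_right).a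
      (e.iota hp.even_left hp.even_right).b (p 0) (p 1) (m - 1 - k) r c := by
    refine ⟨hlt, hm.row_le, hm.col_le, hm.diag, hm.band, ?_, ?_, ?_⟩
    · rw [rowNode_rev hp.even_left hm.lt, hm.row]; rfl
    · rw [colNode_rev hp.even_left hm.lt, hm.col]; rfl
    · rw [sideLen_rev hp.even_left hm.lt]; exact hm.cell
  have e1 : surfaceXToY hp ((surfaceX m n).param ⟨e, p, h⟩) =
      (surfaceY m n).param ⟨(⟨k, hm.lt⟩ : Fin m), ⟨_, hm.mem hp⟩⟩ :=
    (edgePt_eq hp hm).trans (polyPt_eq ⟨k, hm.lt⟩ (hm.mem hp))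
  have e2 : surfaceXToY hp (iotaStar hp.even_left hp.even_right
      ((surfaceX m n).param ⟨e, p, h⟩)) =
      (surfaceY m n).param ⟨(⟨m - 1 - k, hlt⟩ : Fin m), ⟨_, hm'.mem hp⟩⟩ :=
    (edgePt_eq hp hm').trans (polyPt_eq ⟨_, hlt⟩ (hm'.mem hp))
  rw [e1, e2]
  have cast : ∀ (k k' : Fin m) (_ : k = k') (v v' : Plane) (_ : v = v') (hv : v ∈ polyP m n k)
      (hv' : v' ∈ polyP m n k'), (surfaceY m n).param ⟨k, ⟨v, hv⟩⟩ =
        (surfaceY m n).param ⟨k', ⟨v', hv'⟩⟩ := by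
    rintro k _ rfl v _ rfl hv hv'; rfl
  refine cast _ _ (Fin.ext ?_) _ _ ?_ _ _
  · simp only [Fin.val_rev]; omega
  · simp only [sideLen_rev hp.even_left hm.lt]

/-! ### The two maps are mutually inverse -/

variable [Nonempty (surfaceX m n).Point]

theorem surfaceYToX_surfaceXToY (hp : EvenGrid m n) (q : (surfaceX m n).Point) :
    surfaceYToX hp (surfaceXToY hp q) = q := by
  obtain ⟨⟨e, p, h⟩, rfl⟩ := (surfaceX m n).isQuotientMap_param.surjective q
  obtain ⟨⟨h0, h0'⟩, h1, h1'⟩ := mem_gridRect.1 h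
  obtain ⟨k, r, c, hm⟩ := exists_matchesCell hp e h0 h0' h1 h1'
  have e1 : surfaceXToY hp ((surfaceX m n).param ⟨e, p, h⟩) =
      (surfaceY m n).param ⟨(⟨k, hm.lt⟩ : Fin m), ⟨_, hm.mem hp⟩⟩ :=
    (edgePt_eq hp hm).trans (polyPt_eq ⟨k, hm.lt⟩ (hm.mem hp))
  have hnode : IsGridNode m n (rowNode n k r) := hm.row ▸ e.a_node
  have hnode' : IsGridNode m n (colNode n k c) := hm.col ▸ e.b_node
  obtain ⟨⟨h2, h3⟩, h4, h5⟩ := isGridNode_rowNode.1 hnode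
  have e2 : surfaceYToX hp ((surfaceY m n).param ⟨(⟨k, hm.lt⟩ : Fin m), ⟨_, hm.mem hp⟩⟩) =
      cellPt m n k r c (colPos n (sideLen m k) c + p 0) (rowPos n (sideLen m k) r + p 1) :=
    polyToX_shear hp ⟨k, hm.lt⟩ (hm.mem hp) h4 h5 (sideLen_pos h2 h3) hm.band rfl hm.cell
  have h6 : ![p 0, p 1] ∈ gridRect e := mem_gridRect.2 ⟨⟨h0, h0'⟩, h1, h1'⟩
  rw [e1, e2, cellPt, evenPt, add_sub_cancel, if_pos hnode', hm.row, hm.col, add_sub_cancel_left,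
    add_sub_cancel_left, rectPt_eq e h6]
  exact surfaceX_param_congr rfl _ _ (plane_ext rfl rfl)

theorem surfaceXToY_rectPt (hp : EvenGrid m n) {a d : ℤ × ℤ} {u v : ℝ} (ha : IsGridNode m n a)
    (hae : Even (a.1 + a.2)) (hd : d.1 ^ 2 + d.2 ^ 2 = 1) (hb : IsGridNode m n (a + d))
    (hu : 0 ≤ u) (hu' : u ≤ gridWeight m n (a + d)) (hv : 0 ≤ v) (hv' : v ≤ gridWeight m n a) :
    surfaceXToY hp (rectPt m n a (a + d) u v) = edgePt m n a (a + d) u v := by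
  let e : GridEdge m n := GridEdge.ofNodes ha hb hae (even_add_of_odd_sub hae hd)
    (by rw [← hd, Prod.fst_add, Prod.snd_add]; ring)
  have h : ![u, v] ∈ gridRect e := mem_gridRect.2 ⟨⟨hu, hu'⟩, hv, hv'⟩
  change surfaceXToY hp (rectPt m n e.a e.b u v) = _
  rw [rectPt_eq e h]
  rfl

/-- Needed for cells in flat columns, which `evenPt` sends to the next rectangle. The chain of flat
cells in `Y` leads to the same point. -/
theorem surfaceXToY_evenPt (hp : EvenGrid m n) {a d : ℤ × ℤ} {u v : ℝ} (ha : IsGridNode m n a)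
    (hae : Even (a.1 + a.2)) (hd : d.1 ^ 2 + d.2 ^ 2 = 1)
    (hu : 0 ≤ u) (hu' : u ≤ gridWeight m n (a + d)) (hv : 0 ≤ v) (hv' : v ≤ gridWeight m n a) :
    surfaceXToY hp (evenPt m n a d u v) = edgePt m n a (a + d) u v := by
  unfold evenPt
  split_ifs with h
  · exact surfaceXToY_rectPt hp ha hae hd h hu hu' hv hv'
  · have hw := gridWeight_add_eq_zero ha hd h
    have hmem := nextDir_mem (P := fun d => IsGridNode m n (a + d))
      (exists_neighbor hp ha a.1 hd)
    have hnorm := (nextDir_norm (fun d => IsGridNode m n (a + d)) a.1 d).trans hd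
    have hchain := edgePt_nextDir_even hp ha hae hd hv hv'
    rw [hw] at hu' hchain
    rw [le_antisymm hu' hu, hchain]
    exact surfaceXToY_rectPt hp ha hae hnorm hmem le_rfl (gridWeight_pos hmem).le hv hv'

theorem surfaceXToY_surfaceYToX (hp : EvenGrid m n) (q : (surfaceY m n).Point) :
    surfaceXToY hp (surfaceYToX hp q) = q := by
  have hn2 := hp.two_le_right
  obtain ⟨⟨k, p, h⟩, rfl⟩ := (surfaceY m n).isQuotientMap_param.surjective q
  change Fin m at k
  obtain ⟨r, c, h1, h2, hs, hb, hc⟩ := exists_inCell_polyP hp k.2 h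
  have hcn : c ≤ n := by unfold InBand at hb; omega
  have e1 : surfaceYToX hp ((surfaceY m n).param ⟨k, p, h⟩) =
      cellPt m n k r c (unshear n p) (p 1) := polyToX_eq hp k h h1 h2 hs hb hc
  obtain ⟨⟨hx, hx'⟩, ⟨hy, hy'⟩, -⟩ := id hc
  rw [colPos_succ] at hx'
  rw [rowPos_succ] at hy'
  have hm : MatchesCell m n (rowNode n k r) (colNode n k c)
      (unshear n p - colPos n (sideLen m k) c) (p 1 - rowPos n (sideLen m k) r) k r c :=
    ⟨k.2, h2.le, hcn, fun _ => ⟨h1, h2⟩, hb, rfl, rfl, by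
      rwa [add_sub_cancel, add_sub_cancel]⟩
  rw [e1, cellPt, surfaceXToY_evenPt hp (isGridNode_rowNode_of_pos k.2 h1 h2 hs)
    (even_rowNode hp.even_right r) (norm_row_direction hb) (by linarith)
    (by rw [add_sub_cancel, gridWeight_colNode hn2]; linarith) (by linarith)
    (by rw [gridWeight_rowNode hn2]; linarith), add_sub_cancel, edgePt_eq hp hm, add_sub_cancel,
    add_sub_cancel, shear_unshear hn2]
  exact polyPt_eq k h

end

/-! ### The reflection from `X_{m,n}` to `X_{n,m}`, and the affine homeomorphisms -/

noncomputable section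

variable {m n : ℕ}

/-- Transposition reverses the orientation of the plane; a reversed parity of the first coordinate
compensates this. -/
theorem swap_turn {i j : ℤ} (h : Even j ↔ ¬ Even i) (d : ℤ × ℤ) :
    turn j d.swap = (turn i d).swap := by
  by_cases hi : Even i <;> simp [turn, h, hi]

theorem swap_nextDir {P Q : ℤ × ℤ → Prop} [DecidablePred P] [DecidablePred Q]
    (hPQ : ∀ d, Q d.swap ↔ P d) {i j : ℤ} (h : Even j ↔ ¬ Even i) (d : ℤ × ℤ) :
    nextDir Q j d.swap = (nextDir P i d).swap := by
  simp only [nextDir, swap_turn h, hPQ]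
  split_ifs <;> rfl

theorem isGridNode_swap {v : ℤ × ℤ} : IsGridNode n m v.swap ↔ IsGridNode m n v := by
  unfold IsGridNode
  simp only [Prod.fst_swap, Prod.snd_swap]
  tauto

theorem gridWeight_swap (m n : ℕ) (v : ℤ × ℤ) : gridWeight n m v.swap = gridWeight m n v :=
  mul_comm _ _

namespace GridEdge

/-- The edge of the transposed grid. -/
def transpose (e : GridEdge m n) : GridEdge n m where
  a := e.a.swap
  b := e.b.swap
  a_node := isGridNode_swap.2 e.a_node
  b_node := isGridNode_swap.2 e.b_node
  a_even := by rw [Prod.fst_swap, Prod.snd_swap, add_comm]; exact e.a_even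
  b_odd := by rw [Prod.fst_swap, Prod.snd_swap, add_comm]; exact e.b_odd
  dist_one := by rw [← e.dist_one]; simp only [Prod.fst_swap, Prod.snd_swap]; ring

/-- At an even node both coordinates have the same parity, so transposition reverses the cyclic
order. At an odd node the parities differ and the order is kept. Thus `east` is inverted and `north`
preserved, as for a reflection in a vertical axis. -/
theorem east_transpose (e : GridEdge m n) : e.east.transpose.east = e.transpose := by
  rw [← Equiv.eq_symm_apply]
  apply GridEdge.ext
  · rfl
  · change (e.a + nextDir (fun d => IsGridNode m n (e.a + d)) (e.a.1 + 0) (e.b - e.a)).swap =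
      e.a.swap + nextDir (fun d => IsGridNode n m (e.a.swap + d)) (e.a.2 + 1) (e.b - e.a).swap
    rw [swap_nextDir (P := fun d => IsGridNode m n (e.a + d)) (i := e.a.1 + 0)
      (fun d => isGridNode_swap (v := e.a + d))]
    · rfl
    · rw [Int.even_add_one, add_zero, Int.even_add.1 e.a_even]

theorem north_transpose (e : GridEdge m n) : e.transpose.north = e.north.transpose := by
  apply GridEdge.ext
  · change e.b.swap + nextDir (fun d => IsGridNode n m (e.b.swap + d)) (e.b.2 + 0)
      (e.a - e.b).swap =
      (e.b + nextDir (fun d => IsGridNode m n (e.b + d)) (e.b.1 + 0) (e.a - e.b)).swap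
    rw [swap_nextDir (P := fun d => IsGridNode m n (e.b + d)) (i := e.b.1 + 0)
      (fun d => isGridNode_swap (v := e.b + d))]
    · rfl
    · have := e.b_odd
      rw [← Int.not_even_iff_odd, Int.even_add] at this
      simp only [add_zero]; tauto
  · rfl

theorem flip_mem_gridRect (e : GridEdge m n) {v : Plane} (hv : v ∈ gridRect e) :
    ![gridWeight m n e.b - v 0, v 1] ∈ gridRect e.transpose := by
  obtain ⟨⟨h1, h2⟩, h3, h4⟩ := mem_gridRect.1 hv
  simp only [mem_gridRect, transpose, gridWeight_swap, Matrix.cons_val_zero, Matrix.cons_val_one]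
  exact ⟨⟨by linarith, by linarith⟩, h3, h4⟩

end GridEdge

/-- The reflection of the rectangles of `X_{m,n}` onto those of `X_{n,m}`. -/
def flipRect (x : Σ e : GridEdge m n, gridRect e) : (surfaceX n m).Point :=
  (surfaceX n m).param ⟨x.1.transpose, _, x.1.flip_mem_gridRect x.2.2⟩

theorem flipRect_glue (x y : Σ e : GridEdge m n, gridRect e) (h : RectGlue m n x y) :
    flipRect x = flipRect y := by
  cases h with
  | right_left e p q hp hq h =>
    have hmem : ![gridWeight m n e.b - p.1 0, p.1 1] ∈ gridRect e.east.transpose.east := by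
      rw [e.east_transpose]; exact e.flip_mem_gridRect p.2
    have := Quot.sound (RectGlue.right_left e.east.transpose
      ⟨_, e.east.flip_mem_gridRect q.2⟩ ⟨_, hmem⟩ ?_ ?_ ?_)
    · refine Eq.trans ?_ this.symm
      exact surfaceX_param_congr e.east_transpose.symm _ _ rfl
    · simp only [Matrix.cons_val_zero, hq, sub_zero, GridEdge.transpose, gridWeight_swap]
    · simp [hp]
    · simp [h]
  | top_bottom e p q hp hq h =>
    have hmem : ![gridWeight m n e.b - q.1 0, q.1 1] ∈ gridRect e.transpose.north := by
      rw [e.north_transpose]; exact e.north.flip_mem_gridRect q.2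
    have := Quot.sound (RectGlue.top_bottom e.transpose
      ⟨_, e.flip_mem_gridRect p.2⟩ ⟨_, hmem⟩ ?_ ?_ ?_)
    · refine this.trans ?_
      exact surfaceX_param_congr e.north_transpose _ _ rfl
    · simp only [Matrix.cons_val_one, hp, GridEdge.transpose, gridWeight_swap]
      rfl
    · simp [hq]
    · simp [h]

/-- The reflection `X_{m,n} → X_{n,m}`. -/
def flipX (m n : ℕ) : (surfaceX m n).Point → (surfaceX n m).Point :=
  Quot.lift flipRect flipRect_glue

/-- The derivative of the reflection. -/
def derivFlip : Matrix (Fin 2) (Fin 2) ℝ := !![-1, 0; 0, 1]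

theorem derivFlip_mul_self : derivFlip * derivFlip = 1 := by
  ext i j; fin_cases i <;> fin_cases j <;> simp [derivFlip]

theorem piecewiseAffine_flipX (m n : ℕ) :
    TiledSurface.PiecewiseAffine (surfaceX m n) (surfaceX n m) derivFlip (flipX m n) := by
  intro e
  change GridEdge m n at e
  refine ⟨Unit, inferInstance, fun _ => Set.univ, fun _ => e.transpose,
    fun _ => ![gridWeight m n e.b, 0], fun _ => isClosed_univ, fun _ _ => ⟨(), trivial⟩,
    fun _ y hy _ => ?_⟩
  have h : derivFlip.mulVec y + ![gridWeight m n e.b, 0] = ![gridWeight m n e.b - y 0, y 1] := by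
    refine plane_ext ?_ ?_ <;> simp [derivFlip, dotProduct]
    ring
  have hmem := e.flip_mem_gridRect hy
  exact ⟨h ▸ hmem, surfaceX_param_congr rfl _ _ h.symm⟩

theorem flipX_flipX (m n : ℕ) (q : (surfaceX m n).Point) : flipX n m (flipX m n q) = q := by
  obtain ⟨⟨e, p, h⟩, rfl⟩ := (surfaceX m n).isQuotientMap_param.surjective q
  refine surfaceX_param_congr (GridEdge.ext (Prod.swap_swap _) (Prod.swap_swap _)) _ _
    (plane_ext ?_ ?_)
  · simp [GridEdge.transpose, gridWeight_swap]
  · simp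

theorem flipX_iotaStar (hm : Even m) (hn : Even n) (q : (surfaceX m n).Point) :
    flipX m n (iotaStar hm hn q) = iotaStar hn hm (flipX m n q) := by
  obtain ⟨⟨e, p, h⟩, rfl⟩ := (surfaceX m n).isQuotientMap_param.surjective q
  refine surfaceX_param_congr rfl _ _ (plane_ext ?_ rfl)
  simp [iotaRect, GridEdge.iota, gridWeight_iotaNode e.b_node]

theorem derivMu_mul_derivMuInv (hn : 2 ≤ n) : derivMu n * derivMuInv n = 1 := by
  have := (sin_pi_div_pos hn).ne'
  ext i j
  fin_cases i <;> fin_cases j <;> simp [derivMu, derivMuInv, Real.cot_eq_cos_div_sin, this]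
  field_simp; ring

theorem derivMuInv_mul_derivMu (hn : 2 ≤ n) : derivMuInv n * derivMu n = 1 :=
  mul_eq_one_comm.1 (derivMu_mul_derivMuInv hn)

theorem derivMu_mul_derivFlip (n : ℕ) : derivMu n * derivFlip = derivNu n := by
  ext i j
  fin_cases i <;> fin_cases j <;> simp [derivMu, derivNu, derivFlip]

theorem EvenGrid.symm (hp : EvenGrid m n) : EvenGrid n m :=
  ⟨hp.two_le_right, hp.two_le_left, mul_comm m n ▸ hp.six_le, hp.even_right, hp.even_left⟩

theorem EvenGrid.nonempty_surfaceY (hp : EvenGrid m n) : Nonempty (surfaceY m n).Point :=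
  have hm := hp.two_le_left
  have hn := hp.two_le_right
  ⟨(surfaceY m n).param ⟨(⟨0, by omega⟩ : Fin m), _,
    subset_convexHull ℝ _ (Set.mem_range_self (⟨0, by omega⟩ : Fin (2 * n)))⟩⟩

theorem EvenGrid.nonempty_surfaceX (hp : EvenGrid m n) : Nonempty (surfaceX m n).Point := by
  have hm := hp.two_le_left
  have hn := hp.two_le_right
  have hv : IsGridNode m n ((1, 1) : ℤ × ℤ) := by unfold IsGridNode; simp only; omega
  have key : ∀ d : ℤ × ℤ, d.1 ^ 2 + d.2 ^ 2 = 1 → IsGridNode m n ((1, 1) + d) →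
      Nonempty (surfaceX m n).Point := by
    intro d hd hb
    have hae : Even (((1, 1) : ℤ × ℤ).1 + ((1, 1) : ℤ × ℤ).2) := ⟨1, rfl⟩
    let e : GridEdge m n := GridEdge.ofNodes hv hb hae (even_add_of_odd_sub hae hd)
      (by rw [← hd, Prod.fst_add, Prod.snd_add]; ring)
    exact ⟨(surfaceX m n).param ⟨e, ![0, 0], mem_gridRect.2
      ⟨⟨le_rfl, (gridWeight_pos e.b_node).le⟩, le_rfl, (gridWeight_pos e.a_node).le⟩⟩⟩
  have hd : ((1, 0) : ℤ × ℤ).1 ^ 2 + ((1, 0) : ℤ × ℤ).2 ^ 2 = 1 := rfl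
  have ht := fun d => isGridNode_add_turn_norm (i := 0) (d := d)
  rcases exists_neighbor hp hv 0 hd with h | h | h | h
  · exact key _ hd h
  · exact key _ (ht _ hd) h
  · exact key _ (ht _ (ht _ hd)) h
  · exact key _ (ht _ (ht _ (ht _ hd))) h

/-! ### Assembling the affine homeomorphisms -/

namespace TiledSurface

variable {S T : TiledSurface} {D E : Matrix (Fin 2) (Fin 2) ℝ}

/-- Mutually inverse maps that are piecewise affine and equivariant induce affine homeomorphisms,
also of the quotients. -/
theorem exists_isAffineHomeo_quotient {f : S.Point → T.Point} {g : T.Point → S.Point}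
    {a : S.Point ≃ₜ S.Point} {b : T.Point ≃ₜ T.Point} (hDE : D * E = 1) (hED : E * D = 1)
    (hf : PiecewiseAffine S T D f) (hg : PiecewiseAffine T S E g) (hgf : ∀ x, g (f x) = x)
    (hfg : ∀ y, f (g y) = y) (hab : ∀ x, f (a x) = b (f x))
    (hS : {p | ¬ S.IsRegularPoint p}.Finite)
    (hSa : {p | ¬ (S.quotient a).IsRegularPoint p}.Finite) :
    ∃ (μ : S.Point ≃ₜ T.Point) (μe : (S.quotient a).Point ≃ₜ (T.quotient b).Point),
      S.IsAffineHomeo T μ D ∧ (S.quotient a).IsAffineHomeo (T.quotient b) μe D := by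
  have h1 : ∀ x y, a x = y → b (f x) = f y := by rintro x _ rfl; exact (hab x).symm
  have h2 : ∀ x y, b x = y → a (g x) = g y := by
    rintro x _ rfl; rw [← hgf (a (g x)), hab, hfg]
  have hf' := hf.quotient_map h1
  have hg' := hg.quotient_map h2
  refine ⟨⟨⟨f, g, hgf, hfg⟩, hf.continuous, hg.continuous⟩,
    ⟨⟨Quot.map f h1, Quot.map g h2, ?_, ?_⟩, hf'.continuous, hg'.continuous⟩,
    isAffineHomeo_of_piecewiseAffine hDE hED hf hg hS,
    isAffineHomeo_of_piecewiseAffine hDE hED hf' hg' hSa⟩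
  · rintro ⟨x⟩; exact congrArg (Quot.mk _) (hgf x)
  · rintro ⟨x⟩; exact congrArg (Quot.mk _) (hfg x)

end TiledSurface

end

theorem mainTheorem12 (m n : ℕ) (hm2 : 2 ≤ m) (hn2 : 2 ≤ n) (hmn : 6 ≤ m * n)
    (hm : Even m) (hn : Even n) :
    (∃ (μ : (surfaceX m n).Point ≃ₜ (surfaceY m n).Point)
        (μe : (surfaceXe hm hn).Point ≃ₜ (surfaceYe hm hn).Point),
        TiledSurface.IsAffineHomeo (surfaceX m n) (surfaceY m n) μ (derivMu n) ∧
        TiledSurface.IsAffineHomeo (surfaceXe hm hn) (surfaceYe hm hn) μe (derivMu n)) ∧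
    (∃ (ν : (surfaceX m n).Point ≃ₜ (surfaceY n m).Point)
        (νe : (surfaceXe hm hn).Point ≃ₜ (surfaceYe hn hm).Point),
        TiledSurface.IsAffineHomeo (surfaceX m n) (surfaceY n m) ν (derivNu m) ∧
        TiledSurface.IsAffineHomeo (surfaceXe hm hn) (surfaceYe hn hm) νe (derivNu m)) := by
  have hp : EvenGrid m n := ⟨hm2, hn2, hmn, hm, hn⟩
  have := hp.nonempty_surfaceX
  have := hp.nonempty_surfaceY
  have := hp.symm.nonempty_surfaceX
  have := hp.symm.nonempty_surfaceY
  constructor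
  · exact TiledSurface.exists_isAffineHomeo_quotient (derivMu_mul_derivMuInv hn2)
      (derivMuInv_mul_derivMu hn2) (piecewiseAffine_surfaceXToY hp) (piecewiseAffine_surfaceYToX hp)
      (surfaceYToX_surfaceXToY hp) (surfaceXToY_surfaceYToX hp) (surfaceXToY_iotaStar hp)
      (finite_not_isRegularPoint_surfaceX m n) (finite_not_isRegularPoint_surfaceXe hm hn)
  -- `ν` is the reflection onto `X_{n,m}` followed by `μ` for the transposed parameters; the
  -- derivative is the product `derivMu m * derivFlip`.
  · have hf := (piecewiseAffine_surfaceXToY hp.symm).comp (piecewiseAffine_flipX m n)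
    have hg := (piecewiseAffine_flipX n m).comp (piecewiseAffine_surfaceYToX hp.symm)
    have hDE : derivMu m * derivFlip * (derivFlip * derivMuInv m) = 1 := by
      rw [← mul_assoc, mul_assoc (derivMu m), derivFlip_mul_self, mul_one,
        derivMu_mul_derivMuInv hm2]
    rw [← derivMu_mul_derivFlip]
    refine TiledSurface.exists_isAffineHomeo_quotient hDE (mul_eq_one_comm.1 hDE) hf hg
      (fun x => ?_) (fun y => ?_) (fun x => ?_)
      (finite_not_isRegularPoint_surfaceX m n) (finite_not_isRegularPoint_surfaceXe hm hn)
    · simp only [Function.comp_apply, surfaceYToX_surfaceXToY, flipX_flipX]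
    · simp only [Function.comp_apply, surfaceXToY_surfaceYToX, flipX_flipX]
    · simp only [Function.comp_apply, flipX_iotaStar hm hn, surfaceXToY_iotaStar hp.symm]
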